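/- Let $d\ge 2$ be an integer and let $\sigma\ge 1$, $\kappa\ge 0$ be real constants. There are an algorithm $A$ and a constant $C>0$ (both depending only on $d,\sigma,\kappa$) such that the following holds for every real $\alpha\ge 1$, every $n\ge 1$ and every family $o_1,\dots,o_n$ of bounded subsets of $\mathbb R^d$ ("objects") that is * similarly sized: $\operatorname{diam}(o_i)\le\sigma\operatorname{diam}(o_j)$ for all $i,j$, and * $\alpha$-stabbed: for every $r\in\mathbb R$ and every ball $B$ of radius $r$ there is a set of at most $\alpha^d$ points that meets every object $o_i\subseteq B$ with $\operatorname{diam}(o_i)\in[r/2,r)$. Given $n$, the adjacency matrix of the intersection graph of the family (vertices $1,\dots,n$; $i\neq j$ adjacent iff $o_i\cap o_j\ne\emptyset$), and for each object $o_i$ a point $p_i\in\mathbb R^d$ locating it, i.e. a point at distance at most $\kappa\operatorname{diam}(o_i)$ from some point of $o_i$ (for example a point of $o_i$, or the centre of a circumscribed ball), the algorithm $A$ computes a maximum independent set of the intersection graph in at most $2^{C\,n^{1-1/d}\alpha}$ steps, that is, in time $2^{O(n^{1-1/d}\alpha)}$ where the hidden constant does not depend on $\alpha$. Here an algorithm is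 a program for a unit-cost random access machine with an integer memory and a real memory, whose elementary operations are constants, addition, (truncated) subtraction, indirect loading and storing of natural numbers, addition, subtraction, indirect loading and storing of real numbers, and branching and looping on comparisons. The program is not given $\alpha$. -/

import Mathlib

/-! ### Intersection graphs, similarly sized families, stabbed families -/

/-- The intersection graph of a family of sets: the vertices are the indices, and two distinct
indices are adjacent iff the corresponding sets have a common point. -/
def intersectionGraph {ι X : Type*} (o : ι → Set X) : SimpleGraph ι where
  Adj i j := i ≠ j ∧ (o i ∩ o j).Nonempty
  symm := ⟨fun _ _ h => ⟨h.1.symm, Set.inter_comm _ _ ▸ h.2⟩⟩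
  loopless := ⟨fun _ h => h.1 rfl⟩

/-- A family of objects is similarly sized with ratio `σ` if no diameter exceeds `σ` times another
one. (Only used for bounded objects, where `Metric.diam` is the true diameter.) -/
def SimilarlySized {ι X : Type*} [PseudoMetricSpace X] (σ : ℝ) (o : ι → Set X) : Prop :=
  ∀ i j, Metric.diam (o i) ≤ σ * Metric.diam (o j)

/-- A family of objects in `ℝ^d` is `α`-stabbed if for every `r`, the objects whose diameter lies
in `[r/2, r)` and that are contained in a given ball of radius `r` can be stabbed by `α ^ d`
points. -/
def IsStabbed {ι : Type*} {d : ℕ} (α : ℝ) (o : ι → Set (EuclideanSpace ℝ (Fin d))) : Prop :=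
  ∀ (r : ℝ) (c : EuclideanSpace ℝ (Fin d)),
    ∃ S : Finset (EuclideanSpace ℝ (Fin d)), (S.card : ℝ) ≤ α ^ d ∧
      ∀ i, r / 2 ≤ Metric.diam (o i) → Metric.diam (o i) < r → o i ⊆ Metric.ball c r →
        ∃ x ∈ S, x ∈ o i

/-- The points `p i` locate the objects `o i` up to the factor `κ`: `p i` is within distance
`κ * diam (o i)` of some point of `o i`. For instance `p i ∈ o i` is such a location with `κ = 0`,
and a corner of the bounding box of `o i` or the centre of its circumscribed ball is one for some
`κ` depending on `d` only. -/
def Locates {ι X : Type*} [PseudoMetricSpace X] (κ : ℝ) (p : ι → X) (o : ι → Set X) : Prop :=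
  ∀ i, ∃ x ∈ o i, dist (p i) x ≤ κ * Metric.diam (o i)

/-! ### A random access machine with integer and real memory -/

namespace RealRAM

/-- A state of the machine: registers and an addressable memory for natural numbers, and registers
and an addressable memory for real numbers. -/
@[ext]
structure State where
  /-- natural-number registers -/
  reg : ℕ → ℕ
  /-- natural-number memory -/
  mem : ℕ → ℕ
  /-- real registers -/
  rreg : ℕ → ℝ
  /-- real memory -/
  rmem : ℕ → ℝ

/-- Programs. The only operations on numbers are addition, subtraction (truncated on natural
numbers) and comparison; there is no multiplication, division or rounding. -/
inductive Program where
  /-- do nothing -/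
  | skip
  /-- `reg a := k` -/
  | const (a k : ℕ)
  /-- `reg a := reg b + reg c` -/
  | add (a b c : ℕ)
  /-- `reg a := reg b - reg c` -/
  | sub (a b c : ℕ)
  /-- `reg a := mem (reg b)` -/
  | load (a b : ℕ)
  /-- `mem (reg a) := reg b` -/
  | store (a b : ℕ)
  /-- `rreg a := rreg b + rreg c` -/
  | radd (a b c : ℕ)
  /-- `rreg a := rreg b - rreg c` -/
  | rsub (a b c : ℕ)
  /-- `rreg a := rmem (reg b)` -/
  | rload (a b : ℕ)
  /-- `rmem (reg a) := rreg b` -/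
  | rstore (a b : ℕ)
  /-- sequential composition -/
  | seq (P Q : Program)
  /-- if `reg a < reg b` then `P` else `Q` -/
  | ifLt (a b : ℕ) (P Q : Program)
  /-- if `rreg a < rreg b` then `P` else `Q` -/
  | ifRLt (a b : ℕ) (P Q : Program)
  /-- while `reg a < reg b` do `P` -/
  | whileLt (a b : ℕ) (P : Program)

/-- `Runs P s s' t`: the program `P`, started in state `s`, halts in state `s'` after exactly `t`
time units. Every elementary instruction and every test takes one time unit. -/
inductive Runs : Program → State → State → ℕ → Prop
  | skip (s : State) : Runs .skip s s 1
  | const (a k : ℕ) (s : State) :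
      Runs (.const a k) s { s with reg := Function.update s.reg a k } 1
  | add (a b c : ℕ) (s : State) :
      Runs (.add a b c) s { s with reg := Function.update s.reg a (s.reg b + s.reg c) } 1
  | sub (a b c : ℕ) (s : State) :
      Runs (.sub a b c) s { s with reg := Function.update s.reg a (s.reg b - s.reg c) } 1
  | load (a b : ℕ) (s : State) :
      Runs (.load a b) s { s with reg := Function.update s.reg a (s.mem (s.reg b)) } 1
  | store (a b : ℕ) (s : State) :
      Runs (.store a b) s { s with mem := Function.update s.mem (s.reg a) (s.reg b) } 1
  | radd (a b c : ℕ) (s : State) :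
      Runs (.radd a b c) s { s with rreg := Function.update s.rreg a (s.rreg b + s.rreg c) } 1
  | rsub (a b c : ℕ) (s : State) :
      Runs (.rsub a b c) s { s with rreg := Function.update s.rreg a (s.rreg b - s.rreg c) } 1
  | rload (a b : ℕ) (s : State) :
      Runs (.rload a b) s { s with rreg := Function.update s.rreg a (s.rmem (s.reg b)) } 1
  | rstore (a b : ℕ) (s : State) :
      Runs (.rstore a b) s { s with rmem := Function.update s.rmem (s.reg a) (s.rreg b) } 1
  | seq {P Q : Program} {s s' s'' : State} {t t' : ℕ} :
      Runs P s s' t → Runs Q s' s'' t' → Runs (.seq P Q) s s'' (t + t')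
  | ifLt_true {a b : ℕ} {P Q : Program} {s s' : State} {t : ℕ} :
      s.reg a < s.reg b → Runs P s s' t → Runs (.ifLt a b P Q) s s' (t + 1)
  | ifLt_false {a b : ℕ} {P Q : Program} {s s' : State} {t : ℕ} :
      ¬ s.reg a < s.reg b → Runs Q s s' t → Runs (.ifLt a b P Q) s s' (t + 1)
  | ifRLt_true {a b : ℕ} {P Q : Program} {s s' : State} {t : ℕ} :
      s.rreg a < s.rreg b → Runs P s s' t → Runs (.ifRLt a b P Q) s s' (t + 1)
  | ifRLt_false {a b : ℕ} {P Q : Program} {s s' : State} {t : ℕ} :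
      ¬ s.rreg a < s.rreg b → Runs Q s s' t → Runs (.ifRLt a b P Q) s s' (t + 1)
  | while_true {a b : ℕ} {P : Program} {s s' s'' : State} {t t' : ℕ} :
      s.reg a < s.reg b → Runs P s s' t → Runs (.whileLt a b P) s' s'' t' →
        Runs (.whileLt a b P) s s'' (t + t' + 1)
  | while_false {a b : ℕ} {P : Program} {s : State} :
      ¬ s.reg a < s.reg b → Runs (.whileLt a b P) s s 1

open Classical in
/-- The initial state on input a graph `G` with vertices `0, …, n - 1` and a point `p i` of `ℝ^d`
for each vertex `i`: register `0` contains `n`, memory cell `i * n + j` contains the entry `(i, j)`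
of the adjacency matrix, real memory cell `i * d + j` contains the `j`-th coordinate of `p i`, and
everything else is `0`. -/
noncomputable def input {n d : ℕ} (G : SimpleGraph (Fin n)) (p : Fin n → EuclideanSpace ℝ (Fin d)) :
    State where
  reg a := if a = 0 then n else 0
  mem a := if ∃ i j : Fin n, a = i * n + j ∧ G.Adj i j then 1 else 0
  rreg _ := 0
  rmem a := if h : ∃ ij : Fin n × Fin d, a = ij.1 * d + ij.2 then p h.choose.1 h.choose.2 else 0

/-- The set of vertices that a final state reports: those `i < n` whose memory cell `i` holds
`1`. -/
def output (n : ℕ) (s : State) : Finset (Fin n) :=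
  Finset.univ.filter fun i => s.mem i = 1

end RealRAM

/-!
A maximum independent set is found by dynamic programming along a layout (a linear order) of the
vertices. For an initial segment `P` of the layout, two independent subsets of `P` that have the
same neighbours outside of `P` (the same `key`) have the same extensions, so it suffices to keep one
largest set for every key (`IsFullTable`). The key depends only on the part of the set in the
boundary of `P`, hence the number of keys is at most the number of independent subsets of any set
`Y` that contains this boundary (`IsTable.length_le`). If `Y` has `N` vertices and is covered by `k`
cliques of sizes `t₁, t₂, …`, this number is at most `∏ (1 + tᵢ)`, and concavity bounds the product
by `exp (2 * k ^ (1 / d) * N ^ (1 - 1 / d))` (`CliqueCover.indCount_le` with `β = 1 - 1 / d`).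

The geometry supplies a layout all of whose boundaries are contained in such sets. Similarly sized
objects that intersect are located at distance at most `L`, which is proportional to the largest
diameter, and objects located within distance `L` of each other are covered by `m = O(α ^ d)`
cliques (`exists_locallyCovered`). Let `S` be a set of points and consider a smallest cube of radius
`R` about a point of `S` that contains a constant fraction of `S`. The concentric cube of radius
`2 * R` contains at most half of `S`, since it consists of a bounded number of smaller cubes
(`IsDenseCube.two_mul_card_cube_le`). If `R ≤ 2 * L`, the cube itself is covered by `O(m)` cliques.
Otherwise some shell of width `L` between the radii `R` and `2 * R` contains only `O(|S| * L / R)`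
points, and these lie in `O((R / L) ^ (d - 1))` cells of side `L`; the powers of `R / L` cancel in
the bound for the number of independent subsets (`IsDenseCube.indCount_shell_le`). In both cases
there is a separator with `exp (O(m ^ (1 / d) * |S| ^ (1 - 1 / d)))` independent subsets, and there
are no edges between the two parts it leaves, each of which lacks a constant fraction of `S`.
Putting the separator first and treating the parts recursively gives the layout. The numbers of
independent subsets multiply along the recursion, and the exponents form a geometric series, so all
the boundaries satisfy the same bound up to the constant (`LayoutInv.split`,
`LayoutInv.geometric_split`). Since `m ^ (1 / d) = O(α)`, this is `2 ^ O(n ^ (1 - 1 / d) * α)`, and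
it absorbs the polynomial factors of the running time because `n ^ (1 - 1 / d) ≥ n ^ (1 / 2)`.

The algorithm only compares distances and counts points. It knows neither `α` nor `m`, and it uses
for `L` the largest distance between the points of adjacent vertices, which can only be smaller
than the bound above. To avoid square roots, distances in `Fin d → ℝ` are sup-norm distances. The
recursion is run with a stack: the vertices that are not yet in the layout are labelled with the
number of their group, and the group with the largest number is divided next.

Programs are verified through `Exec P s Q`, the statement that `P` started in the state `s` halts in
a state and after a time satisfying `Q`.
-/

set_option linter.unusedSectionVars false

namespace StabbedMIS

open Finset RealRAM
open scoped Classical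

/-! ### Counting independent sets -/

section Counting

variable {V : Type*} [DecidableEq V] {G : SimpleGraph V}

/-- The number of independent subsets of `X`. -/
noncomputable def indCount (G : SimpleGraph V) (X : Finset V) : ℕ :=
  (X.powerset.filter fun I : Finset V => G.IsIndepSet (I : Set V)).card

theorem mem_indep_filter {X I : Finset V} :
    I ∈ X.powerset.filter (fun I : Finset V => G.IsIndepSet (I : Set V)) ↔
      I ⊆ X ∧ G.IsIndepSet (I : Set V) := by
  simp

theorem isIndepSet_mono {I J : Finset V} (h : I ⊆ J) (hJ : G.IsIndepSet (J : Set V)) :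
    G.IsIndepSet (I : Set V) :=
  Set.Pairwise.mono (by exact_mod_cast h) hJ

theorem indCount_mono {X Y : Finset V} (h : X ⊆ Y) : indCount G X ≤ indCount G Y := by
  refine card_le_card fun I hI => ?_
  rw [mem_indep_filter] at hI ⊢
  exact ⟨hI.1.trans h, hI.2⟩

@[simp] theorem indCount_empty : indCount G ∅ = 1 := by
  simp [indCount, SimpleGraph.IsIndepSet, filter_singleton]

theorem indCount_union_le (X Y : Finset V) :
    indCount G (X ∪ Y) ≤ indCount G X * indCount G Y := by
  unfold indCount
  rw [← card_product]
  refine card_le_card_of_injOn (fun I => (I ∩ X, I ∩ Y)) ?_ ?_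
  · intro I hI
    have hI := mem_indep_filter.1 (mem_coe.1 hI)
    rw [mem_coe, mem_product]
    exact ⟨mem_indep_filter.2 ⟨inter_subset_right, isIndepSet_mono inter_subset_left hI.2⟩,
      mem_indep_filter.2 ⟨inter_subset_right, isIndepSet_mono inter_subset_left hI.2⟩⟩
  · intro I hI J hJ hIJ
    have hI := mem_indep_filter.1 (mem_coe.1 hI)
    have hJ := mem_indep_filter.1 (mem_coe.1 hJ)
    have h1 : I ∩ X = J ∩ X := (Prod.ext_iff.1 hIJ).1
    have h2 : I ∩ Y = J ∩ Y := (Prod.ext_iff.1 hIJ).2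
    rw [← inter_eq_left.2 hI.1, ← inter_eq_left.2 hJ.1, inter_union_distrib_left,
      inter_union_distrib_left, h1, h2]

theorem indCount_clique_le {X : Finset V} (h : ∀ u ∈ X, ∀ v ∈ X, u ≠ v → G.Adj u v) :
    indCount G X ≤ X.card + 1 := by
  have : X.powerset.filter (fun I : Finset V => G.IsIndepSet (I : Set V)) ⊆
      insert ∅ (X.image fun v => ({v} : Finset V)) := by
    intro I hI
    rw [mem_indep_filter] at hI
    rcases I.eq_empty_or_nonempty with rfl | ⟨v, hv⟩
    · exact mem_insert_self _ _
    · refine mem_insert_of_mem (mem_image.2 ⟨v, hI.1 hv, ?_⟩)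
      refine (eq_singleton_iff_unique_mem.2 ⟨hv, fun u hu => ?_⟩).symm
      by_contra huv
      exact hI.2 hu hv huv (h u (hI.1 hu) v (hI.1 hv) huv)
  refine (card_le_card this).trans ((card_insert_le _ _).trans ?_)
  exact Nat.succ_le_succ card_image_le

theorem indCount_biUnion_le {ι : Type*} (s : Finset ι) (F : ι → Finset V) :
    indCount G (s.biUnion F) ≤ ∏ i ∈ s, indCount G (F i) := by
  induction s using Finset.induction_on with
  | empty => simp
  | insert a s ha ih =>
    rw [biUnion_insert, prod_insert ha]
    exact (indCount_union_le _ _).trans (Nat.mul_le_mul_left _ ih)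

/-- `X` can be covered by at most `q` cliques: the colour classes of `f` on `X` are cliques. -/
def CliqueCover (G : SimpleGraph V) (X : Finset V) (q : ℝ) : Prop :=
  ∃ f : V → ℕ, ((X.image f).card : ℝ) ≤ q ∧
    ∀ u ∈ X, ∀ v ∈ X, u ≠ v → f u = f v → G.Adj u v

/-- An injective numbering of the elements of a finite set. -/
theorem exists_injOn_nat {γ : Type*} (A : Finset γ) : ∃ e : γ → ℕ, Set.InjOn e A := by
  refine ⟨fun y => if h : y ∈ A then (A.equivFin ⟨y, h⟩ : ℕ) else 0, fun x hx y hy hxy => ?_⟩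
  have hx : x ∈ A := hx
  have hy : y ∈ A := hy
  simp only [hx, hy, dif_pos] at hxy
  simpa using A.equivFin.injective (Fin.ext hxy)

theorem CliqueCover.of_map {X : Finset V} {γ : Type*} [DecidableEq γ] (f : V → γ) {q : ℝ}
    (hq : ((X.image f).card : ℝ) ≤ q)
    (h : ∀ u ∈ X, ∀ v ∈ X, u ≠ v → f u = f v → G.Adj u v) : CliqueCover G X q := by
  obtain ⟨e, he⟩ := exists_injOn_nat (X.image f)
  refine ⟨e ∘ f, ?_, fun u hu v hv huv hef => h u hu v hv huv
    (he (mem_coe.2 (mem_image_of_mem _ hu)) (mem_coe.2 (mem_image_of_mem _ hv)) hef)⟩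
  rw [← image_image]
  exact (Nat.cast_le.2 card_image_le).trans hq

theorem CliqueCover.of_fibers {X : Finset V} {γ : Type*} [DecidableEq γ] (g : V → γ) {c m : ℝ}
    (hc : ((X.image g).card : ℝ) ≤ c) (hm : 0 ≤ m)
    (h : ∀ a ∈ X.image g, CliqueCover G (X.filter fun u => g u = a) m) :
    CliqueCover G X (c * m) := by
  have h' : ∀ a, ∃ f : V → ℕ, a ∈ X.image g →
      (((X.filter fun u => g u = a).image f).card : ℝ) ≤ m ∧
      ∀ u ∈ X, ∀ v ∈ X, g u = a → g v = a → u ≠ v → f u = f v → G.Adj u v := by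
    intro a
    by_cases ha : a ∈ X.image g
    · obtain ⟨f, hf, hf'⟩ := h a ha
      exact ⟨f, fun _ => ⟨hf, fun u hu v hv hua hva =>
        hf' u (mem_filter.2 ⟨hu, hua⟩) v (mem_filter.2 ⟨hv, hva⟩)⟩⟩
    · exact ⟨fun _ => 0, fun h => absurd h ha⟩
  choose F hF using h'
  refine CliqueCover.of_map (fun u => (g u, F (g u) u)) ?_ ?_
  · have hsub : X.image (fun u => (g u, F (g u) u)) ⊆
        (X.image g).biUnion fun a =>
          ((X.filter fun u => g u = a).image (F a)).image (Prod.mk a) := by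
      intro y hy
      obtain ⟨u, hu, rfl⟩ := mem_image.1 hy
      exact mem_biUnion.2 ⟨g u, mem_image_of_mem _ hu,
        mem_image_of_mem _ (mem_image_of_mem _ (mem_filter.2 ⟨hu, rfl⟩))⟩
    have h1 : ((X.image fun u => (g u, F (g u) u)).card : ℝ) ≤
        ∑ a ∈ X.image g, (((X.filter fun u => g u = a).image (F a)).card : ℝ) := by
      have h2 := (card_le_card hsub).trans card_biUnion_le
      refine (Nat.cast_le.2 h2).trans ?_
      rw [Nat.cast_sum]
      exact sum_le_sum fun a _ => Nat.cast_le.2 card_image_le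
    refine h1.trans ((sum_le_card_nsmul _ _ m fun a ha => (hF a ha).1).trans ?_)
    rw [nsmul_eq_mul]
    exact mul_le_mul_of_nonneg_right hc hm
  · intro u hu v hv huv huv'
    obtain ⟨h1, h2⟩ := Prod.mk_inj.1 huv'
    exact (hF (g u) (mem_image_of_mem _ hu)).2 u hu v hv rfl h1.symm huv (h2.trans (by rw [h1]))

theorem one_add_le_exp_rpow {x β : ℝ} (hx : 0 ≤ x) (hβ : 1 / 2 ≤ β) (hβ1 : β ≤ 1) :
    1 + x ≤ Real.exp (2 * x ^ β) := by
  have h1 : (1 + x) ^ β ≤ 1 + x ^ β := by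
    simpa using Real.rpow_add_le_add_rpow zero_le_one hx (by linarith : (0 : ℝ) ≤ β) hβ1
  have h2 : (1 + x) ^ (1 / 2 : ℝ) ≤ Real.exp (x ^ β) :=
    (Real.rpow_le_rpow_of_exponent_le (by linarith) hβ).trans
      (h1.trans (by linarith [Real.add_one_le_exp (x ^ β)]))
  have h3 := Real.rpow_le_rpow (by positivity) h2 (by norm_num : (0 : ℝ) ≤ 2)
  rw [← Real.rpow_mul (by linarith), ← Real.exp_mul] at h3
  norm_num at h3
  rwa [mul_comm] at h3

/-- Concavity of `x ↦ x ^ β`. -/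
theorem sum_rpow_le {ι : Type*} (s : Finset ι) (t : ι → ℝ) (ht : ∀ i, 0 ≤ t i) {β : ℝ}
    (hβ : 0 < β) (hβ1 : β ≤ 1) :
    ∑ i ∈ s, t i ^ β ≤ (s.card : ℝ) ^ (1 - β) * (∑ i ∈ s, t i) ^ β := by
  have h := Real.rpow_sum_le_const_mul_sum_rpow s (fun i => t i ^ β)
    (p := 1 / β) (by rw [le_div_iff₀ hβ]; linarith)
  have h1 : ∀ i, |t i ^ β| = t i ^ β := fun i => abs_of_nonneg (Real.rpow_nonneg (ht i) _)
  have h2 : ∀ i, (t i ^ β) ^ (1 / β) = t i := fun i => by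
    rw [← Real.rpow_mul (ht i), mul_one_div_cancel hβ.ne', Real.rpow_one]
  simp only [h1, h2] at h
  have h0 : 0 ≤ ∑ i ∈ s, t i ^ β := sum_nonneg fun i _ => Real.rpow_nonneg (ht i) _
  have h3 := Real.rpow_le_rpow (Real.rpow_nonneg h0 _) h hβ.le
  rw [← Real.rpow_mul h0, one_div_mul_cancel hβ.ne', Real.rpow_one,
    Real.mul_rpow (Real.rpow_nonneg (Nat.cast_nonneg _) _) (sum_nonneg fun i _ => ht i),
    ← Real.rpow_mul (Nat.cast_nonneg _)] at h3
  convert h3 using 3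
  field_simp

/-- A set of `x` vertices that is covered by `q` cliques has at most
`exp (2 * q ^ (1 - β) * x ^ β)` independent subsets: a clique of size `t` contributes a factor
`1 + t ≤ exp (2 * t ^ β)`, and the sum of the `t ^ β` is bounded by concavity. -/
theorem CliqueCover.indCount_le {X : Finset V} {q β : ℝ} (h : CliqueCover G X q)
    (hβ : 1 / 2 ≤ β) (hβ1 : β ≤ 1) :
    (indCount G X : ℝ) ≤ Real.exp (2 * (q ^ (1 - β) * (X.card : ℝ) ^ β)) := by
  obtain ⟨f, hf, hadj⟩ := h
  have hX : X ⊆ (X.image f).biUnion fun c => X.filter fun u => f u = c := fun u hu =>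
    mem_biUnion.2 ⟨f u, mem_image_of_mem _ hu, mem_filter.2 ⟨hu, rfl⟩⟩
  have h1 : (indCount G X : ℝ) ≤
      ∏ c ∈ X.image f, (1 + ((X.filter fun u => f u = c).card : ℝ)) := by
    refine (Nat.cast_le.2 ((indCount_mono hX).trans (indCount_biUnion_le _ _))).trans ?_
    rw [Nat.cast_prod]
    refine prod_le_prod (fun _ _ => Nat.cast_nonneg _) fun c _ => ?_
    rw [add_comm]
    have := indCount_clique_le (G := G) (X := X.filter fun u => f u = c) fun u hu v hv huv =>
      hadj u (mem_filter.1 hu).1 v (mem_filter.1 hv).1 huv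
        ((mem_filter.1 hu).2.trans (mem_filter.1 hv).2.symm)
    exact_mod_cast this
  refine h1.trans ((prod_le_prod (fun _ _ => by positivity) fun c _ =>
    one_add_le_exp_rpow (Nat.cast_nonneg _) hβ hβ1).trans ?_)
  rw [← Real.exp_sum, Real.exp_le_exp, ← mul_sum]
  refine mul_le_mul_of_nonneg_left ?_ (by norm_num)
  refine (sum_rpow_le _ _ (fun _ => Nat.cast_nonneg _) (by linarith) hβ1).trans ?_
  have h2 : ∑ c ∈ X.image f, ((X.filter fun u => f u = c).card : ℝ) = X.card := by
    rw [card_eq_sum_card_image f X, Nat.cast_sum]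
  rw [h2]
  exact mul_le_mul_of_nonneg_right
    (Real.rpow_le_rpow (Nat.cast_nonneg _) hf (by linarith)) (by positivity)

end Counting

/-! ### Separators of point sets -/

section Separator

variable {V : Type*} [DecidableEq V] {G : SimpleGraph V} {d : ℕ} {q : V → Fin d → ℝ} {L m : ℝ}

/-- The points of `S` in the closed sup-norm ball of radius `r` about the point of `p`. -/
noncomputable def cube (q : V → Fin d → ℝ) (S : Finset V) (p : V) (r : ℝ) : Finset V :=
  S.filter fun x => dist (q p) (q x) ≤ r

/-- The points of `S` whose sup-norm distance from the point of `p` lies in `(r, r + L]`. -/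
noncomputable def shell (q : V → Fin d → ℝ) (S : Finset V) (p : V) (L r : ℝ) : Finset V :=
  S.filter fun x => r < dist (q p) (q x) ∧ dist (q p) (q x) ≤ r + L

/-- The constant fraction: a cube is dense if it contains at least one in `ballRatio d` of the
points. The factor `9 ^ d` is the number of cells of side `R / 2` that cover a cube of side
`4 * R`. -/
def ballRatio (d : ℕ) : ℕ := 2 * 9 ^ d

/-- The cube of radius `R` about `p` is a smallest one among the cubes that are centred at a point
of `S`, have a point of `S` on the boundary, and contain at least one in `ballRatio d` of the
points of `S`. -/
structure IsDenseCube (q : V → Fin d → ℝ) (S : Finset V) (p : V) (R : ℝ) : Prop where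
  center_mem : p ∈ S
  radius : ∃ y ∈ S, dist (q p) (q y) = R
  dense : S.card ≤ ballRatio d * (cube q S p R).card
  minimal : ∀ p' ∈ S, ∀ y' ∈ S,
    S.card ≤ ballRatio d * (cube q S p' (dist (q p') (q y'))).card → R ≤ dist (q p') (q y')

/-- Every set of vertices whose points have pairwise sup-norm distance at most `L` is covered by `m`
cliques. -/
def LocallyCovered (G : SimpleGraph V) (q : V → Fin d → ℝ) (L m : ℝ) : Prop :=
  ∀ T : Finset V, (∀ u ∈ T, ∀ v ∈ T, dist (q u) (q v) ≤ L) → CliqueCover G T m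

theorem IsDenseCube.radius_nonneg {S : Finset V} {p : V} {R : ℝ} (h : IsDenseCube q S p R) :
    0 ≤ R := by
  obtain ⟨y, -, rfl⟩ := h.radius
  exact dist_nonneg

theorem dist_lt_of_floor_eq {x y z : Fin d → ℝ} {w : ℝ} (hw : 0 < w)
    (h : (fun k => ⌊(x k - z k) / w⌋) = fun k => ⌊(y k - z k) / w⌋) : dist x y < w := by
  rw [dist_pi_lt_iff hw]
  intro k
  have h1 := Int.abs_sub_lt_one_of_floor_eq_floor (congrFun h k)
  rw [← sub_div, abs_div, abs_of_pos hw, div_lt_one hw] at h1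
  rw [Real.dist_eq]
  have h2 : x k - y k = x k - z k - (y k - z k) := by ring
  rwa [h2]

theorem abs_div_le_of_dist_le {x z : Fin d → ℝ} {w r : ℝ} (hw : 0 < w) (h : dist z x ≤ r)
    (k : Fin d) : |(x k - z k) / w| ≤ r / w := by
  rw [abs_div, abs_of_pos hw]
  refine div_le_div_of_nonneg_right ?_ hw.le
  rw [abs_sub_comm, ← Real.dist_eq]
  exact (dist_le_pi_dist z x k).trans h

/-- Doubling the radius of a smallest dense cube keeps at most half of the points: the larger
cube consists of `9 ^ d` cells, and none of them is dense. -/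
theorem IsDenseCube.two_mul_card_cube_le {S : Finset V} {p : V} {R : ℝ}
    (h : IsDenseCube q S p R) (hR : 0 < R) : 2 * (cube q S p (2 * R)).card ≤ S.card := by
  set g : V → Fin d → ℤ := fun u k => ⌊(q u k - q p k) / (R / 2)⌋ with hg
  have hR2 : 0 < R / 2 := by linarith
  set C := cube q S p (2 * R) with hC
  have himg : C.image g ⊆ Fintype.piFinset fun _ => Finset.Icc (-4 : ℤ) 4 := by
    intro c hc
    obtain ⟨u, hu, rfl⟩ := mem_image.1 hc
    rw [Fintype.mem_piFinset]
    intro k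
    have h1 := abs_div_le_of_dist_le hR2 (mem_filter.1 hu).2 k
    have h2 : 2 * R / (R / 2) = 4 := by field_simp; norm_num
    rw [h2, abs_le] at h1
    rw [mem_Icc]
    refine ⟨Int.le_floor.2 (by exact_mod_cast h1.1), ?_⟩
    have := (Int.floor_le ((q u k - q p k) / (R / 2))).trans h1.2
    exact_mod_cast this
  have hfib : ∀ c ∈ C.image g, ballRatio d * (C.filter fun u => g u = c).card ≤ S.card := by
    intro c hc
    obtain ⟨u, hu, rfl⟩ := mem_image.1 hc
    obtain ⟨y, hy, hmax⟩ := exists_max_image (C.filter fun x => g x = g u)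
      (fun x => dist (q u) (q x)) ⟨u, mem_filter.2 ⟨hu, rfl⟩⟩
    have hyS : y ∈ S := (mem_filter.1 (mem_filter.1 hy).1).1
    have huS : u ∈ S := (mem_filter.1 hu).1
    have hlt : dist (q u) (q y) < R / 2 := by
      rw [dist_comm]
      exact dist_lt_of_floor_eq hR2 (mem_filter.1 hy).2
    by_contra hcon
    have hsub : (C.filter fun x => g x = g u) ⊆ cube q S u (dist (q u) (q y)) := fun x hx =>
      mem_filter.2 ⟨(mem_filter.1 (mem_filter.1 hx).1).1, hmax x hx⟩
    have := h.minimal u huS y hyS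
      ((not_le.1 hcon).le.trans (Nat.mul_le_mul_left _ (card_le_card hsub)))
    linarith
  have h1 : ballRatio d * C.card ≤ 9 ^ d * S.card := by
    rw [card_eq_sum_card_image g C, mul_sum]
    refine (sum_le_card_nsmul _ _ _ hfib).trans ?_
    rw [smul_eq_mul]
    refine Nat.mul_le_mul_right _ ((card_le_card himg).trans ?_)
    simp [Fintype.card_piFinset]
  have h9 : 0 < 9 ^ d := by positivity
  unfold ballRatio at h1
  nlinarith

/-- A shell of width `L` in a cube of radius `2 * s * L` meets `O(s ^ (d - 1))` cells of side `L`: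
for each of its points some coordinate lies within `L` of one of the two bounding hyperplanes,
which leaves `4` values for this coordinate of the cell, and at most `5 * s` for the others. -/
theorem card_shell_cells_le {X : Finset V} {p : V} {lo s : ℝ} (hL : 0 < L) (hs : 2 ≤ s)
    (hlo : 0 ≤ lo) (hX : ∀ x ∈ X, lo < dist (q p) (q x) ∧ dist (q p) (q x) ≤ lo + L)
    (hX' : ∀ x ∈ X, dist (q p) (q x) ≤ 2 * s * L) :
    ((X.image fun u => fun k => ⌊(q u k - q p k) / L⌋).card : ℝ) ≤
      4 * d * (5 * s) ^ (d - 1) := by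
  set a := lo / L with ha
  set F : Finset ℤ := {⌊a⌋, ⌊a⌋ + 1, ⌊-a - 1⌋, ⌊-a - 1⌋ + 1} with hF
  set I : Finset ℤ := Finset.Icc ⌊-(2 * s)⌋ ⌊2 * s⌋ with hI
  have hFc : F.card ≤ 4 := card_le_four
  have hIc : (I.card : ℝ) ≤ 5 * s := by
    rw [hI, Int.card_Icc]
    have h1 := Int.floor_le (2 * s)
    have h2 := Int.lt_floor_add_one (-(2 * s))
    have h3 : 0 ≤ ⌊2 * s⌋ + 1 - ⌊-(2 * s)⌋ := by
      have : ⌊-(2 * s)⌋ ≤ ⌊2 * s⌋ := Int.floor_le_floor (by linarith)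
      linarith
    have h4 : (((⌊2 * s⌋ + 1 - ⌊-(2 * s)⌋).toNat : ℤ) : ℝ) = ⌊2 * s⌋ + 1 - ⌊-(2 * s)⌋ := by
      rw [Int.toNat_of_nonneg h3]; push_cast; ring
    rw [Int.cast_natCast] at h4
    rw [h4]
    linarith
  have hsub : (X.image fun u => fun k => ⌊(q u k - q p k) / L⌋) ⊆
      univ.biUnion fun k => Fintype.piFinset fun j => if j = k then F else I := by
    intro c hc
    obtain ⟨u, hu, rfl⟩ := mem_image.1 hc
    obtain ⟨h1, h2⟩ := hX u hu
    obtain ⟨k, hk⟩ : ∃ k, lo < dist (q p k) (q u k) := by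
      by_contra hcon
      push Not at hcon
      exact absurd ((dist_pi_le_iff hlo).2 hcon) (not_le.2 h1)
    refine mem_biUnion.2 ⟨k, mem_univ _, Fintype.mem_piFinset.2 fun j => ?_⟩
    by_cases hj : j = k
    · subst hj
      rw [if_pos rfl]
      have h3 := (abs_div_le_of_dist_le hL h2 j)
      have h4 : a < |(q u j - q p j) / L| := by
        rw [abs_div, abs_of_pos hL, ha]
        refine div_lt_div_of_pos_right ?_ hL
        rwa [abs_sub_comm, ← Real.dist_eq]
      rw [add_div, div_self hL.ne', ← ha] at h3
      set t := (q u j - q p j) / L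
      have key : ∀ b : ℝ, b ≤ t → t ≤ b + 1 → ⌊t⌋ = ⌊b⌋ ∨ ⌊t⌋ = ⌊b⌋ + 1 := by
        intro b hb1 hb2
        have h5 := Int.floor_le_floor hb1
        have h6 := Int.floor_le_floor hb2
        rw [Int.floor_add_one] at h6
        omega
      rw [hF]
      simp only [mem_insert, mem_singleton]
      rcases abs_cases t with ⟨h5, -⟩ | ⟨h5, -⟩
      · rcases key a (by linarith) (by linarith) with h | h <;> simp [h]
      · rcases key (-a - 1) (by linarith) (by linarith) with h | h <;> simp [h]
    · rw [if_neg hj]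
      have h3 := (abs_div_le_of_dist_le hL (hX' u hu) j)
      rw [mul_div_assoc, div_self hL.ne', mul_one, abs_le] at h3
      exact mem_Icc.2 ⟨Int.floor_le_floor h3.1, Int.floor_le_floor h3.2⟩
  have hcard : ∀ k : Fin d,
      ((Fintype.piFinset fun j => if j = k then F else I).card : ℝ) ≤ 4 * (5 * s) ^ (d - 1) := by
    intro k
    rw [Fintype.card_piFinset, ← mul_prod_erase univ _ (mem_univ k)]
    have : ∏ x ∈ univ.erase k, (if x = k then F else I).card = I.card ^ (d - 1) := by
      rw [prod_congr rfl (fun x hx => by rw [if_neg (ne_of_mem_erase hx)]), prod_const,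
        card_erase_of_mem (mem_univ k)]
      simp
    rw [this, if_pos rfl]
    push_cast
    exact mul_le_mul (by exact_mod_cast hFc) (pow_le_pow_left₀ (Nat.cast_nonneg _) hIc _)
      (by positivity) (by norm_num)
  have h1 := (card_le_card hsub).trans card_biUnion_le
  refine (Nat.cast_le.2 h1).trans ?_
  rw [Nat.cast_sum]
  refine (sum_le_card_nsmul _ _ _ fun k _ => hcard k).trans ?_
  rw [card_univ, Fintype.card_fin, nsmul_eq_mul]
  exact le_of_eq (by ring)

theorem LocallyCovered.cliqueCover {X : Finset V} (p : V) {c : ℝ} (hL : 0 < L) (hm : 0 ≤ m)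
    (hG : LocallyCovered G q L m)
    (hc : ((X.image fun u => fun k => ⌊(q u k - q p k) / L⌋).card : ℝ) ≤ c) :
    CliqueCover G X (c * m) := by
  refine CliqueCover.of_fibers (fun u => fun k => ⌊(q u k - q p k) / L⌋) hc hm
    fun a _ => hG _ fun u hu v hv => ?_
  exact (dist_lt_of_floor_eq hL
    ((mem_filter.1 hu).2.trans (mem_filter.1 hv).2.symm)).le

/-- The exponent `1 - 1 / d`. -/
noncomputable def expo (d : ℕ) : ℝ := 1 - 1 / (d : ℝ)

theorem half_le_expo (hd : 2 ≤ d) : 1 / 2 ≤ expo d := by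
  unfold expo
  have : (1 : ℝ) / d ≤ 1 / 2 := one_div_le_one_div_of_le (by norm_num) (by exact_mod_cast hd)
  linarith

theorem expo_le_one : expo d ≤ 1 := by
  unfold expo
  have : (0 : ℝ) ≤ 1 / d := by positivity
  linarith

theorem one_sub_expo : 1 - expo d = 1 / (d : ℝ) := by unfold expo; ring

/-- A cube of radius at most `2 * L` meets a bounded number of cells of side `L`, so all its
points together form a separator. -/
theorem indCount_cube_le (hd : 2 ≤ d) {S : Finset V} {p : V} {R : ℝ}
    (hL : 0 ≤ L) (hm : 1 ≤ m) (hG : LocallyCovered G q L m)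
    (hR : R ≤ 2 * L) :
    (indCount G (cube q S p R) : ℝ) ≤
      Real.exp (80 * d * (m ^ (1 / (d : ℝ)) * (S.card : ℝ) ^ expo d)) := by
  have hcover : CliqueCover G (cube q S p R) (5 ^ d * m) := by
    rcases hL.eq_or_lt with rfl | hL
    · have hone : CliqueCover G (cube q S p R) m := by
        refine hG _ fun u hu v hv => ?_
        have h1 := (mem_filter.1 hu).2
        have h2 := (mem_filter.1 hv).2
        have := dist_triangle_left (q u) (q v) (q p)
        linarith
      obtain ⟨f, hf, hf'⟩ := hone
      exact ⟨f, hf.trans (le_mul_of_one_le_left (by linarith)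
        (one_le_pow₀ (by norm_num))), hf'⟩
    · refine hG.cliqueCover p hL (by linarith) ?_
      have himg : ((cube q S p R).image fun u => fun k => ⌊(q u k - q p k) / L⌋) ⊆
          Fintype.piFinset fun _ => Finset.Icc (-2 : ℤ) 2 := by
        intro c hc
        obtain ⟨u, hu, rfl⟩ := mem_image.1 hc
        rw [Fintype.mem_piFinset]
        intro k
        have h1 := abs_div_le_of_dist_le hL ((mem_filter.1 hu).2.trans hR) k
        rw [mul_div_assoc, div_self hL.ne', mul_one, abs_le] at h1
        rw [mem_Icc]
        refine ⟨Int.le_floor.2 (by exact_mod_cast h1.1), ?_⟩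
        have := (Int.floor_le ((q u k - q p k) / L)).trans h1.2
        exact_mod_cast this
      have := card_le_card himg
      rw [Fintype.card_piFinset] at this
      simp only [Int.card_Icc, prod_const, card_univ, Fintype.card_fin] at this
      exact_mod_cast this
  refine (hcover.indCount_le (half_le_expo hd) expo_le_one).trans (Real.exp_le_exp.2 ?_)
  have hd0 : (d : ℝ) ≠ 0 := by positivity
  have h5 : ((5 : ℝ) ^ d) ^ (1 / (d : ℝ)) = 5 := by
    rw [← Real.rpow_natCast, ← Real.rpow_mul (by norm_num), mul_one_div_cancel hd0,
      Real.rpow_one]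
  rw [one_sub_expo, Real.mul_rpow (by positivity) (by linarith), h5]
  have h1 : ((cube q S p R).card : ℝ) ^ expo d ≤ (S.card : ℝ) ^ expo d :=
    Real.rpow_le_rpow (Nat.cast_nonneg _) (Nat.cast_le.2 (card_le_card (filter_subset _ _)))
      (by linarith [half_le_expo hd])
  have h2 : (0 : ℝ) ≤ m ^ (1 / (d : ℝ)) := Real.rpow_nonneg (by linarith) _
  have h3 : (0 : ℝ) ≤ (S.card : ℝ) ^ expo d := Real.rpow_nonneg (Nat.cast_nonneg _) _
  have h4 : (2 : ℝ) ≤ d := by exact_mod_cast hd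
  have h6 := mul_le_mul_of_nonneg_left h1 h2
  nlinarith [mul_nonneg h2 h3]

/-- Among the disjoint shells of width `L` between the radii `R` and `2 * R` one has few points,
and it can be shifted inwards so that its inner radius is attained. -/
theorem IsDenseCube.exists_sparse_shell {S : Finset V} {p : V} {R : ℝ}
    (h : IsDenseCube q S p R) (hL : 0 < L) :
    ∃ y ∈ S, R ≤ dist (q p) (q y) ∧ (1 ≤ R / L → dist (q p) (q y) + L ≤ 2 * R) ∧
      ⌊R / L⌋₊ * (shell q S p L (dist (q p) (q y))).card ≤ S.card := by
  obtain ⟨y₀, hy₀, hy₀R⟩ := h.radius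
  rcases Nat.eq_zero_or_pos ⌊R / L⌋₊ with h0 | hpos
  · refine ⟨y₀, hy₀, hy₀R.ge, fun h1 => ?_, by rw [h0, zero_mul]; exact Nat.zero_le _⟩
    rw [le_div_iff₀ hL] at h1
    linarith
  have hdisj : ((range ⌊R / L⌋₊ : Finset ℕ) : Set ℕ).PairwiseDisjoint
      fun j : ℕ => shell q S p L (R + j * L) := by
    have key : ∀ i j : ℕ, i < j →
        Disjoint (shell q S p L (R + i * L)) (shell q S p L (R + j * L)) := by
      intro i j hij
      rw [disjoint_left]
      intro x hx hx'
      have h1 := (mem_filter.1 hx).2.2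
      have h2 := (mem_filter.1 hx').2.1
      have h3 : ((i : ℝ) + 1) * L ≤ j * L :=
        mul_le_mul_of_nonneg_right (by exact_mod_cast hij) hL.le
      linarith
    intro i _ j _ hij
    rcases lt_or_gt_of_ne hij with h1 | h1
    · exact key i j h1
    · exact (key j i h1).symm
  have hsum : ∑ j ∈ range ⌊R / L⌋₊, ⌊R / L⌋₊ * (shell q S p L (R + j * L)).card ≤
      ∑ _j ∈ range ⌊R / L⌋₊, S.card := by
    rw [← mul_sum, ← card_biUnion hdisj, sum_const, card_range, smul_eq_mul]
    exact Nat.mul_le_mul_left _ (card_le_card (biUnion_subset.2 fun j _ => filter_subset _ _))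
  obtain ⟨j, hj, hjle⟩ := exists_le_of_sum_le (nonempty_range_iff.2 hpos.ne') hsum
  obtain ⟨y, hy, hmax⟩ := exists_max_image (S.filter fun x => dist (q p) (q x) ≤ R + j * L)
    (fun x => dist (q p) (q x)) ⟨y₀, mem_filter.2
      ⟨hy₀, by rw [hy₀R]; nlinarith [j.cast_nonneg (α := ℝ)]⟩⟩
  refine ⟨y, (mem_filter.1 hy).1, ?_, fun _ => ?_, le_trans (Nat.mul_le_mul_left _
    (card_le_card ?_)) hjle⟩
  · rw [← hy₀R]
    exact hmax y₀ (mem_filter.2 ⟨hy₀, by rw [hy₀R]; nlinarith [j.cast_nonneg (α := ℝ)]⟩)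
  · have h1 := (mem_filter.1 hy).2
    have h2 : ((j : ℝ) + 1) ≤ R / L :=
      le_trans (by exact_mod_cast mem_range.1 hj) (Nat.floor_le (div_nonneg h.radius_nonneg hL.le))
    rw [le_div_iff₀ hL] at h2
    linarith
  · intro x hx
    obtain ⟨hxS, h1, h2⟩ := mem_filter.1 hx
    refine mem_filter.2 ⟨hxS, ?_, by linarith [(mem_filter.1 hy).2]⟩
    by_contra hcon
    exact absurd (hmax x (mem_filter.2 ⟨hxS, not_lt.1 hcon⟩)) (not_le.2 h1)

/-- If the smallest dense cube has radius `R > 2 * L`, a sparsest shell of width `L` between the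
radii `R` and `2 * R` is a separator. With `s = R / L` it has at most `2 * |S| / s` points, in
`O(s ^ (d - 1))` cells of side `L`. -/
theorem IsDenseCube.indCount_shell_le (hd : 2 ≤ d) {S : Finset V} {p y : V} {R : ℝ}
    (h : IsDenseCube q S p R) (hL : 0 ≤ L) (hm : 1 ≤ m) (hG : LocallyCovered G q L m)
    (hR : 2 * L < R) (hy' : dist (q p) (q y) + L ≤ 2 * R)
    (hmin : ∀ y' ∈ S, R ≤ dist (q p) (q y') → dist (q p) (q y') + L ≤ 2 * R →
      (shell q S p L (dist (q p) (q y))).card ≤ (shell q S p L (dist (q p) (q y'))).card) :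
    (indCount G (shell q S p L (dist (q p) (q y))) : ℝ) ≤
      Real.exp (80 * d * (m ^ (1 / (d : ℝ)) * (S.card : ℝ) ^ expo d)) := by
  set X := shell q S p L (dist (q p) (q y)) with hXdef
  have hm0 : (0 : ℝ) ≤ m ^ (1 / (d : ℝ)) := Real.rpow_nonneg (by linarith) _
  have hS0 : (0 : ℝ) ≤ (S.card : ℝ) ^ expo d := Real.rpow_nonneg (Nat.cast_nonneg _) _
  have hβ := half_le_expo hd
  rcases hL.eq_or_lt with rfl | hL
  · have hX : X = ∅ := by
      refine filter_eq_empty_iff.2 fun x _ hx => ?_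
      linarith [hx.1, hx.2]
    rw [hX, indCount_empty, Nat.cast_one]
    exact Real.one_le_exp (by positivity)
  set s := R / L with hs
  have hsL : s * L = R := div_mul_cancel₀ _ hL.ne'
  have hs2 : 2 ≤ s := by rw [hs, le_div_iff₀ hL]; exact hR.le
  have hs0 : 0 < s := by linarith
  have hcells := card_shell_cells_le (q := q) (X := X) (p := p) hL hs2
    (lo := dist (q p) (q y)) dist_nonneg
    (fun x hx => (mem_filter.1 hx).2) (fun x hx => by
      rw [mul_assoc, hsL]; exact (mem_filter.1 hx).2.2.trans hy')
  have hcover := hG.cliqueCover p hL (by linarith) hcells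
  refine (hcover.indCount_le hβ expo_le_one).trans (Real.exp_le_exp.2 ?_)
  have hcard : (X.card : ℝ) ≤ 2 * S.card / s := by
    obtain ⟨y', hy'S, h1, h2, h3⟩ := h.exists_sparse_shell hL
    have h4 := hmin y' hy'S h1 (h2 (by linarith))
    have h5 : ((⌊s⌋₊ * X.card : ℕ) : ℝ) ≤ S.card :=
      Nat.cast_le.2 ((Nat.mul_le_mul_left _ h4).trans h3)
    push_cast at h5
    have h6 := Nat.lt_floor_add_one s
    rw [le_div_iff₀ hs0]
    nlinarith [(Nat.cast_nonneg X.card : (0 : ℝ) ≤ X.card)]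
  have hd1 : (1 : ℝ) ≤ d := by exact_mod_cast (by omega : 1 ≤ d)
  have hd0 : (d : ℝ) ≠ 0 := by positivity
  have hinv : 1 / (d : ℝ) ≤ 1 := by rw [div_le_one (by positivity)]; exact hd1
  have hinv0 : 0 ≤ 1 / (d : ℝ) := by positivity
  have h4d : ((4 : ℝ) * d) ^ (1 / (d : ℝ)) ≤ 4 * d :=
    (Real.rpow_le_rpow_of_exponent_le (by linarith) hinv).trans_eq (Real.rpow_one _)
  have hpow : ((5 * s) ^ (d - 1)) ^ (1 / (d : ℝ)) ≤ 5 * s ^ expo d := by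
    rw [← Real.rpow_natCast, ← Real.rpow_mul (by positivity), Nat.cast_sub (by omega),
      Nat.cast_one]
    have : ((d : ℝ) - 1) * (1 / d) = expo d := by unfold expo; field_simp
    rw [this, Real.mul_rpow (by norm_num) hs0.le]
    refine mul_le_mul_of_nonneg_right ?_ (by positivity)
    exact (Real.rpow_le_rpow_of_exponent_le (by norm_num) expo_le_one).trans_eq (Real.rpow_one _)
  have hXpow : (X.card : ℝ) ^ expo d ≤ 2 * (S.card : ℝ) ^ expo d / s ^ expo d := by
    refine (Real.rpow_le_rpow (Nat.cast_nonneg _) hcard (by linarith)).trans ?_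
    rw [Real.div_rpow (by positivity) hs0.le, Real.mul_rpow (by norm_num) (Nat.cast_nonneg _)]
    refine div_le_div_of_nonneg_right (mul_le_mul_of_nonneg_right ?_ hS0) (by positivity)
    exact (Real.rpow_le_rpow_of_exponent_le (by norm_num) expo_le_one).trans_eq (Real.rpow_one _)
  rw [one_sub_expo, Real.mul_rpow (by positivity) (by linarith),
    Real.mul_rpow (by positivity) (by positivity)]
  have hspow : 0 < s ^ expo d := Real.rpow_pos_of_pos hs0 _
  calc 2 * (((4 : ℝ) * d) ^ (1 / (d : ℝ)) * ((5 * s) ^ (d - 1)) ^ (1 / (d : ℝ)) *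
          m ^ (1 / (d : ℝ)) * (X.card : ℝ) ^ expo d)
      ≤ 2 * ((4 * d) * (5 * s ^ expo d) * m ^ (1 / (d : ℝ)) *
          (2 * (S.card : ℝ) ^ expo d / s ^ expo d)) := by gcongr
    _ = 80 * d * (m ^ (1 / (d : ℝ)) * (S.card : ℝ) ^ expo d) := by
        field_simp; ring

end Separator

/-! ### Stabbed families are locally covered by few cliques -/

section Stabbed

variable {d : ℕ}

theorem dist_ofLp_le (x y : EuclideanSpace ℝ (Fin d)) : dist x.ofLp y.ofLp ≤ dist x y := by
  refine (dist_pi_le_iff dist_nonneg).2 fun k => ?_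
  have := PiLp.norm_apply_le (x - y) k
  rwa [PiLp.sub_apply, ← dist_eq_norm, ← dist_eq_norm] at this

theorem dist_le_sqrt_mul_dist_ofLp (x y : EuclideanSpace ℝ (Fin d)) :
    dist x y ≤ √d * dist x.ofLp y.ofLp := by
  rw [EuclideanSpace.dist_eq]
  refine Real.sqrt_le_iff.2 ⟨by positivity, ?_⟩
  rw [mul_pow, Real.sq_sqrt (Nat.cast_nonneg _)]
  refine (sum_le_card_nsmul _ _ _ fun k _ =>
    pow_le_pow_left₀ dist_nonneg (dist_le_pi_dist x.ofLp y.ofLp k) 2).trans ?_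
  simp

/-- The objects located within a cube whose side is comparable to their diameters are covered by
`O(α ^ d)` cliques. The ball containing the relevant points of the objects is covered by a finite
net, and the possible diameters by scales `r` in geometric progression with ratio `4 / 3`: an
object whose diameter lies between `r / 2` and `2 * r / 3` is contained in the ball of radius `r`
about any net point that is close to one of its points. Objects assigned to the same net point and
scale are thus stabbed by `α ^ d` points, and objects sharing a stabbing point form a clique. -/
theorem exists_locallyCovered (σ κ : ℝ) (hσ : 1 ≤ σ) (hκ : 0 ≤ κ) :
    ∃ K : ℝ, 1 ≤ K ∧ ∀ (α : ℝ), 1 ≤ α → ∀ (n : ℕ), 1 ≤ n →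
      ∀ (o : Fin n → Set (EuclideanSpace ℝ (Fin d))) (p : Fin n → EuclideanSpace ℝ (Fin d)),
        (∀ i, Bornology.IsBounded (o i)) → SimilarlySized σ o → IsStabbed α o → Locates κ p o →
        ∃ L : ℝ, 0 ≤ L ∧ (∀ i j, (intersectionGraph o).Adj i j → dist (p i).ofLp (p j).ofLp ≤ L) ∧
          LocallyCovered (intersectionGraph o) (fun i => (p i).ofLp) L (K * α ^ d) := by
  set ρ : ℝ := κ + √d * (2 * κ + 2) with hρ
  have hσ0 : 0 < σ := by linarith
  obtain ⟨F, hFfin, hF⟩ := Metric.totallyBounded_iff.1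
    (isCompact_closedBall (0 : EuclideanSpace ℝ (Fin d)) ρ).totallyBounded (1 / (2 * σ))
    (by positivity)
  obtain ⟨N, hN⟩ := pow_unbounded_of_one_lt σ (by norm_num : (1 : ℝ) < 4 / 3)
  refine ⟨hFfin.toFinset.card * N + 1, le_add_of_nonneg_left (by positivity), ?_⟩
  intro α hα n hn o p hbdd hsim hstab hloc
  have hαd : 1 ≤ α ^ d := one_le_pow₀ hα
  obtain ⟨i₁, -, hi₁⟩ := exists_max_image (univ : Finset (Fin n)) (fun i => Metric.diam (o i))
    ⟨⟨0, hn⟩, mem_univ _⟩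
  set D := Metric.diam (o i₁) with hD
  have hD0 : 0 ≤ D := Metric.diam_nonneg
  have hmax : ∀ i, Metric.diam (o i) ≤ D := fun i => hi₁ i (mem_univ _)
  choose x hxo hx using hloc
  have hx' : ∀ i, dist (p i) (x i) ≤ κ * D := fun i =>
    (hx i).trans (mul_le_mul_of_nonneg_left (hmax i) hκ)
  have hin : ∀ i, ∀ y ∈ o i, ∀ z ∈ o i, dist y z ≤ Metric.diam (o i) := fun i y hy z hz =>
    Metric.dist_le_diam_of_mem (hbdd i) hy hz
  refine ⟨(2 * κ + 2) * D, by positivity, fun i j hij => ?_, fun T hT => ?_⟩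
  · obtain ⟨-, z, hzi, hzj⟩ := hij
    have h1 := dist_triangle4 (p i) (x i) (x j) (p j)
    have h2 := dist_triangle (x i) z (x j)
    have h3 := (hin i _ (hxo i) _ hzi).trans (hmax i)
    have h4 := (hin j _ hzj _ (hxo j)).trans (hmax j)
    have h5 := hx' j
    rw [dist_comm] at h5
    have := hx' i
    refine (dist_ofLp_le _ _).trans ?_
    linarith
  have hdist : ∀ u ∈ T, ∀ v ∈ T, dist (p u) (p v) ≤ √d * ((2 * κ + 2) * D) := fun u hu v hv =>
    (dist_le_sqrt_mul_dist_ofLp _ _).trans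
      (mul_le_mul_of_nonneg_left (hT u hu v hv) (Real.sqrt_nonneg _))
  rcases hD0.eq_or_lt with hD0 | hDpos
  · -- All objects are single points, and those of `T` coincide.
    refine CliqueCover.of_map (fun _ => (0 : ℕ)) ?_ ?_
    · have h1 : ((T.image fun _ => (0 : ℕ)).card : ℝ) ≤ 1 := by
        have : T.image (fun _ => (0 : ℕ)) ⊆ {0} := fun y hy => by
          obtain ⟨u, -, rfl⟩ := mem_image.1 hy
          exact mem_singleton_self _
        exact_mod_cast card_le_card this
      refine h1.trans (one_le_mul_of_one_le_of_one_le ?_ hαd)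
      have : (0 : ℝ) ≤ hFfin.toFinset.card * N := by positivity
      linarith
    · intro u hu v hv huv _
      have hxp : ∀ i, p i = x i := fun i => by
        have := hx' i
        rw [← hD0, mul_zero] at this
        exact dist_le_zero.1 this
      have h1 := hdist u hu v hv
      rw [← hD0, mul_zero, mul_zero, dist_le_zero, hxp, hxp] at h1
      exact ⟨huv, x u, hxo u, h1 ▸ hxo v⟩
  rcases T.eq_empty_or_nonempty with rfl | ⟨i₀, hi₀⟩
  · exact ⟨fun _ => 0, by simp; positivity, by simp⟩
  have hassign : ∀ i, ∃ fk : EuclideanSpace ℝ (Fin d) × ℕ, i ∈ T →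
      fk ∈ hFfin.toFinset ×ˢ range N ∧
      2 * (D / σ) * (4 / 3) ^ fk.2 / 2 ≤ Metric.diam (o i) ∧
      Metric.diam (o i) < 2 * (D / σ) * (4 / 3) ^ fk.2 ∧
      o i ⊆ Metric.ball (p i₀ + D • fk.1) (2 * (D / σ) * (4 / 3) ^ fk.2) := by
    intro i
    by_cases hi : i ∈ T
    swap
    · exact ⟨(0, 0), fun h => absurd h hi⟩
    have hsi : D ≤ σ * Metric.diam (o i) := hsim i₁ i
    have hdi : 0 < Metric.diam (o i) := by
      by_contra hcon
      nlinarith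
    obtain ⟨k, hk1, hk2⟩ := exists_nat_pow_near
      (x := Metric.diam (o i) * σ / D) (y := (4 / 3 : ℝ))
      (by rw [le_div_iff₀ hDpos]; linarith) (by norm_num)
    have hball : (1 / D) • (x i - p i₀) ∈ Metric.closedBall (0 : EuclideanSpace ℝ (Fin d)) ρ := by
      rw [mem_closedBall_zero_iff, norm_smul, Real.norm_of_nonneg (by positivity),
        ← dist_eq_norm, one_div, inv_mul_le_iff₀ hDpos]
      have h1 := dist_triangle (x i) (p i) (p i₀)
      have h2 := hx' i
      rw [dist_comm] at h2
      have h3 := hdist i hi i₀ hi₀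
      rw [hρ]
      linarith
    obtain ⟨f, hfF, hf⟩ := Set.mem_iUnion₂.1 (hF hball)
    have hfdist : dist (x i) (p i₀ + D • f) < D * (1 / (2 * σ)) := by
      have h1 : x i - (p i₀ + D • f) = D • ((1 / D) • (x i - p i₀) - f) := by
        rw [smul_sub, smul_smul, mul_one_div_cancel hDpos.ne', one_smul]
        abel
      rw [dist_eq_norm, h1, norm_smul, Real.norm_of_nonneg hDpos.le, ← dist_eq_norm]
      exact mul_lt_mul_of_pos_left hf hDpos
    have hkN : k < N := by
      have h1 : (4 / 3 : ℝ) ^ k < (4 / 3) ^ N := by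
        refine (hk1.trans ?_).trans_lt hN
        rw [div_le_iff₀ hDpos]
        nlinarith [hmax i]
      exact (pow_lt_pow_iff_right₀ (by norm_num)).1 h1
    have hk0 : (1 : ℝ) ≤ (4 / 3) ^ k := one_le_pow₀ (by norm_num)
    rw [le_div_iff₀ hDpos] at hk1
    rw [div_lt_iff₀ hDpos, pow_succ] at hk2
    set w := (4 / 3 : ℝ) ^ k with hw
    have e1 : w * (D / σ) ≤ Metric.diam (o i) := by
      rw [← mul_div_assoc, div_le_iff₀ hσ0]; exact hk1
    have e2 : Metric.diam (o i) < w * (4 / 3) * (D / σ) := by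
      rw [← mul_div_assoc, lt_div_iff₀ hσ0]; exact hk2
    have e3 : D * (1 / (2 * σ)) = (D / σ) / 2 := by field_simp
    have e4 : 0 < D / σ := by positivity
    refine ⟨(f, k), fun _ => ⟨?_, ?_, ?_, fun z hz => ?_⟩⟩
    · exact mem_product.2 ⟨hFfin.mem_toFinset.2 hfF, mem_range.2 hkN⟩
    · change 2 * (D / σ) * w / 2 ≤ _
      linarith
    · change _ < 2 * (D / σ) * w
      nlinarith
    · change dist z (p i₀ + D • f) < 2 * (D / σ) * w
      have h1 := dist_triangle z (x i) (p i₀ + D • f)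
      have h2 := hin i z hz _ (hxo i)
      nlinarith
  choose g hg using hassign
  have hgT : T.image g ⊆ hFfin.toFinset ×ˢ range N := fun y hy => by
    obtain ⟨u, hu, rfl⟩ := mem_image.1 hy
    exact (hg u hu).1
  have hgc : ((T.image g).card : ℝ) ≤ hFfin.toFinset.card * N + 1 := by
    have := card_le_card hgT
    rw [card_product, card_range] at this
    have h2 : ((T.image g).card : ℝ) ≤ hFfin.toFinset.card * N := by exact_mod_cast this
    linarith
  refine CliqueCover.of_fibers g hgc (by linarith) fun a _ => ?_
  obtain ⟨S, hS, hSstab⟩ := hstab (2 * (D / σ) * (4 / 3) ^ a.2) (p i₀ + D • a.1)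
  have hst : ∀ i, ∃ z, i ∈ T.filter (fun u => g u = a) → z ∈ S ∧ z ∈ o i := by
    intro i
    by_cases hi : i ∈ T.filter (fun u => g u = a)
    · obtain ⟨hiT, rfl⟩ := mem_filter.1 hi
      obtain ⟨-, h1, h2, h3⟩ := hg i hiT
      obtain ⟨z, hz⟩ := hSstab i h1 h2 h3
      exact ⟨z, fun _ => hz⟩
    · exact ⟨0, fun h => absurd h hi⟩
  choose z hz using hst
  refine CliqueCover.of_map z ?_ fun u hu v hv huv h => ⟨huv, z u, (hz u hu).2, h ▸ (hz v hv).2⟩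
  refine (Nat.cast_le.2 (card_le_card fun y hy => ?_)).trans hS
  obtain ⟨u, hu, rfl⟩ := mem_image.1 hy
  exact (hz u hu).1

end Stabbed

/-! ### Layouts with small cuts -/

section Layout

variable {V : Type*} [Fintype V] [DecidableEq V] {G : SimpleGraph V}

/-- The edges leaving `P` start in a set with at most `M` independent subsets. -/
def HasCut (G : SimpleGraph V) (M : ℝ) (P : Finset V) : Prop :=
  ∃ Y : Finset V, (indCount G Y : ℝ) ≤ M ∧ ∀ u ∈ P, ∀ w ∉ P, G.Adj u w → u ∈ Y

/-- The state of the computation of a layout. The list `l` is the part of the layout that is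
already known; its members have the label `0`. The other vertices are divided into groups with the
labels `1, …, c`, which form a stack: the group `c` is processed next. There are no edges between
different groups, and the neighbours in `l` of the groups `1, …, k` lie in a set whose number of
independent subsets leaves room for the cuts that arise when group `k` is divided further, as
measured by `Φ`. -/
structure LayoutInv (G : SimpleGraph V) (M : ℝ) (Φ : ℕ → ℝ) (l : List V) (lab : V → ℕ) (c : ℕ) :
    Prop where
  nodup : l.Nodup
  mem_iff : ∀ v, v ∈ l ↔ lab v = 0
  lab_le : ∀ v, lab v ≤ c
  no_edge : ∀ u v, G.Adj u v → lab u ≠ 0 → lab v ≠ 0 → lab u = lab v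
  sep : ∀ k, 1 ≤ k → k ≤ c → ∃ Y : Finset V,
    indCount G Y * Real.exp (Φ (univ.filter fun v => lab v = k).card) ≤ M ∧
      ∀ u ∈ l, ∀ w, G.Adj u w → 1 ≤ lab w → lab w ≤ k → u ∈ Y
  cut : ∀ k, HasCut G M (l.take k).toFinset

theorem LayoutInv.init (Φ : ℕ → ℝ) (hΦ : ∀ N, 0 ≤ Φ N) :
    LayoutInv G (Real.exp (Φ (Fintype.card V))) Φ [] (fun _ => 1) 1 where
  nodup := List.nodup_nil
  mem_iff := by simp
  lab_le := fun _ => le_rfl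
  no_edge := fun _ _ _ _ _ => rfl
  sep := fun k h1 h2 => ⟨∅, by
    obtain rfl : k = 1 := le_antisymm h2 h1
    simp, by simp⟩
  cut := fun k => ⟨∅, by simpa using hΦ _, by simp⟩

theorem LayoutInv.pop {M : ℝ} {Φ : ℕ → ℝ} {l : List V} {lab : V → ℕ} {c : ℕ}
    (h : LayoutInv G M Φ l lab c) (hc : ∀ v, lab v ≠ c) : LayoutInv G M Φ l lab (c - 1) where
  nodup := h.nodup
  mem_iff := h.mem_iff
  lab_le := fun v => by have := h.lab_le v; have := hc v; omega
  no_edge := h.no_edge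
  sep := fun k h1 h2 => h.sep k h1 (by omega)
  cut := h.cut

/-- Dividing the group on top of the stack: the vertices of `xs` are appended to the layout and
separate those that get the label `c + 1` from those that keep the label `c`. -/
theorem LayoutInv.split {M : ℝ} {Φ : ℕ → ℝ} (hΦ : ∀ N, 0 ≤ Φ N) {l xs : List V} {lab lab' : V → ℕ}
    {c : ℕ} (h : LayoutInv G M Φ l lab c) (hc : 1 ≤ c) (hxs : xs.Nodup)
    (hne : ∀ v, lab v ≠ c → v ∉ xs ∧ lab' v = lab v)
    (heq : ∀ v, lab v = c → v ∈ xs ∧ lab' v = 0 ∨ v ∉ xs ∧ lab' v = c ∨ v ∉ xs ∧ lab' v = c + 1)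
    (hAB : ∀ u v, lab' u = c + 1 → lab' v = c → ¬ G.Adj u v)
    (hA : indCount G xs.toFinset * Real.exp (Φ (univ.filter fun v => lab' v = c + 1).card) ≤
      Real.exp (Φ (univ.filter fun v => lab v = c).card))
    (hB : indCount G xs.toFinset * Real.exp (Φ (univ.filter fun v => lab' v = c).card) ≤
      Real.exp (Φ (univ.filter fun v => lab v = c).card)) :
    LayoutInv G M Φ (l ++ xs) lab' (c + 1) := by
  have hzero : ∀ v, lab' v = 0 ↔ v ∈ l ∨ v ∈ xs := by
    intro v
    rw [h.mem_iff]
    by_cases hv : lab v = c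
    · rcases heq v hv with h1 | h1 | h1
      · simp [h1.1, h1.2]
      · simp only [h1.1, h1.2, or_false]; omega
      · simp only [h1.1, h1.2, or_false]; omega
    · simp [(hne v hv).1, (hne v hv).2]
  have hlabxs : ∀ v ∈ xs, lab v = c := fun v hv => by
    by_contra hcon
    exact (hne v hcon).1 hv
  have hold : ∀ v, lab' v ≠ 0 → lab v ≠ 0 ∧ lab v ≤ c ∧ (lab' v = lab v ∨ lab v = c) := by
    intro v hv
    have := h.lab_le v
    by_cases hvc : lab v = c
    · omega
    · rw [(hne v hvc).2] at hv ⊢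
      exact ⟨hv, this, Or.inl rfl⟩
  obtain ⟨Y, hY, hYcov⟩ := h.sep c hc le_rfl
  set N := (univ.filter fun v => lab v = c).card
  have hun : ∀ W : Finset V, W ⊆ xs.toFinset → ∀ t : ℝ, 0 ≤ t →
      indCount G xs.toFinset * Real.exp t ≤ Real.exp (Φ N) →
      indCount G (Y ∪ W) * Real.exp t ≤ M := by
    intro W hW t _ ht'
    have h1 : (indCount G (Y ∪ W) : ℝ) ≤ indCount G Y * indCount G xs.toFinset := by
      exact_mod_cast (indCount_union_le Y W).trans (Nat.mul_le_mul_left _ (indCount_mono hW))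
    calc (indCount G (Y ∪ W) : ℝ) * Real.exp t
        ≤ indCount G Y * indCount G xs.toFinset * Real.exp t :=
          mul_le_mul_of_nonneg_right h1 (Real.exp_nonneg _)
      _ = indCount G Y * (indCount G xs.toFinset * Real.exp t) := by ring
      _ ≤ indCount G Y * Real.exp (Φ N) := mul_le_mul_of_nonneg_left ht' (Nat.cast_nonneg _)
      _ ≤ M := hY
  have hcov : ∀ u ∈ l ++ xs, ∀ w, G.Adj u w → lab' w ≠ 0 → u ∈ Y ∪ xs.toFinset := by
    intro u hu w huw hw
    rw [mem_union, List.mem_toFinset]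
    rcases List.mem_append.1 hu with hu | hu
    · obtain ⟨h1, h2, -⟩ := hold w hw
      exact Or.inl (hYcov u hu w huw (by omega) h2)
    · exact Or.inr hu
  refine ⟨?_, ?_, ?_, ?_, ?_, ?_⟩
  · refine h.nodup.append hxs fun v hv hv' => ?_
    have := (h.mem_iff v).1 hv
    have := hlabxs v hv'
    omega
  · intro v
    rw [List.mem_append, hzero]
  · intro v
    have := h.lab_le v
    by_cases hv : lab v = c
    · rcases heq v hv with h1 | h1 | h1 <;> omega
    · rw [(hne v hv).2]; omega
  · intro u v huv hu hv
    obtain ⟨hu0, -, hu1⟩ := hold u hu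
    obtain ⟨hv0, -, hv1⟩ := hold v hv
    have h1 := h.no_edge u v huv hu0 hv0
    by_cases huc : lab u = c
    · have hvc : lab v = c := h1 ▸ huc
      have hAB1 := hAB u v
      have hAB2 := hAB v u
      have := huv.symm
      rcases heq u huc with h2 | h2 | h2 <;> rcases heq v hvc with h3 | h3 | h3 <;>
        simp_all
    · rw [(hne u huc).2, (hne v (h1 ▸ huc)).2, h1]
  · intro k hk hkc
    rcases lt_trichotomy k c with hlt | rfl | hgt
    · obtain ⟨Z, hZ, hZcov⟩ := h.sep k hk hlt.le
      refine ⟨Z, ?_, ?_⟩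
      · have : (univ.filter fun v => lab' v = k) = univ.filter fun v => lab v = k := by
          ext v
          simp only [mem_filter, mem_univ, true_and]
          by_cases hv : lab v = c
          · rcases heq v hv with h1 | h1 | h1 <;> omega
          · rw [(hne v hv).2]
        rwa [this]
      · intro u hu w huw hw1 hw2
        obtain ⟨hw0, -, hw3⟩ := hold w (by omega)
        have hwc : lab w ≠ c := by
          intro hwc
          rcases heq w hwc with h1 | h1 | h1 <;> omega
        rw [(hne w hwc).2] at hw1 hw2
        rcases List.mem_append.1 hu with hu | hu
        · exact hZcov u hu w huw hw1 hw2
        · have hu1 := hlabxs u hu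
          have := h.no_edge u w huw (by omega) hw0
          omega
    · exact ⟨Y ∪ xs.toFinset, hun _ Subset.rfl _ (hΦ _) hB, fun u hu w huw hw _ =>
        hcov u hu w huw (by omega)⟩
    · obtain rfl : k = c + 1 := by omega
      exact ⟨Y ∪ xs.toFinset, hun _ Subset.rfl _ (hΦ _) hA, fun u hu w huw hw _ =>
        hcov u hu w huw (by omega)⟩
  · intro k
    rcases le_total k l.length with hk | hk
    · rw [List.take_append_of_le_length hk]
      exact h.cut k
    · rw [List.take_append, List.take_of_length_le hk, List.toFinset_append]
      set ys := xs.take (k - l.length)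
      have hys : ys ⊆ xs := List.take_subset _ _
      have hys' : ys.toFinset ⊆ xs.toFinset := fun v hv =>
        List.mem_toFinset.2 (hys (List.mem_toFinset.1 hv))
      have hX : indCount G xs.toFinset * Real.exp 0 ≤ Real.exp (Φ N) := by
        refine le_trans (mul_le_mul_of_nonneg_left ?_ (Nat.cast_nonneg _)) hB
        exact Real.exp_le_exp.2 (hΦ _)
      refine ⟨Y ∪ ys.toFinset, ?_, fun u hu w hw huw => ?_⟩
      · simpa using hun _ hys' 0 le_rfl hX
      · simp only [mem_union, List.mem_toFinset, not_or] at hu hw ⊢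
        rcases hu with hu | hu
        · refine Or.inl (hYcov u hu w huw ?_ (h.lab_le w))
          have := mt (h.mem_iff w).2 hw.1
          omega
        · exact Or.inr hu

end Layout

/-! ### Layouts from separators -/

section Recursion

variable {V : Type*} [Fintype V] [DecidableEq V] {G : SimpleGraph V} {d : ℕ} {q : V → Fin d → ℝ}
  {L m : ℝ}

/-- The constant of the exponent: the cost of a separator is compensated by the decrease of
`N ^ expo d` when `N` is reduced by the fraction `1 / ballRatio d`. -/
noncomputable def expoConst (d : ℕ) : ℝ :=
  (80 * d + 1) / (1 - (1 - 1 / (ballRatio d : ℝ)) ^ expo d)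

/-- The exponent of the number of states at a cut of a layout of `N` vertices. -/
noncomputable def cutExpo (d : ℕ) (μ : ℝ) (N : ℕ) : ℝ := expoConst d * (μ * (N : ℝ) ^ expo d)

theorem one_lt_ballRatio (d : ℕ) : (1 : ℝ) < ballRatio d := by
  have : 1 ≤ 9 ^ d := Nat.one_le_pow _ _ (by norm_num)
  have : 1 < ballRatio d := by unfold ballRatio; omega
  exact_mod_cast this

theorem shrink_pos (hd : 2 ≤ d) : 0 < 1 - (1 - 1 / (ballRatio d : ℝ)) ^ expo d := by
  have h1 := one_lt_ballRatio d
  have h2 : (1 : ℝ) / ballRatio d ≤ 1 := by rw [div_le_one (by linarith)]; exact h1.le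
  have h3 : (0 : ℝ) < 1 / ballRatio d := by positivity
  have := Real.rpow_lt_one (x := 1 - 1 / (ballRatio d : ℝ)) (z := expo d) (by linarith)
    (by linarith) (by linarith [half_le_expo hd])
  linarith

theorem expoConst_pos (hd : 2 ≤ d) : 0 < expoConst d :=
  div_pos (by positivity) (shrink_pos hd)

theorem cutExpo_nonneg (hd : 2 ≤ d) {μ : ℝ} (hμ : 0 ≤ μ) (N : ℕ) : 0 ≤ cutExpo d μ N :=
  mul_nonneg (expoConst_pos hd).le (by positivity)

/-- The choice of `expoConst`: a separator `X` of a group of `N` vertices, enlarged by one vertex,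
can be paid for if the remaining part has `A ≤ (1 - 1 / ballRatio d) * N` vertices. -/
theorem indCount_insert_mul_exp_le (hd : 2 ≤ d) {μ : ℝ} (hμ : 1 ≤ μ) {N A : ℕ} (hN : 1 ≤ N)
    (hA : ballRatio d * A + N ≤ ballRatio d * N) {X X' : Finset V} {p : V} (hX' : X' ⊆ insert p X)
    (hX : (indCount G X : ℝ) ≤ Real.exp (80 * d * (μ * (N : ℝ) ^ expo d))) :
    indCount G X' * Real.exp (cutExpo d μ A) ≤ Real.exp (cutExpo d μ N) := by
  have hβ := half_le_expo hd
  have hK := one_lt_ballRatio d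
  have hN1 : (1 : ℝ) ≤ (N : ℝ) ^ expo d :=
    Real.one_le_rpow (by exact_mod_cast hN) (by linarith)
  have hone : (1 : ℝ) ≤ μ * (N : ℝ) ^ expo d := one_le_mul_of_one_le_of_one_le hμ hN1
  have h1 : (indCount G X' : ℝ) ≤ Real.exp ((80 * d + 1) * (μ * (N : ℝ) ^ expo d)) := by
    have h2 : indCount G X' ≤ 2 * indCount G X := by
      rw [insert_eq] at hX'
      refine (indCount_mono hX').trans ((indCount_union_le _ _).trans (Nat.mul_le_mul_right _ ?_))
      simpa using indCount_clique_le (G := G) (X := {p})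
        (fun u hu v hv huv => absurd ((mem_singleton.1 hu).trans (mem_singleton.1 hv).symm) huv)
    have h3 : (2 : ℝ) ≤ Real.exp (μ * (N : ℝ) ^ expo d) := by
      linarith [Real.add_one_le_exp (μ * (N : ℝ) ^ expo d)]
    calc (indCount G X' : ℝ) ≤ 2 * indCount G X := by exact_mod_cast h2
      _ ≤ Real.exp (μ * (N : ℝ) ^ expo d) * Real.exp (80 * d * (μ * (N : ℝ) ^ expo d)) := by
          gcongr
      _ = Real.exp ((80 * d + 1) * (μ * (N : ℝ) ^ expo d)) := by
          rw [← Real.exp_add]; congr 1; ring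
  have hAle : (A : ℝ) ≤ (1 - 1 / (ballRatio d : ℝ)) * N := by
    have : (ballRatio d : ℝ) * A + N ≤ ballRatio d * N := by exact_mod_cast hA
    have h0 : (0 : ℝ) < ballRatio d := by linarith
    rw [sub_mul, one_mul, one_div_mul_eq_div, le_sub_iff_add_le, ← le_sub_iff_add_le',
      div_le_iff₀ h0]
    linarith
  have h0 : (0 : ℝ) ≤ 1 - 1 / (ballRatio d : ℝ) := by
    rw [sub_nonneg, div_le_one (by linarith)]; exact hK.le
  have hApow : (A : ℝ) ^ expo d ≤ (1 - 1 / (ballRatio d : ℝ)) ^ expo d * (N : ℝ) ^ expo d := by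
    rw [← Real.mul_rpow h0 (Nat.cast_nonneg _)]
    exact Real.rpow_le_rpow (Nat.cast_nonneg _) hAle (by linarith)
  have hC : expoConst d * (1 - (1 - 1 / (ballRatio d : ℝ)) ^ expo d) = 80 * d + 1 :=
    div_mul_cancel₀ _ (shrink_pos hd).ne'
  refine (mul_le_mul_of_nonneg_right h1 (Real.exp_nonneg _)).trans ?_
  rw [← Real.exp_add, Real.exp_le_exp, ← hC]
  unfold cutExpo
  have h4 : expoConst d * (μ * (A : ℝ) ^ expo d) ≤
      expoConst d * (μ * ((1 - 1 / (ballRatio d : ℝ)) ^ expo d * (N : ℝ) ^ expo d)) := by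
    have := (expoConst_pos hd).le
    gcongr
  linarith

/-- A group `S` is divided by the cube of radius `R` about `p` if it is small (`big = False`), and
else by a sparsest shell of width `L` whose inner radius lies between `R` and `2 * R - L` and is
attained. -/
def GoodSplit (q : V → Fin d → ℝ) (L : ℝ) (S : Finset V) (p : V) (R lo hi : ℝ) (big : Prop) :
    Prop :=
  (¬ big ∧ R ≤ 2 * L ∧ hi = R) ∨
  (big ∧ 2 * L < R ∧ hi = lo + L ∧ ∃ y ∈ S, lo = dist (q p) (q y) ∧ R ≤ lo ∧ lo + L ≤ 2 * R ∧
    ∀ y' ∈ S, R ≤ dist (q p) (q y') → dist (q p) (q y') + L ≤ 2 * R →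
      (shell q S p L lo).card ≤ (shell q S p L (dist (q p) (q y'))).card)

/-- The labels after a group has been divided: vertices outside of the radius `hi` keep the
label, those in the separator get the label `0`, and those within the radius `lo` get a new
label. The centre is always put into the separator. -/
noncomputable def splitLabel (q : V → Fin d → ℝ) (p : V) (lo hi : ℝ) (big : Prop) (c : ℕ)
    (lab : V → ℕ) (v : V) : ℕ :=
  if lab v = c then
    if hi < dist (q p) (q v) then c
    else if v = p ∨ (big → lo < dist (q p) (q v)) then 0 else c + 1
  else lab v

/-- Dividing the group on top of the stack with the separator given by the smallest dense cube. The
outer part misses this cube and the inner part is contained in the cube of twice its radius, so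
both parts lack a constant fraction of the group. -/
theorem LayoutInv.geometric_split (hd : 2 ≤ d) (hL : 0 ≤ L) (hm : 1 ≤ m)
    (hadj : ∀ u v, G.Adj u v → dist (q u) (q v) ≤ L) (hG : LocallyCovered G q L m) {M : ℝ}
    {l xs : List V} {lab : V → ℕ} {c : ℕ} {p : V} {R lo hi : ℝ} {big : Prop}
    (h : LayoutInv G M (cutExpo d (m ^ (1 / (d : ℝ)))) l lab c) (hc : 1 ≤ c)
    (hp : IsDenseCube q (univ.filter fun v => lab v = c) p R)
    (hs : GoodSplit q L (univ.filter fun v => lab v = c) p R lo hi big) (hxs : xs.Nodup)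
    (hmem : ∀ v, v ∈ xs ↔ lab v = c ∧ splitLabel q p lo hi big c lab v = 0) :
    LayoutInv G M (cutExpo d (m ^ (1 / (d : ℝ)))) (l ++ xs) (splitLabel q p lo hi big c lab)
      (c + 1) := by
  set S := univ.filter fun v => lab v = c with hS
  have hmemS : ∀ v, v ∈ S ↔ lab v = c := fun v => by simp [hS]
  have hμ : (1 : ℝ) ≤ m ^ (1 / (d : ℝ)) := Real.one_le_rpow hm (by positivity)
  have hN : 1 ≤ S.card := card_pos.2 ⟨p, hp.center_mem⟩
  have hR := hp.radius_nonneg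
  have hhi : R ≤ hi := by
    rcases hs with ⟨-, -, h1⟩ | ⟨-, -, h1, y, -, -, h2, -⟩ <;> linarith
  set A := univ.filter fun v => splitLabel q p lo hi big c lab v = c + 1 with hAdef
  set B := univ.filter fun v => splitLabel q p lo hi big c lab v = c with hBdef
  have hA : ∀ v, v ∈ A → v ∈ S ∧ big ∧ dist (q p) (q v) ≤ lo := by
    intro v hv
    have hv := (mem_filter.1 hv).2
    have := h.lab_le v
    unfold splitLabel at hv
    split_ifs at hv with h1 h2 h3 <;> try omega
    simp only [not_or, Classical.not_imp, not_lt] at h3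
    exact ⟨(hmemS v).2 h1, h3.2⟩
  have hB : ∀ v, v ∈ B → v ∈ S ∧ hi < dist (q p) (q v) := by
    intro v hv
    have hv := (mem_filter.1 hv).2
    unfold splitLabel at hv
    split_ifs at hv with h1 h2 h3 <;> try omega
    exact ⟨(hmemS v).2 h1, h2⟩
  -- The dense cube is disjoint from the outer part.
  have hBcard : ballRatio d * B.card + S.card ≤ ballRatio d * S.card := by
    have h1 : B.card + (cube q S p R).card ≤ S.card := by
      rw [← card_union_of_disjoint]
      · exact card_le_card (union_subset (fun v hv => (hB v hv).1) (filter_subset _ _))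
      · rw [disjoint_left]
        intro v hv hv'
        have := (hB v hv).2
        have := (mem_filter.1 hv').2
        linarith
    have h2 := hp.dense
    nlinarith [Nat.mul_le_mul_left (ballRatio d) h1]
  -- The inner part is contained in the cube of radius `2 * R`.
  have hAcard : ballRatio d * A.card + S.card ≤ ballRatio d * S.card := by
    have h2K : 2 ≤ ballRatio d := by
      have := Nat.one_le_pow d 9 (by norm_num)
      unfold ballRatio
      omega
    have h1 : 2 * A.card ≤ S.card := by
      rcases hs with ⟨h1, -⟩ | ⟨-, h1, -, y, -, -, -, h2, -⟩
      · have : A = ∅ := eq_empty_of_forall_notMem fun v hv => h1 (hA v hv).2.1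
        simp [this]
      · refine le_trans (Nat.mul_le_mul_left 2 (card_le_card fun v hv => ?_))
          (hp.two_mul_card_cube_le (by linarith))
        exact mem_filter.2 ⟨(hA v hv).1, by linarith [(hA v hv).2.2]⟩
    obtain ⟨k, hk⟩ := Nat.exists_eq_add_of_le h2K
    rw [hk]
    nlinarith
  have hX : ∃ X : Finset V, xs.toFinset ⊆ insert p X ∧ (indCount G X : ℝ) ≤
      Real.exp (80 * d * (m ^ (1 / (d : ℝ)) * (S.card : ℝ) ^ expo d)) := by
    rcases hs with ⟨h1, h2, rfl⟩ | ⟨h1, h2, h3, y, hyS, rfl, hRy, h4, h5⟩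
    · refine ⟨cube q S p hi, fun v hv => ?_, indCount_cube_le hd hL hm hG h2⟩
      obtain ⟨hv1, hv2⟩ := (hmem v).1 (List.mem_toFinset.1 hv)
      unfold splitLabel at hv2
      split_ifs at hv2 with h6
      · omega
      · exact mem_insert_of_mem (mem_filter.2 ⟨(hmemS v).2 hv1, not_lt.1 h6⟩)
    · refine ⟨_, fun v hv => ?_, hp.indCount_shell_le hd hL hm hG h2 h4 h5⟩
      obtain ⟨hv1, hv2⟩ := (hmem v).1 (List.mem_toFinset.1 hv)
      unfold splitLabel at hv2
      split_ifs at hv2 with h6 h7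
      · omega
      · rcases h7 with rfl | h7
        · exact mem_insert_self _ _
        · exact mem_insert_of_mem (mem_filter.2 ⟨(hmemS v).2 hv1, h7 h1, h3 ▸ not_lt.1 h6⟩)
  obtain ⟨X, hXs, hX⟩ := hX
  refine h.split (cutExpo_nonneg hd (by linarith)) hc hxs ?_ ?_ ?_
    (indCount_insert_mul_exp_le hd hμ hN hAcard hXs hX)
    (indCount_insert_mul_exp_le hd hμ hN hBcard hXs hX)
  · intro v hv
    refine ⟨fun hv' => hv ((hmem v).1 hv').1, ?_⟩
    unfold splitLabel
    rw [if_neg hv]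
  · intro v hv
    rw [hmem]
    unfold splitLabel
    rw [if_pos hv]
    split_ifs <;> simp [hv]
    omega
  · intro u v hu hv huv
    obtain ⟨-, hbig, hu⟩ := hA u (mem_filter.2 ⟨mem_univ _, hu⟩)
    obtain ⟨-, hv⟩ := hB v (mem_filter.2 ⟨mem_univ _, hv⟩)
    have h1 := hadj u v huv
    have h2 := dist_triangle (q p) (q u) (q v)
    rcases hs with ⟨h3, -⟩ | ⟨-, -, h3, -⟩
    · exact h3 hbig
    · linarith

/-- The cube about `p` that contains all of `S` is dense. -/
theorem exists_isDenseCube_radius {S : Finset V} {p : V} (hp : p ∈ S) :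
    ∃ y ∈ S, S.card ≤ ballRatio d * (cube q S p (dist (q p) (q y))).card := by
  obtain ⟨y, hy, hmax⟩ := exists_max_image S (fun x => dist (q p) (q x)) ⟨p, hp⟩
  refine ⟨y, hy, ?_⟩
  have : cube q S p (dist (q p) (q y)) = S := filter_true_of_mem hmax
  rw [this]
  exact Nat.le_mul_of_pos_left _ (by unfold ballRatio; positivity)

end Recursion

/-! ### Dynamic programming along a layout -/

section Table

variable {V : Type*} [Fintype V] [DecidableEq V] {G : SimpleGraph V}

/-- The vertices outside of `P` that have a neighbour in `I`. Two independent subsets of `P` with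
the same key have the same extensions. -/
noncomputable def key (G : SimpleGraph V) (P I : Finset V) : Finset V :=
  univ.filter fun w => w ∉ P ∧ ∃ u ∈ I, G.Adj u w

theorem mem_key {P I : Finset V} {w : V} : w ∈ key G P I ↔ w ∉ P ∧ ∃ u ∈ I, G.Adj u w := by
  simp [key]

/-- A list of independent subsets of `P` with pairwise different keys. -/
structure IsTable (G : SimpleGraph V) (P : Finset V) (l : List (Finset V)) : Prop where
  subset : ∀ I ∈ l, I ⊆ P
  indep : ∀ I ∈ l, G.IsIndepSet (I : Set V)
  nodup : (l.map (key G P)).Nodup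

/-- Some member of the list has the same key as `J` and is at least as large. -/
def Covers (G : SimpleGraph V) (P : Finset V) (l : List (Finset V)) (J : Finset V) : Prop :=
  ∃ I ∈ l, key G P I = key G P J ∧ J.card ≤ I.card

theorem IsTable.nil (P : Finset V) : IsTable G P [] :=
  ⟨by simp, by simp, by simp⟩

/-- A table has at most as many entries as there are independent subsets of a set that contains
the boundary of `P`. -/
theorem IsTable.length_le {P : Finset V} {l : List (Finset V)} (h : IsTable G P l) {M : ℝ}
    (hP : HasCut G M P) : (l.length : ℝ) ≤ M := by
  obtain ⟨Y, hY, hcov⟩ := hP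
  refine le_trans (Nat.cast_le.2 ?_) hY
  have hkey : ∀ I ∈ l, key G P (I ∩ Y) = key G P I := by
    intro I hI
    ext w
    rw [mem_key, mem_key]
    refine and_congr_right fun hw => ⟨?_, ?_⟩
    · rintro ⟨u, hu, huw⟩
      exact ⟨u, (mem_inter.1 hu).1, huw⟩
    · rintro ⟨u, hu, huw⟩
      exact ⟨u, mem_inter.2 ⟨hu, hcov u (h.subset I hI hu) w hw huw⟩, huw⟩
  have hnd : (l.map (· ∩ Y)).Nodup := by
    refine List.Nodup.of_map (key G P) ?_
    rw [List.map_map, List.map_congr_left (f := key G P ∘ (· ∩ Y)) (g := key G P)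
      (fun I hI => hkey I hI)]
    exact h.nodup
  rw [← List.length_map (as := l) (· ∩ Y), ← List.toFinset_card_of_nodup hnd]
  refine card_le_card fun J hJ => ?_
  obtain ⟨I, hI, rfl⟩ := List.mem_map.1 (List.mem_toFinset.1 hJ)
  rw [mem_indep_filter]
  exact ⟨inter_subset_right, isIndepSet_mono inter_subset_left (h.indep I hI)⟩

theorem IsTable.append {P : Finset V} {l : List (Finset V)} (h : IsTable G P l) {I : Finset V}
    (hI : I ⊆ P) (hI' : G.IsIndepSet (I : Set V)) (hkey : ∀ J ∈ l, key G P J ≠ key G P I) :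
    IsTable G P (l ++ [I]) := by
  refine ⟨?_, ?_, ?_⟩
  · simp only [List.mem_append, List.mem_singleton]
    rintro J (hJ | rfl)
    exacts [h.subset J hJ, hI]
  · simp only [List.mem_append, List.mem_singleton]
    rintro J (hJ | rfl)
    exacts [h.indep J hJ, hI']
  · rw [List.map_append]
    refine h.nodup.append (by simp) fun k hk hk' => ?_
    obtain ⟨J, hJ, rfl⟩ := List.mem_map.1 hk
    simp only [List.map_cons, List.map_nil, List.mem_singleton] at hk'
    exact hkey J hJ hk'

theorem map_key_set {P : Finset V} {l : List (Finset V)} {I : Finset V} {r : ℕ}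
    (hr : r < l.length) (hkey : key G P l[r] = key G P I) :
    (l.set r I).map (key G P) = l.map (key G P) := by
  rw [List.map_set, ← hkey]
  conv_rhs => rw [← List.set_getElem_self (as := l.map (key G P)) (i := r) (by simpa using hr)]
  simp

theorem IsTable.set {P : Finset V} {l : List (Finset V)} (h : IsTable G P l) {I : Finset V}
    (hI : I ⊆ P) (hI' : G.IsIndepSet (I : Set V)) {r : ℕ} (hr : r < l.length)
    (hkey : key G P l[r] = key G P I) : IsTable G P (l.set r I) := by
  refine ⟨fun J hJ => ?_, fun J hJ => ?_, by rw [map_key_set hr hkey]; exact h.nodup⟩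
  · rcases List.mem_or_eq_of_mem_set hJ with hJ | rfl
    exacts [h.subset J hJ, hI]
  · rcases List.mem_or_eq_of_mem_set hJ with hJ | rfl
    exacts [h.indep J hJ, hI']

theorem Covers.append {P : Finset V} {l : List (Finset V)} {J : Finset V} (h : Covers G P l J)
    (l' : List (Finset V)) : Covers G P (l ++ l') J := by
  obtain ⟨I, hI, h⟩ := h
  exact ⟨I, List.mem_append_left _ hI, h⟩

theorem Covers.set {P : Finset V} {l : List (Finset V)} {J : Finset V} (h : Covers G P l J)
    {I : Finset V} {r : ℕ} (hr : r < l.length) (hkey : key G P l[r] = key G P I)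
    (hcard : l[r].card ≤ I.card) : Covers G P (l.set r I) J := by
  obtain ⟨I', hI', h1, h2⟩ := h
  obtain ⟨s, hs, rfl⟩ := List.getElem_of_mem hI'
  by_cases hrs : r = s
  · subst hrs
    exact ⟨I, List.mem_set hr I, hkey.symm.trans h1, h2.trans hcard⟩
  · exact ⟨l[s], List.mem_iff_getElem.2 ⟨s, by simpa using hs, by rw [List.getElem_set_ne hrs]⟩,
      h1, h2⟩

/-- The table represents all independent subsets of `P`. -/
def IsFullTable (G : SimpleGraph V) (P : Finset V) (l : List (Finset V)) : Prop :=
  IsTable G P l ∧ ∀ J ⊆ P, G.IsIndepSet (J : Set V) → Covers G P l J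

theorem isFullTable_singleton_empty : IsFullTable G ∅ [∅] := by
  refine ⟨⟨by simp, by simp [SimpleGraph.IsIndepSet], by simp⟩, fun J hJ _ => ?_⟩
  rw [subset_empty.1 hJ]
  exact ⟨∅, by simp, rfl, le_rfl⟩

theorem isIndepSet_insert {P I : Finset V} {v : V} (hI : G.IsIndepSet (I : Set V))
    (hv : v ∉ P) (hkey : v ∉ key G P I) :
    G.IsIndepSet (insert v I : Finset V) := by
  rw [coe_insert]
  refine Set.Pairwise.insert hI fun u hu _ => ?_
  have h1 : ¬ G.Adj u v := fun huv => hkey (mem_key.2 ⟨hv, u, hu, huv⟩)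
  exact ⟨fun h => h1 h.symm, h1⟩

/-- One step of the dynamic program: every independent subset of `insert v P` is covered if the
members of a full table for `P` are, both without and (if possible) with `v` added. -/
theorem IsFullTable.step {P : Finset V} {l l' : List (Finset V)} {v : V} (h : IsFullTable G P l)
    (hv : v ∉ P) (hl' : IsTable G (insert v P) l')
    (hskip : ∀ I ∈ l, Covers G (insert v P) l' I)
    (htake : ∀ I ∈ l, v ∉ key G P I → Covers G (insert v P) l' (insert v I)) :
    IsFullTable G (insert v P) l' := by
  refine ⟨hl', fun J hJ hJind => ?_⟩
  have hkeyins : ∀ I I' : Finset V, key G P I = key G P I' →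
      key G (insert v P) I = key G (insert v P) I' := by
    intro I I' hII'
    ext w
    have := Finset.ext_iff.1 hII' w
    simp only [mem_key, mem_insert, not_or] at this ⊢
    rw [and_assoc, and_assoc, this]
  by_cases hvJ : v ∈ J
  · obtain ⟨I, hI, h1, h2⟩ := h.2 (J.erase v)
      (fun u hu => by
        obtain ⟨h1, h2⟩ := mem_erase.1 hu
        exact (mem_insert.1 (hJ h2)).resolve_left h1)
      (isIndepSet_mono (erase_subset _ _) hJind)
    have hvk : v ∉ key G P I := by
      rw [h1, mem_key]
      rintro ⟨-, u, hu, huv⟩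
      obtain ⟨h3, h4⟩ := mem_erase.1 hu
      exact hJind h4 hvJ h3 huv
    obtain ⟨I', hI', h3, h4⟩ := htake I hI hvk
    refine ⟨I', hI', h3.trans ?_, ?_⟩
    · ext w
      have := Finset.ext_iff.1 h1 w
      simp only [mem_key, mem_insert, not_or, mem_erase, exists_eq_or_imp] at this ⊢
      constructor
      · rintro ⟨⟨hw1, hw2⟩, h5 | h5⟩
        · exact ⟨⟨hw1, hw2⟩, v, hvJ, h5⟩
        · obtain ⟨-, u, hu, huw⟩ := this.1 ⟨hw2, h5⟩
          exact ⟨⟨hw1, hw2⟩, u, hu.2, huw⟩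
      · rintro ⟨⟨hw1, hw2⟩, u, hu, huw⟩
        refine ⟨⟨hw1, hw2⟩, ?_⟩
        by_cases huv : u = v
        · exact Or.inl (huv ▸ huw)
        · exact Or.inr (this.2 ⟨hw2, u, ⟨huv, hu⟩, huw⟩).2
    · have h5 := card_erase_add_one hvJ
      have h6 : (insert v I).card = I.card + 1 :=
        card_insert_of_notMem fun hvI => hv (h.1.subset I hI hvI)
      omega
  · obtain ⟨I, hI, h1, h2⟩ := h.2 J
      (fun u hu => (mem_insert.1 (hJ hu)).resolve_left fun h => hvJ (h ▸ hu)) hJind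
    obtain ⟨I', hI', h3, h4⟩ := hskip I hI
    exact ⟨I', hI', h3.trans (hkeyins I J h1), h2.trans h4⟩

/-- When all vertices have been processed, the table consists of a maximum independent set. -/
theorem IsFullTable.eq_singleton {l : List (Finset V)} (h : IsFullTable G univ l) :
    ∃ I, l = [I] ∧ G.IsMaximumIndepSet I := by
  have hkey : ∀ I : Finset V, key G univ I = ∅ := fun I => by
    ext w
    simp [mem_key]
  have hnd := h.1.nodup
  rw [List.map_congr_left (g := fun _ => (∅ : Finset V)) (fun I _ => hkey I), List.map_const',
    List.nodup_replicate] at hnd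
  obtain ⟨I, hI, -⟩ := h.2 ∅ (empty_subset _) (by simp [SimpleGraph.IsIndepSet])
  have hlen := List.length_pos_of_mem hI
  obtain ⟨I, rfl⟩ := List.length_eq_one_iff.1 (le_antisymm hnd hlen)
  refine ⟨I, rfl, h.1.indep I (by simp), fun J hJ => ?_⟩
  obtain ⟨I', hI', -, h2⟩ := h.2 J (subset_univ _) hJ
  rw [List.mem_singleton] at hI'
  exact hI' ▸ h2

end Table

/-! ### Reasoning about programs -/

section Exec

/-- Write a natural-number register. -/
def _root_.RealRAM.State.setReg (s : State) (a x : ℕ) : State :=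
  { s with reg := Function.update s.reg a x }

/-- Write a cell of the natural-number memory. -/
def _root_.RealRAM.State.setMem (s : State) (a x : ℕ) : State :=
  { s with mem := Function.update s.mem a x }

/-- Write a real register. -/
noncomputable def _root_.RealRAM.State.setReal (s : State) (a : ℕ) (x : ℝ) : State :=
  { s with rreg := Function.update s.rreg a x }

variable (s : State) (a b x : ℕ) (y : ℝ)

@[simp] theorem reg_setReg : (s.setReg a x).reg b = if b = a then x else s.reg b :=
  Function.update_apply ..
@[simp] theorem mem_setReg : (s.setReg a x).mem = s.mem := rfl
@[simp] theorem rreg_setReg : (s.setReg a x).rreg = s.rreg := rfl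
@[simp] theorem rmem_setReg : (s.setReg a x).rmem = s.rmem := rfl
@[simp] theorem reg_setMem : (s.setMem a x).reg = s.reg := rfl
theorem mem_setMem : (s.setMem a x).mem b = if b = a then x else s.mem b :=
  Function.update_apply ..
@[simp] theorem rreg_setMem : (s.setMem a x).rreg = s.rreg := rfl
@[simp] theorem rmem_setMem : (s.setMem a x).rmem = s.rmem := rfl
@[simp] theorem reg_setReal : (s.setReal a y).reg = s.reg := rfl
@[simp] theorem mem_setReal : (s.setReal a y).mem = s.mem := rfl
@[simp] theorem rreg_setReal : (s.setReal a y).rreg b = if b = a then y else s.rreg b :=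
  Function.update_apply ..
@[simp] theorem rmem_setReal : (s.setReal a y).rmem = s.rmem := rfl

/-- The program `P`, started in `s`, halts in a state and after a time that satisfy `Q`. -/
def Exec (P : Program) (s : State) (Q : State → ℕ → Prop) : Prop :=
  ∃ s' t, Runs P s s' t ∧ Q s' t

theorem Exec.mono {P : Program} {s : State} {Q Q' : State → ℕ → Prop} (h : Exec P s Q)
    (hQ : ∀ s' t, Q s' t → Q' s' t) : Exec P s Q' := by
  obtain ⟨s', t, h1, h2⟩ := h
  exact ⟨s', t, h1, hQ s' t h2⟩

variable {s : State} {Q : State → ℕ → Prop} {P P' : Program} {a b x : ℕ} {c : ℕ}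

@[simp] theorem exec_skip : Exec .skip s Q ↔ Q s 1 :=
  ⟨fun ⟨_, _, h, hQ⟩ => by cases h; exact hQ, fun h => ⟨_, _, .skip s, h⟩⟩

@[simp] theorem exec_const : Exec (.const a x) s Q ↔ Q (s.setReg a x) 1 :=
  ⟨fun ⟨_, _, h, hQ⟩ => by cases h; exact hQ, fun h => ⟨_, _, .const a x s, h⟩⟩

@[simp] theorem exec_add : Exec (.add a b c) s Q ↔ Q (s.setReg a (s.reg b + s.reg c)) 1 :=
  ⟨fun ⟨_, _, h, hQ⟩ => by cases h; exact hQ, fun h => ⟨_, _, .add a b c s, h⟩⟩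

@[simp] theorem exec_sub : Exec (.sub a b c) s Q ↔ Q (s.setReg a (s.reg b - s.reg c)) 1 :=
  ⟨fun ⟨_, _, h, hQ⟩ => by cases h; exact hQ, fun h => ⟨_, _, .sub a b c s, h⟩⟩

@[simp] theorem exec_load : Exec (.load a b) s Q ↔ Q (s.setReg a (s.mem (s.reg b))) 1 :=
  ⟨fun ⟨_, _, h, hQ⟩ => by cases h; exact hQ, fun h => ⟨_, _, .load a b s, h⟩⟩

@[simp] theorem exec_store : Exec (.store a b) s Q ↔ Q (s.setMem (s.reg a) (s.reg b)) 1 :=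
  ⟨fun ⟨_, _, h, hQ⟩ => by cases h; exact hQ, fun h => ⟨_, _, .store a b s, h⟩⟩

@[simp] theorem exec_radd : Exec (.radd a b c) s Q ↔ Q (s.setReal a (s.rreg b + s.rreg c)) 1 :=
  ⟨fun ⟨_, _, h, hQ⟩ => by cases h; exact hQ, fun h => ⟨_, _, .radd a b c s, h⟩⟩

@[simp] theorem exec_rsub : Exec (.rsub a b c) s Q ↔ Q (s.setReal a (s.rreg b - s.rreg c)) 1 :=
  ⟨fun ⟨_, _, h, hQ⟩ => by cases h; exact hQ, fun h => ⟨_, _, .rsub a b c s, h⟩⟩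

@[simp] theorem exec_rload : Exec (.rload a b) s Q ↔ Q (s.setReal a (s.rmem (s.reg b))) 1 :=
  ⟨fun ⟨_, _, h, hQ⟩ => by cases h; exact hQ, fun h => ⟨_, _, .rload a b s, h⟩⟩

@[simp] theorem exec_seq : Exec (.seq P P') s Q ↔
    Exec P s fun s' t => Exec P' s' fun s'' t' => Q s'' (t + t') :=
  ⟨fun ⟨_, _, h, hQ⟩ => by cases h with | seq h1 h2 => exact ⟨_, _, h1, _, _, h2, hQ⟩,
    fun ⟨_, _, h1, _, _, h2, hQ⟩ => ⟨_, _, .seq h1 h2, hQ⟩⟩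

@[simp] theorem exec_ifLt : Exec (.ifLt a b P P') s Q ↔
    if s.reg a < s.reg b then Exec P s fun s' t => Q s' (t + 1)
    else Exec P' s fun s' t => Q s' (t + 1) := by
  split_ifs with hlt
  · exact ⟨fun ⟨_, _, h, hQ⟩ => by
      cases h with
      | ifLt_true _ h => exact ⟨_, _, h, hQ⟩
      | ifLt_false h' _ => exact absurd hlt h',
      fun ⟨_, _, h, hQ⟩ => ⟨_, _, .ifLt_true hlt h, hQ⟩⟩
  · exact ⟨fun ⟨_, _, h, hQ⟩ => by
      cases h with
      | ifLt_false _ h => exact ⟨_, _, h, hQ⟩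
      | ifLt_true h' _ => exact absurd h' hlt,
      fun ⟨_, _, h, hQ⟩ => ⟨_, _, .ifLt_false hlt h, hQ⟩⟩

@[simp] theorem exec_ifRLt : Exec (.ifRLt a b P P') s Q ↔
    if s.rreg a < s.rreg b then Exec P s fun s' t => Q s' (t + 1)
    else Exec P' s fun s' t => Q s' (t + 1) := by
  split_ifs with hlt
  · exact ⟨fun ⟨_, _, h, hQ⟩ => by
      cases h with
      | ifRLt_true _ h => exact ⟨_, _, h, hQ⟩
      | ifRLt_false h' _ => exact absurd hlt h',
      fun ⟨_, _, h, hQ⟩ => ⟨_, _, .ifRLt_true hlt h, hQ⟩⟩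
  · exact ⟨fun ⟨_, _, h, hQ⟩ => by
      cases h with
      | ifRLt_false _ h => exact ⟨_, _, h, hQ⟩
      | ifRLt_true h' _ => exact absurd h' hlt,
      fun ⟨_, _, h, hQ⟩ => ⟨_, _, .ifRLt_false hlt h, hQ⟩⟩

/-- Execute a list of programs one after another. -/
def block : List Program → Program
  | [] => .skip
  | P :: Ps => .seq P (block Ps)

@[simp] theorem exec_block_nil : Exec (block []) s Q ↔ Q s 1 := exec_skip

@[simp] theorem exec_block_cons {Ps : List Program} : Exec (block (P :: Ps)) s Q ↔
    Exec P s fun s' t => Exec (block Ps) s' fun s'' t' => Q s'' (t + t') := exec_seq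

/-- If `reg a = reg b` then `P` else `P'`; the `skip` makes the test take the same time in all
cases. -/
def ifEq (a b : ℕ) (P P' : Program) : Program :=
  .ifLt a b (.seq .skip P') (.ifLt b a P' P)

@[simp] theorem exec_ifEq : Exec (ifEq a b P P') s Q ↔
    if s.reg a = s.reg b then Exec P s fun s' t => Q s' (t + 2)
    else Exec P' s fun s' t => Q s' (t + 2) := by
  unfold ifEq
  rcases lt_trichotomy (s.reg a) (s.reg b) with h | h | h
  · simp [h, h.ne, add_comm, add_left_comm]
  · simp [h]
  · simp [h, h.ne', h.le]

/-- A loop whose body decreases the measure `μ` and keeps the invariant. -/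
theorem exec_while {T : ℕ} (Inv : State → Prop) (μ : State → ℕ)
    (hstep : ∀ s, Inv s → s.reg a < s.reg b →
      Exec P s fun s' t => t ≤ T ∧ Inv s' ∧ μ s' < μ s) :
    ∀ s, Inv s → Exec (.whileLt a b P) s fun s' t =>
      t ≤ μ s * (T + 1) + 1 ∧ Inv s' ∧ ¬ s'.reg a < s'.reg b := by
  intro s
  induction hk : μ s using Nat.strong_induction_on generalizing s with
  | _ k ih =>
    intro hs
    by_cases hlt : s.reg a < s.reg b
    · obtain ⟨s', t, h1, ht, hs', hμ⟩ := hstep s hs hlt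
      obtain ⟨s'', t', h2, ht', hs'', hlt'⟩ := ih (μ s') (hk ▸ hμ) s' rfl hs'
      refine ⟨s'', t + t' + 1, .while_true hlt h1 h2, ?_, hs'', hlt'⟩
      have : (μ s' + 1) * (T + 1) ≤ k * (T + 1) := Nat.mul_le_mul_right _ (hk ▸ hμ)
      rw [add_mul, one_mul] at this
      omega
    · exact ⟨s, 1, .while_false hlt, by omega, hs, hlt⟩

/-- A loop that executes the body for `i = 0, 1, …, reg b - 1`. Register `1` is supposed to
contain the number `1`. -/
def forTo (i b : ℕ) (P : Program) : Program :=
  .seq (.const i 0) (.whileLt i b (.seq P (.add i i 1)))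

theorem exec_forTo {i N T : ℕ} (Inv : ℕ → State → Prop) (h0 : Inv 0 (s.setReg i 0))
    (hb : ∀ k s', Inv k s' → s'.reg b = N ∧ s'.reg i = k)
    (hstep : ∀ k s', k < N → Inv k s' → Exec P s' fun s'' t =>
      t ≤ T ∧ s''.reg i = k ∧ s''.reg 1 = 1 ∧ Inv (k + 1) (s''.setReg i (k + 1))) :
    Exec (forTo i b P) s fun s' t => t ≤ N * (T + 2) + 2 ∧ Inv N s' := by
  unfold forTo
  rw [exec_seq, exec_const]
  refine (exec_while (T := T + 1) (fun s' => ∃ k ≤ N, Inv k s') (fun s' => N - s'.reg i) ?_ _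
    ⟨0, Nat.zero_le _, h0⟩).mono ?_
  · rintro s' ⟨k, hk, hs'⟩ hlt
    obtain ⟨h1, h2⟩ := hb k s' hs'
    have hkN : k < N := by omega
    rw [exec_seq]
    refine (hstep k s' hkN hs').mono ?_
    rintro s'' t ⟨ht, hi, h1', hInv⟩
    rw [exec_add, hi, h1']
    refine ⟨by omega, ⟨k + 1, hkN, hInv⟩, ?_⟩
    simp only [reg_setReg, if_true]
    omega
  · rintro s' t ⟨ht, ⟨k, hk, hs'⟩, hlt⟩
    obtain ⟨h1, h2⟩ := hb k s' hs'
    obtain rfl : k = N := by omega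
    refine ⟨?_, hs'⟩
    simp only [reg_setReg, if_true] at ht
    have : T + 1 + 1 = T + 2 := rfl
    rw [this, Nat.sub_zero] at ht
    omega

/-- The registers below `B`, the real registers below `R` and the real memory are the same in both
states. -/
structure Keeps (B R : ℕ) (s s' : State) : Prop where
  reg : ∀ r < B, s'.reg r = s.reg r
  rreg : ∀ r < R, s'.rreg r = s.rreg r
  rmem : s'.rmem = s.rmem

variable {s' s'' : State} {B R B' R' : ℕ} {y : ℝ}

@[simp] theorem Keeps.refl : Keeps B R s s := ⟨fun _ _ => rfl, fun _ _ => rfl, rfl⟩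

theorem Keeps.trans (h : Keeps B R s s') (h' : Keeps B' R' s' s'') (hB : B ≤ B') (hR : R ≤ R') :
    Keeps B R s s'' :=
  ⟨fun r hr => (h'.reg r (by omega)).trans (h.reg r hr),
    fun r hr => (h'.rreg r (by omega)).trans (h.rreg r hr), h'.rmem.trans h.rmem⟩

theorem Keeps.of_le (h : Keeps B' R' s s') (hB : B ≤ B') (hR : R ≤ R') : Keeps B R s s' :=
  Keeps.refl.trans h hB hR

@[simp] theorem keeps_setReg (h : B ≤ a) : Keeps B R s (s'.setReg a x) ↔ Keeps B R s s' := by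
  have : ∀ r < B, (s'.setReg a x).reg r = s'.reg r := fun r hr => by
    rw [reg_setReg, if_neg (by omega)]
  exact ⟨fun k => ⟨fun r hr => (this r hr) ▸ k.reg r hr, k.rreg, k.rmem⟩,
    fun k => ⟨fun r hr => (this r hr) ▸ k.reg r hr, k.rreg, k.rmem⟩⟩

@[simp] theorem keeps_setMem : Keeps B R s (s'.setMem a x) ↔ Keeps B R s s' :=
  ⟨fun k => ⟨k.reg, k.rreg, k.rmem⟩, fun k => ⟨k.reg, k.rreg, k.rmem⟩⟩

@[simp] theorem keeps_setReal (h : R ≤ a) : Keeps B R s (s'.setReal a y) ↔ Keeps B R s s' := by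
  have : ∀ r < R, (s'.setReal a y).rreg r = s'.rreg r := fun r hr => by
    rw [rreg_setReal, if_neg (by omega)]
  exact ⟨fun k => ⟨k.reg, fun r hr => (this r hr) ▸ k.rreg r hr, k.rmem⟩,
    fun k => ⟨k.reg, fun r hr => (this r hr) ▸ k.rreg r hr, k.rmem⟩⟩

end Exec

/-! ### The global data and distances -/

section Distance

variable {n d : ℕ} {G : SimpleGraph (Fin n)} {q : Fin n → Fin d → ℝ} {s s' : State}

/-- The constants and the input that are available throughout the computation: the registers
`0, …, 8` contain `n`, `1`, `0`, `d`, `ballRatio d`, the addresses of the array of labels, of the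
layout and of the table, and the length of a row of the table. -/
structure Ctx (G : SimpleGraph (Fin n)) (q : Fin n → Fin d → ℝ) (s : State) : Prop where
  reg0 : s.reg 0 = n
  reg1 : s.reg 1 = 1
  reg2 : s.reg 2 = 0
  reg3 : s.reg 3 = d
  reg4 : s.reg 4 = ballRatio d
  reg5 : s.reg 5 = n * n
  reg6 : s.reg 6 = n * n + n
  reg7 : s.reg 7 = n * n + 2 * n
  reg8 : s.reg 8 = n + 1
  rreg0 : s.rreg 0 = 0
  adj : ∀ i j : Fin n, s.mem (i * n + j) = if G.Adj i j then 1 else 0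
  pts : ∀ (i : Fin n) (k : Fin d), s.rmem (i * d + k) = q i k

theorem addr_lt (i j : Fin n) : (i : ℕ) * n + j < n * n := by
  have h1 : ((i : ℕ) + 1) * n ≤ n * n := Nat.mul_le_mul_right _ i.2
  have h2 := j.2
  rw [add_mul] at h1
  omega

theorem Ctx.keeps {B R : ℕ} (h : Ctx G q s) (hk : Keeps B R s s')
    (hmem : ∀ a < n * n, s'.mem a = s.mem a) (hB : 9 ≤ B := by norm_num)
    (hR : 1 ≤ R := by norm_num) : Ctx G q s' := by
  obtain ⟨h0, h1, h2, h3, h4, h5, h6, h7, h8, hr, ha, hp⟩ := h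
  refine ⟨?_, ?_, ?_, ?_, ?_, ?_, ?_, ?_, ?_, ?_, ?_, ?_⟩
  all_goals try (rw [hk.reg _ (by omega)]; assumption)
  · rw [hk.rreg _ (by omega)]; assumption
  · intro i j
    rw [hmem _ (addr_lt i j), ha]
  · intro i k
    rw [hk.rmem, hp]

/-- Compute the distance of the points of the vertices in registers `50` and `51`. -/
def distProg : Program := block [
  .const 52 0, .const 54 0,
  forTo 53 3 (block [.add 52 52 50, .add 54 54 51]),
  .rsub 50 0 0,
  forTo 53 3 (block [
    .rload 51 52, .rload 52 54, .rsub 53 51 52,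
    .ifRLt 53 0 (.rsub 53 0 53) .skip,
    .ifRLt 50 53 (.radd 50 53 0) .skip,
    .add 52 52 1, .add 54 54 1])]

/-- A bound for the running time of `distProg`. -/
def distTime (d : ℕ) : ℕ := d * 20 + 20

theorem distProg_spec (hs : Ctx G q s) {u v : Fin n} (hu : s.reg 50 = u) (hv : s.reg 51 = v) :
    Exec distProg s fun s' t => t ≤ distTime d ∧ Keeps 50 50 s s' ∧ s'.mem = s.mem ∧
      s'.rreg 50 = dist (q u) (q v) := by
  unfold distProg
  simp only [exec_block_cons, exec_block_nil, exec_const]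
  refine (exec_forTo (N := d) (T := 3) (fun k s' => Keeps 52 50 s s' ∧ s'.mem = s.mem ∧
    s'.reg 53 = k ∧ s'.reg 52 = u * k ∧ s'.reg 54 = v * k) (by simp) ?_ ?_).mono ?_
  · rintro k s' ⟨h1, -, h2, -⟩
    exact ⟨by rw [h1.reg 3 (by norm_num), hs.reg3], h2⟩
  · rintro k s' hk ⟨h1, h2, h3, h4, h5⟩
    have e1 := h1.reg 1 (by norm_num)
    have e2 := h1.reg 50 (by norm_num)
    have e3 := h1.reg 51 (by norm_num)
    simp [h1, h2, h3, h4, h5, e1, e2, e3, hs.reg1, hu, hv, mul_add]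
  rintro s₁ t₁ ⟨ht₁, h1, h2, -, h4, h5⟩
  simp only [exec_rsub]
  refine (exec_forTo (N := d) (T := 12) (fun k s' => Keeps 50 50 s s' ∧ s'.mem = s.mem ∧
    s'.reg 53 = k ∧ s'.reg 52 = u * d + k ∧ s'.reg 54 = v * d + k ∧ 0 ≤ s'.rreg 50 ∧
    (∀ j : Fin d, (j : ℕ) < k → dist (q u j) (q v j) ≤ s'.rreg 50) ∧
    s'.rreg 50 ≤ dist (q u) (q v)) ?_ ?_ ?_).mono ?_
  · simp [h2, h4, h5, h1.of_le]
  · rintro k s' ⟨h1, -, h2, -⟩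
    exact ⟨by rw [h1.reg 3 (by norm_num), hs.reg3], h2⟩
  · rintro k s' hk ⟨h1, h2, h3, h4, h5, h6, h7, h8⟩
    have e1 : s'.reg 1 = 1 := (h1.reg 1 (by norm_num)).trans hs.reg1
    have e0 : s'.rreg 0 = 0 := (h1.rreg 0 (by norm_num)).trans hs.rreg0
    have e2 : s'.rmem (u * d + k) = q u ⟨k, hk⟩ := by rw [h1.rmem]; exact hs.pts u ⟨k, hk⟩
    have e3 : s'.rmem (v * d + k) = q v ⟨k, hk⟩ := by rw [h1.rmem]; exact hs.pts v ⟨k, hk⟩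
    have e4 := dist_le_pi_dist (q u) (q v) ⟨k, hk⟩
    have e5 : ∀ x : ℝ, s'.rreg 50 ≤ x → dist (q u ⟨k, hk⟩) (q v ⟨k, hk⟩) ≤ x →
        ∀ j : Fin d, (j : ℕ) ≤ k → dist (q u j) (q v j) ≤ x := by
      intro x hx1 hx2 j hj
      rcases hj.lt_or_eq with hj | rfl
      · exact (h7 j hj).trans hx1
      · exact hx2
    rw [Real.dist_eq] at e4 e5
    rcases abs_cases (q u ⟨k, hk⟩ - q v ⟨k, hk⟩) with ⟨h9, h10⟩ | ⟨h9, h10⟩ <;>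
      rw [h9] at e4 e5
    · simp [h1, h2, h3, h4, h5, e0, e1, e2, e3, not_lt.2 h10]
      split_ifs with h11
      · exact ⟨by ring, by ring, by linarith, e5 _ h11.le le_rfl, by linarith⟩
      · exact ⟨by ring, by ring, h6, e5 _ le_rfl (not_lt.1 h11), h8⟩
    · simp [h1, h2, h3, h4, h5, e0, e1, e2, e3, h10]
      split_ifs with h11
      · exact ⟨by ring, by ring, by linarith, e5 _ h11.le (by linarith), by linarith⟩
      · exact ⟨by ring, by ring, h6, e5 _ le_rfl (by linarith), h8⟩
  · rintro s₂ t₂ ⟨ht₂, h1, h2, h3, h4, h5, h6, h7, h8⟩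
    refine ⟨?_, h1, h2, le_antisymm h8 ((dist_pi_le_iff h6).2 fun j => h7 j j.2)⟩
    unfold distTime
    omega

end Distance

/-! ### Loops over a group of vertices -/

section Group

variable {n d : ℕ} {G : SimpleGraph (Fin n)} {q : Fin n → Fin d → ℝ} {s s' : State}
  {lab : Fin n → ℕ} {c : ℕ}

/-- Execute `P` for every vertex `reg i` of the group `reg 10`; register `tmp` is used for the
label. -/
def forGroup (i tmp : ℕ) (P : Program) : Program :=
  forTo i 0 (block [.add tmp 5 i, .load tmp tmp, ifEq tmp 10 P .skip])

/-- The state contains the labels `lab` and the number `c` of the current group. -/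
structure HasLabels (lab : Fin n → ℕ) (c : ℕ) (s : State) : Prop where
  cur : s.reg 10 = c
  label : ∀ v : Fin n, s.mem (n * n + v) = lab v

theorem HasLabels.keeps {B R : ℕ} (h : HasLabels lab c s) (hk : Keeps B R s s')
    (hmem : s'.mem = s.mem) (hB : 11 ≤ B := by norm_num) : HasLabels lab c s' :=
  ⟨(hk.reg 10 hB).trans h.cur, fun v => by rw [hmem, h.label]⟩

theorem exec_forGroup {i tmp T B R : ℕ} {P : Program} (hs : Ctx G q s) (hl : HasLabels lab c s)
    (hB : 11 ≤ B) (hi : B ≤ i) (htmp : B ≤ tmp) (hne : i ≠ tmp)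
    (Inv : ℕ → State → Prop) (h0 : Inv 0 s)
    (hInv : ∀ k s' i' x, i' = i ∨ i' = tmp → Inv k s' → Inv k (s'.setReg i' x))
    (hskip : ∀ k : Fin n, ∀ s', lab k ≠ c → Inv k s' → Inv (k + 1) s')
    (hstep : ∀ k : Fin n, ∀ s', Keeps B R s s' → s'.mem = s.mem → s'.reg i = k → lab k = c →
      Inv k s' → Exec P s' fun s'' t =>
        t ≤ T ∧ Keeps B R s s'' ∧ s''.mem = s.mem ∧ s''.reg i = k ∧ Inv (k + 1) s'') :
    Exec (forGroup i tmp P) s fun s' t =>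
      t ≤ n * (T + 8) + 2 ∧ Keeps B R s s' ∧ s'.mem = s.mem ∧ Inv n s' := by
  refine (exec_forTo (N := n) (T := T + 6) (fun k s' => Keeps B R s s' ∧ s'.mem = s.mem ∧
    s'.reg i = k ∧ Inv k s') ?_ ?_ ?_).mono ?_
  · exact ⟨by simp [hi], rfl, by simp, hInv _ _ _ _ (Or.inl rfl) h0⟩
  · rintro k s' ⟨h1, -, h2, -⟩
    exact ⟨by rw [h1.reg 0 (by omega), hs.reg0], h2⟩
  · rintro k s' hk ⟨h1, h2, h3, h4⟩
    have e1 := h1.reg 5 (by omega)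
    have e2 := h1.reg 10 (by omega)
    have e3 : s.mem (n * n + k) = lab ⟨k, hk⟩ := hl.label ⟨k, hk⟩
    have e4 : ∀ s'' : State, Keeps B R s s'' → s''.reg 1 = 1 := fun s'' h =>
      (h.reg 1 (by omega)).trans hs.reg1
    have h10 : (10 : ℕ) ≠ tmp := by omega
    simp only [exec_block_cons, exec_block_nil, exec_add, exec_load, exec_ifEq, reg_setReg,
      mem_setReg, if_true, if_neg h10, h2, h3, e1, e2, e3, hs.reg5, hl.cur]
    set s₁ := (s'.setReg tmp (n * n + k)).setReg tmp (lab ⟨k, hk⟩) with hs₁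
    have k1 : Keeps B R s s₁ := by simp [hs₁, htmp, h1]
    have k2 : s₁.reg i = k := by simp [hs₁, hne, h3]
    have k3 : Inv k s₁ := hInv _ _ _ _ (Or.inr rfl) (hInv _ _ _ _ (Or.inr rfl) h4)
    split_ifs with hc
    · refine (hstep ⟨k, hk⟩ s₁ k1 h2 k2 hc k3).mono ?_
      rintro s'' t ⟨ht, k4, k5, k6, k7⟩
      exact ⟨by omega, k6, e4 _ k4, by simp [hi, k4], k5, by simp, hInv _ _ _ _ (Or.inl rfl) k7⟩
    · simp only [exec_skip]
      refine ⟨by omega, k2, e4 _ k1, by simp [hi, k1], h2, by simp, hInv _ _ _ _ (Or.inl rfl) ?_⟩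
      exact hskip ⟨k, hk⟩ s₁ hc k3
  · rintro s' t ⟨ht, h1, h2, -, h4⟩
    exact ⟨ht, h1, h2, h4⟩

/-- The number of vertices below `k` that satisfy `P`. -/
noncomputable def countBelow (P : Fin n → Prop) (k : ℕ) : ℕ :=
  (univ.filter fun x : Fin n => P x ∧ (x : ℕ) < k).card

theorem countBelow_zero (P : Fin n → Prop) : countBelow P 0 = 0 := by simp [countBelow]

theorem countBelow_self (P : Fin n → Prop) : countBelow P n = (univ.filter P).card := by
  simp [countBelow]

theorem countBelow_succ (P : Fin n → Prop) (k : Fin n) :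
    countBelow P (k + 1) = countBelow P k + if P k then 1 else 0 := by
  unfold countBelow
  split_ifs with h
  · rw [← card_insert_of_notMem (a := k) (by simp)]
    congr 1
    ext x
    simp only [mem_filter, mem_univ, true_and, mem_insert, Nat.lt_succ_iff, Fin.ext_iff]
    refine ⟨fun ⟨h1, h2⟩ => ?_, ?_⟩
    · rcases h2.lt_or_eq with h2 | h2
      exacts [Or.inr ⟨h1, h2⟩, Or.inl h2]
    · rintro (h1 | h1)
      · exact ⟨(Fin.ext h1 : x = k) ▸ h, h1.le⟩
      · exact ⟨h1.1, h1.2.le⟩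
  · rw [add_zero]
    congr 1
    ext x
    simp only [mem_filter, mem_univ, true_and, Nat.lt_succ_iff]
    refine and_congr_right fun hx => ⟨fun h1 => ?_, le_of_lt⟩
    rcases h1.lt_or_eq with h1 | h1
    exacts [h1, absurd ((Fin.ext h1 : x = k) ▸ hx) h]

/-- Add up `reg w` over the vertices `reg 41` of the current group for which `test` executes its
argument. The result is in register `42`. -/
def countProg (w : ℕ) (test : Program → Program) : Program := block [
  .const 42 0,
  forGroup 41 43 (test (.add 42 42 w))]

/-- A bound for the running time of `countProg`. -/
def countTime (n d : ℕ) : ℕ := n * (distTime d + 20) + 10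

theorem countProg_spec {w : ℕ} {test : Program → Program} (hs : Ctx G q s)
    (hl : HasLabels lab c s) (P : Fin n → Prop)
    (htest : ∀ s', ∀ x : Fin n, Keeps 41 42 s s' → s'.mem = s.mem → s'.reg 41 = x →
      Exec (test (.add 42 42 w)) s' fun s'' t => t ≤ distTime d + 10 ∧ Keeps 41 42 s s'' ∧
        s''.mem = s.mem ∧ s''.reg 41 = x ∧
        s''.reg 42 = s'.reg 42 + if P x then s.reg w else 0) :
    Exec (countProg w test) s fun s' t => t ≤ countTime n d ∧ Keeps 41 42 s s' ∧
      s'.mem = s.mem ∧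
      s'.reg 42 = (univ.filter fun x => lab x = c ∧ P x).card * s.reg w := by
  unfold countProg
  simp only [exec_block_cons, exec_block_nil, exec_const]
  have k0 : Keeps 41 42 s (s.setReg 42 0) := by simp
  refine (exec_forGroup (lab := lab) (c := c) (B := 41) (R := 42) (T := distTime d + 10)
    (hs.keeps k0 fun _ _ => rfl) (hl.keeps k0 rfl) (by norm_num) (by norm_num) (by norm_num)
    (by norm_num)
    (fun k s' => s'.reg 42 = countBelow (fun x => lab x = c ∧ P x) k * s.reg w) ?_ ?_ ?_ ?_).mono
    ?_
  · simp [countBelow_zero]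
  · rintro k s' i' x (rfl | rfl) h <;> simpa using h
  · intro k s' hk h
    rw [countBelow_succ, if_neg fun h => hk h.1]
    exact h
  · intro k s' h1 h2 h3 h4 h5
    have k1 : Keeps 41 42 s s' := k0.trans h1 le_rfl le_rfl
    refine (htest s' k k1 h2 h3).mono ?_
    rintro s'' t ⟨ht, h6, h7, h8, h9⟩
    refine ⟨ht, ⟨fun r hr => ?_, h6.rreg, h6.rmem⟩, h7, h8, ?_⟩
    · rw [h6.reg r hr, reg_setReg, if_neg (by omega)]
    · rw [countBelow_succ, h9, h5]
      simp only [h4, true_and]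
      split_ifs <;> ring
  · rintro s' t ⟨ht, h1, h2, h3⟩
    refine ⟨?_, k0.trans h1 le_rfl le_rfl, h2, ?_⟩
    · unfold countTime
      have : n * (distTime d + 10 + 8) ≤ n * (distTime d + 20) := Nat.mul_le_mul_left _ (by omega)
      omega
    · rw [h3, countBelow_self]
      congr!

/-- Count the current group. -/
def groupCount : Program := countProg 1 fun P => P

/-- Count the vertices of the current group at distance at most `rreg 40` from the vertex in
register `40`, with weight `ballRatio d`. -/
def cubeCount : Program := countProg 4 fun P => block [
  .add 50 40 2, .add 51 41 2, distProg, .ifRLt 40 50 .skip P]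

/-- Count the vertices of the current group at distance more than `rreg 40` and at most `rreg 41`
from the vertex in register `40`. -/
def shellCount : Program := countProg 1 fun P => block [
  .add 50 40 2, .add 51 41 2, distProg, .ifRLt 40 50 (.ifRLt 41 50 .skip P) .skip]

theorem groupCount_spec (hs : Ctx G q s) (hl : HasLabels lab c s) :
    Exec groupCount s fun s' t => t ≤ countTime n d ∧ Keeps 41 42 s s' ∧ s'.mem = s.mem ∧
      s'.reg 42 = (univ.filter fun x => lab x = c).card := by
  refine (countProg_spec hs hl (fun _ => True) ?_).mono ?_
  · intro s' x h1 h2 h3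
    have e1 := h1.reg 1 (by norm_num)
    simp [h1, h2, h3, e1]
  · rintro s' t ⟨h1, h2, h3, h4⟩
    refine ⟨h1, h2, h3, ?_⟩
    rw [h4, hs.reg1, mul_one]
    simp

theorem exec_dist_test {p x : Fin n} (hs : Ctx G q s) (hp : s.reg 40 = p) (h1 : Keeps 41 42 s s')
    (h2 : s'.mem = s.mem) (h3 : s'.reg 41 = x) {Ps : List Program} {Q : State → ℕ → Prop}
    (h : ∀ s'' t, t ≤ distTime d + 2 → Keeps 41 42 s s'' → s''.mem = s.mem → s''.reg 41 = x →
      s''.reg 42 = s'.reg 42 → s''.rreg 50 = dist (q p) (q x) →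
      Exec (block Ps) s'' fun s₃ t' => Q s₃ (t + t')) :
    Exec (block (.add 50 40 2 :: .add 51 41 2 :: distProg :: Ps)) s' Q := by
  simp only [exec_block_cons, exec_add]
  have e1 := h1.reg 40 (by norm_num)
  have e2 := h1.reg 2 (by norm_num)
  refine (distProg_spec (u := p) (v := x)
    (hs.keeps (s' := (s'.setReg 50 (s'.reg 40 + s'.reg 2)).setReg 51
      ((s'.setReg 50 (s'.reg 40 + s'.reg 2)).reg 41 + (s'.setReg 50
        (s'.reg 40 + s'.reg 2)).reg 2)) (B := 41) (R := 42) (by simp [h1]) (by simp [h2]))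
    (by simp [e1, e2, hp, hs.reg2]) (by simp [e2, h3, hs.reg2])).mono ?_
  rintro s'' t ⟨ht, h4, h5, h6⟩
  refine (h s'' (t + 2) (by omega) ?_ (by simp [h5, h2]) ?_ ?_ h6).mono ?_
  · exact Keeps.trans (s' := _) (by simp [h1]) h4 (by norm_num) (by norm_num)
  · rw [h4.reg 41 (by norm_num)]; simp [h3]
  · rw [h4.reg 42 (by norm_num)]; simp
  · intro s₃ t' hQ
    convert hQ using 1
    ring

theorem cubeCount_spec (hs : Ctx G q s) (hl : HasLabels lab c s) {p : Fin n}
    (hp : s.reg 40 = p) :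
    Exec cubeCount s fun s' t => t ≤ countTime n d ∧ Keeps 41 42 s s' ∧ s'.mem = s.mem ∧
      s'.reg 42 = ballRatio d *
        (cube q (univ.filter fun x => lab x = c) p (s.rreg 40)).card := by
  refine (countProg_spec hs hl (fun x => dist (q p) (q x) ≤ s.rreg 40) ?_).mono ?_
  · intro s' x h1 h2 h3
    refine exec_dist_test hs hp h1 h2 h3 fun s'' t ht h4 h5 h6 h7 h8 => ?_
    have e1 := h4.rreg 40 (by norm_num)
    have e2 := h4.reg 4 (by norm_num)
    by_cases hlt : s.rreg 40 < dist (q p) (q x)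
    · simp [e1, h8, hlt, not_le.2 hlt, h4, h5, h6, h7]
      omega
    · simp [e1, e2, h8, hlt, not_lt.1 hlt, h4, h5, h6, h7]
      omega
  · rintro s' t ⟨h1, h2, h3, h4⟩
    refine ⟨h1, h2, h3, ?_⟩
    rw [h4, hs.reg4, mul_comm, cube, filter_filter]

theorem shellCount_spec (hs : Ctx G q s) (hl : HasLabels lab c s) {p : Fin n} {L : ℝ}
    (hp : s.reg 40 = p) (hL : s.rreg 41 = s.rreg 40 + L) :
    Exec shellCount s fun s' t => t ≤ countTime n d ∧ Keeps 41 42 s s' ∧ s'.mem = s.mem ∧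
      s'.reg 42 = (shell q (univ.filter fun x => lab x = c) p L (s.rreg 40)).card := by
  refine (countProg_spec hs hl (fun x => s.rreg 40 < dist (q p) (q x) ∧
    dist (q p) (q x) ≤ s.rreg 40 + L) ?_).mono ?_
  · intro s' x h1 h2 h3
    refine exec_dist_test hs hp h1 h2 h3 fun s'' t ht h4 h5 h6 h7 h8 => ?_
    have e1 := h4.rreg 40 (by norm_num)
    have e2 := h4.reg 1 (by norm_num)
    have e3 := h4.rreg 41 (by norm_num)
    by_cases hlt : s.rreg 40 < dist (q p) (q x)
    · by_cases hlt' : s.rreg 40 + L < dist (q p) (q x)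
      · simp [e1, e3, hL, h8, hlt, hlt', not_le.2 hlt', h4, h5, h6, h7]
        omega
      · simp [e1, e2, e3, hL, h8, hlt, hlt', not_lt.1 hlt', h4, h5, h6, h7]
        omega
    · simp [e1, h8, hlt, h4, h5, h6, h7]
      omega
  · rintro s' t ⟨h1, h2, h3, h4⟩
    refine ⟨h1, h2, h3, ?_⟩
    rw [h4, hs.reg1, mul_one, shell, filter_filter]
    congr!

end Group

/-! ### Computing a smallest dense cube -/

section Search

variable {n d : ℕ} {G : SimpleGraph (Fin n)} {q : Fin n → Fin d → ℝ} {s s' : State}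
  {lab : Fin n → ℕ} {c : ℕ} {L : ℝ}

/-- The cube about `p` with `y` on its boundary contains at least one in `ballRatio d` of the
points of `S`. -/
def IsDensePair (q : Fin n → Fin d → ℝ) (S : Finset (Fin n)) (p y : Fin n) : Prop :=
  p ∈ S ∧ y ∈ S ∧ S.card ≤ ballRatio d * (cube q S p (dist (q p) (q y))).card

/-- The search for a smallest dense cube has examined the pairs satisfying `D`: `f` tells whether a
dense pair has been found, `b` is the centre and `R` the radius of the best one. -/
def SearchInv (q : Fin n → Fin d → ℝ) (S : Finset (Fin n)) (D : Fin n → Fin n → Prop) (f b : ℕ)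
    (R : ℝ) : Prop :=
  (f = 0 ∧ ∀ p y, D p y → ¬ IsDensePair q S p y) ∨
  (f = 1 ∧ ∃ p y, IsDensePair q S p y ∧ b = p ∧ R = dist (q p) (q y) ∧
    ∀ p' y', D p' y' → IsDensePair q S p' y' → R ≤ dist (q p') (q y'))

theorem SearchInv.mono {S : Finset (Fin n)} {D D' : Fin n → Fin n → Prop} {f b : ℕ} {R : ℝ}
    (h : SearchInv q S D f b R) (hD : ∀ p y, D' p y → IsDensePair q S p y → D p y) :
    SearchInv q S D' f b R := by
  rcases h with ⟨h1, h2⟩ | ⟨h1, p, y, h2, h3, h4, h5⟩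
  · exact Or.inl ⟨h1, fun p y hp hd => h2 p y (hD p y hp hd) hd⟩
  · exact Or.inr ⟨h1, p, y, h2, h3, h4, fun p' y' hp hd => h5 p' y' (hD p' y' hp hd) hd⟩

theorem SearchInv.update {S : Finset (Fin n)} {D D' : Fin n → Fin n → Prop} {f b : ℕ} {R : ℝ}
    {p y : Fin n} (h : SearchInv q S D f b R)
    (hD : ∀ p' y', D' p' y' → D p' y' ∨ (p' = p ∧ y' = y)) (hpy : IsDensePair q S p y)
    (hlt : f = 1 → dist (q p) (q y) < R) : SearchInv q S D' 1 p (dist (q p) (q y)) := by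
  refine Or.inr ⟨rfl, p, y, hpy, rfl, rfl, fun p' y' h1 h2 => ?_⟩
  rcases hD p' y' h1 with h3 | ⟨rfl, rfl⟩
  · rcases h with ⟨h4, h5⟩ | ⟨h4, -, -, -, -, -, h5⟩
    · exact absurd h2 (h5 p' y' h3)
    · exact (hlt h4).le.trans (h5 p' y' h3 h2)
  · exact le_rfl

theorem SearchInv.skip {S : Finset (Fin n)} {D D' : Fin n → Fin n → Prop} {f b : ℕ} {R : ℝ}
    {p y : Fin n} (h : SearchInv q S D f b R)
    (hD : ∀ p' y', D' p' y' → D p' y' ∨ (p' = p ∧ y' = y))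
    (hlt : f = 1 ∧ R ≤ dist (q p) (q y)) : SearchInv q S D' f b R := by
  rcases h with ⟨h1, h2⟩ | ⟨h1, p₀, y₀, h2, h3, h4, h5⟩
  · omega
  · refine Or.inr ⟨h1, p₀, y₀, h2, h3, h4, fun p' y' hp hd => ?_⟩
    rcases hD p' y' hp with h6 | ⟨rfl, rfl⟩
    exacts [h5 p' y' h6 hd, hlt.2]

/-- Record the centre `reg 30` and the radius `rreg 40` of the current cube. -/
def recordCube : Program := block [.const 34 1, .add 35 30 2, .radd 31 40 0]

/-- Compute the centre (register `35`) and the radius (real register `31`) of a smallest dense cube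
for the current group, whose size is in register `12`. -/
def findCube : Program := block [
  .const 34 0,
  forGroup 30 31 (forGroup 32 33 (block [
    .add 50 30 2, .add 51 32 2, distProg, .radd 40 50 0, .add 40 30 2, cubeCount,
    .ifLt 42 12 .skip (ifEq 34 1 (.ifRLt 40 31 recordCube .skip) recordCube)]))]

/-- A bound for the running time of `findCube`. -/
def cubeTime (n d : ℕ) : ℕ := n * (n * (distTime d + countTime n d + 40) + 20) + 10

theorem findCube_body {p y : Fin n} (hs : Ctx G q s) (hl : HasLabels lab c s)
    (hp : s.reg 30 = p) (hy : s.reg 32 = y) (hpc : lab p = c) (hyc : lab y = c)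
    (h12 : s.reg 12 = (univ.filter fun x => lab x = c).card) {D D' : Fin n → Fin n → Prop}
    (hD : ∀ p' y', D' p' y' → D p' y' ∨ (p' = p ∧ y' = y))
    (hInv : SearchInv q (univ.filter fun x => lab x = c) D (s.reg 34) (s.reg 35) (s.rreg 31)) :
    Exec (block [.add 50 30 2, .add 51 32 2, distProg, .radd 40 50 0, .add 40 30 2, cubeCount,
      .ifLt 42 12 .skip (ifEq 34 1 (.ifRLt 40 31 recordCube .skip) recordCube)]) s fun s' t =>
      t ≤ distTime d + countTime n d + 20 ∧ Keeps 34 31 s s' ∧ s'.mem = s.mem ∧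
        SearchInv q (univ.filter fun x => lab x = c) D' (s'.reg 34) (s'.reg 35) (s'.rreg 31) := by
  set S := univ.filter fun x => lab x = c with hS
  simp only [exec_block_cons, exec_add]
  refine (distProg_spec (u := p) (v := y) (hs.keeps (B := 50) (R := 50)
    (s' := (s.setReg 50 (s.reg 30 + s.reg 2)).setReg 51 _) (by simp)
    (fun _ _ => rfl)) ?_ ?_).mono ?_
  · simp [hp, hs.reg2]
  · simp [hy, hs.reg2]
  rintro s₁ t₁ ⟨ht₁, k₁, m₁, d₁⟩
  replace k₁ : Keeps 50 50 s s₁ := Keeps.trans (by simp) k₁ le_rfl le_rfl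
  simp only [mem_setReg] at m₁
  simp only [exec_radd, d₁, reg_setReal, k₁.reg 30 (by norm_num), k₁.reg 2 (by norm_num),
    k₁.rreg 0 (by norm_num), hs.rreg0, hp, hs.reg2, add_zero]
  set s₂ := (s₁.setReal 40 (dist (q p) (q y))).setReg 40 p with hs₂
  have k₂ : Keeps 40 40 s s₂ := by simp [hs₂, k₁.of_le]
  have m₂ : s₂.mem = s.mem := m₁
  refine (cubeCount_spec (p := p) (hs.keeps k₂ fun _ _ => by rw [m₂]) (hl.keeps k₂ m₂)
    (by simp [hs₂])).mono ?_
  rintro s₃ t₃ ⟨ht₃, k₃, m₃, c₃⟩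
  have r₃ : s₃.rreg 40 = dist (q p) (q y) := by rw [k₃.rreg 40 (by norm_num)]; simp [hs₂]
  replace k₃ : Keeps 40 40 s s₃ := k₂.trans k₃ (by norm_num) (by norm_num)
  rw [show s₂.rreg 40 = dist (q p) (q y) by simp [hs₂]] at c₃
  have hpS : p ∈ S := by simp [hS, hpc]
  have hyS : y ∈ S := by simp [hS, hyc]
  simp only [exec_ifLt, exec_ifEq, exec_ifRLt, exec_block_nil, exec_skip, recordCube,
    exec_block_cons, exec_const, exec_add, exec_radd, c₃, r₃, k₃.reg 12 (by norm_num), h12,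
    k₃.reg 34 (by norm_num), k₃.reg 1 (by norm_num), k₃.rreg 31 (by norm_num), hs.reg1]
  have kk : Keeps 34 31 s s₃ := k₃.of_le (by norm_num) (by norm_num)
  have upd : (s.reg 34 = 1 → dist (q p) (q y) < s.rreg 31) → IsDensePair q S p y →
      Keeps 34 31 s (((s₃.setReg 34 1).setReg 35
        ((s₃.setReg 34 1).reg 30 + (s₃.setReg 34 1).reg 2)).setReal 31
          (s₃.rreg 40 + s₃.rreg 0)) ∧ s₃.mem = s.mem ∧
      SearchInv q S D' 1 (s₃.reg 30 + s₃.reg 2) (s₃.rreg 40 + s₃.rreg 0) := by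
    intro hlt hd
    refine ⟨by simp [kk], m₃.trans m₂, ?_⟩
    rw [k₃.reg 30 (by norm_num), k₃.reg 2 (by norm_num), r₃, k₃.rreg 0 (by norm_num), hs.rreg0,
      hs.reg2, hp, add_zero, add_zero]
    exact hInv.update hD hd hlt
  split_ifs with h1 h2 h3
  · refine ⟨by omega, kk, m₃.trans m₂, ?_⟩
    rw [k₃.reg 35 (by norm_num)]
    refine hInv.mono fun p' y' hD' hd => (hD p' y' hD').resolve_right ?_
    rintro ⟨rfl, rfl⟩
    exact absurd hd.2.2 (not_le.2 h1)
  · obtain ⟨u1, u2, u3⟩ := upd (fun _ => h3) ⟨hpS, hyS, not_lt.1 h1⟩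
    exact ⟨by omega, by simpa using u1, u2, by simpa using u3⟩
  · refine ⟨by omega, kk, m₃.trans m₂, ?_⟩
    rw [k₃.reg 35 (by norm_num)]
    exact hInv.skip hD ⟨h2, not_lt.1 h3⟩
  · obtain ⟨u1, u2, u3⟩ := upd (fun h => absurd h h2) ⟨hpS, hyS, not_lt.1 h1⟩
    exact ⟨by omega, by simpa using u1, u2, by simpa using u3⟩

theorem findCube_spec (hs : Ctx G q s) (hl : HasLabels lab c s)
    (h12 : s.reg 12 = (univ.filter fun x => lab x = c).card) (hne : ∃ v, lab v = c) :
    Exec findCube s fun s' t => t ≤ cubeTime n d ∧ Keeps 30 30 s s' ∧ s'.mem = s.mem ∧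
      ∃ p : Fin n, s'.reg 35 = p ∧
        IsDenseCube q (univ.filter fun x => lab x = c) p (s'.rreg 31) := by
  set S := univ.filter fun x => lab x = c with hS
  unfold findCube
  simp only [exec_block_cons, exec_block_nil, exec_const]
  have k0 : Keeps 30 30 s (s.setReg 34 0) := by simp
  refine (exec_forGroup (lab := lab) (c := c) (B := 30) (R := 30)
    (T := n * (distTime d + countTime n d + 28) + 2)
    (hs.keeps k0 fun _ _ => rfl) (hl.keeps k0 rfl) (by norm_num) (by norm_num) (by norm_num)
    (by norm_num)
    (fun k s' => SearchInv q S (fun p y => (p : ℕ) < k) (s'.reg 34) (s'.reg 35) (s'.rreg 31))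
    ?_ ?_ ?_ ?_).mono ?_
  · exact Or.inl ⟨by simp, fun p y h => absurd h (Nat.not_lt_zero _)⟩
  · rintro k s' i' x (rfl | rfl) h <;> simpa using h
  · intro k s' hk h
    refine h.mono fun p y hp hd => ?_
    have : p ≠ k := fun h => hk (h ▸ (mem_filter.1 hd.1).2)
    have := Fin.val_ne_of_ne this
    omega
  · intro p s₁ k₁ m₁ hp hpc hInv
    replace k₁ := k0.trans k₁ le_rfl le_rfl
    refine (exec_forGroup (lab := lab) (c := c) (B := 31) (R := 31)
      (T := distTime d + countTime n d + 20)
      (hs.keeps k₁ fun _ _ => by rw [m₁]; rfl) (hl.keeps k₁ m₁) (by norm_num) (by norm_num)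
      (by norm_num) (by norm_num)
      (fun k s' => SearchInv q S (fun p' y => (p' : ℕ) < p ∨ (p' = p ∧ (y : ℕ) < k))
        (s'.reg 34) (s'.reg 35) (s'.rreg 31)) ?_ ?_ ?_ ?_).mono ?_
    · refine hInv.mono ?_
      rintro p' y (h | ⟨-, h⟩) -
      exacts [h, absurd h (Nat.not_lt_zero _)]
    · rintro k s' i' x (rfl | rfl) h <;> simpa using h
    · intro k s' hk h
      refine h.mono fun p' y hp hd => hp.imp_right fun ⟨h1, h2⟩ => ⟨h1, ?_⟩
      have : y ≠ k := fun h => hk (h ▸ (mem_filter.1 hd.2.1).2)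
      have := Fin.val_ne_of_ne this
      omega
    · intro y s₂ k₂ m₂ hy hyc hInv₂
      have k₂' : Keeps 30 30 s s₂ := k₁.trans k₂ (by norm_num) (by norm_num)
      have m₂' : s₂.mem = s.mem := m₂.trans m₁
      refine (findCube_body (hs.keeps k₂' fun _ _ => by rw [m₂']) (hl.keeps k₂' m₂')
        (by rw [k₂.reg 30 (by norm_num), hp]) hy hpc hyc
        (by rw [k₂'.reg 12 (by norm_num), h12])
        (D' := fun p' y' => (p' : ℕ) < p ∨ (p' = p ∧ (y' : ℕ) < y + 1)) ?_ hInv₂).mono ?_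
      · rintro p' y' (h | ⟨h, h'⟩)
        · exact Or.inl (Or.inl h)
        · rcases Nat.lt_succ_iff_lt_or_eq.1 h' with h' | h'
          exacts [Or.inl (Or.inr ⟨h, h'⟩), Or.inr ⟨h, Fin.ext h'⟩]
      · rintro s₃ t₃ ⟨ht₃, k₃, m₃, hInv₃⟩
        exact ⟨ht₃, k₂.trans k₃ (by norm_num) le_rfl, m₃.trans m₂,
          by rw [k₃.reg 32 (by norm_num), hy], hInv₃⟩
    · rintro s₂ t₂ ⟨ht₂, k₂, m₂, hInv₂⟩
      refine ⟨ht₂, ?_, m₂.trans m₁, by rw [k₂.reg 30 (by norm_num), hp], hInv₂.mono ?_⟩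
      · have k₃ := k₁.trans k₂ (by norm_num) (by norm_num)
        refine ⟨fun r hr => ?_, fun r hr => k₃.rreg r hr, k₃.rmem⟩
        rw [k₃.reg r hr, reg_setReg, if_neg (by omega)]
      · intro p' y hp' _
        rcases Nat.lt_succ_iff_lt_or_eq.1 hp' with h | h
        exacts [Or.inl h, Or.inr ⟨Fin.ext h, y.2⟩]
  · rintro s₁ t₁ ⟨ht₁, k₁, m₁, hInv⟩
    refine ⟨?_, k0.trans k₁ le_rfl le_rfl, m₁, ?_⟩
    · unfold cubeTime
      have : n * (n * (distTime d + countTime n d + 28) + 2 + 8) ≤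
          n * (n * (distTime d + countTime n d + 40) + 20) :=
        Nat.mul_le_mul_left _ (by
          have : n * (distTime d + countTime n d + 28) ≤ n * (distTime d + countTime n d + 40) :=
            Nat.mul_le_mul_left _ (by omega)
          omega)
      omega
    · obtain ⟨v, hv⟩ := hne
      have hvS : v ∈ S := by simp [hS, hv]
      rcases hInv with ⟨-, h2⟩ | ⟨-, p, y, h2, h3, h4, h5⟩
      · obtain ⟨y, hy, hd⟩ := exists_isDenseCube_radius (q := q) hvS
        exact absurd ⟨hvS, hy, hd⟩ (h2 v y v.2)
      · refine ⟨p, h3, h2.1, ⟨y, h2.2.1, h4.symm⟩, h4 ▸ h2.2.2, fun p' hp' y' hy' hd => ?_⟩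
        exact h5 p' y' p'.2 ⟨hp', hy', hd⟩

end Search

/-! ### Computing a sparsest shell -/

section Shell

variable {n d : ℕ} {G : SimpleGraph (Fin n)} {q : Fin n → Fin d → ℝ} {s s' : State}
  {lab : Fin n → ℕ} {c : ℕ} {L : ℝ}

/-- The inner radius `dist (q p) (q y)` is admissible for a shell around a dense cube of
radius `R`. -/
def IsShellRadius (q : Fin n → Fin d → ℝ) (L : ℝ) (S : Finset (Fin n)) (p : Fin n) (R : ℝ)
    (y : Fin n) : Prop :=
  y ∈ S ∧ R ≤ dist (q p) (q y) ∧ dist (q p) (q y) + L ≤ 2 * R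

/-- The search for a sparsest shell has examined the vertices satisfying `D`: `f` tells whether an
admissible radius has been found, `b` is the size of the best shell, and `lo` and `hi` are its
radii. -/
def ShellInv (q : Fin n → Fin d → ℝ) (L : ℝ) (S : Finset (Fin n)) (p : Fin n) (R : ℝ)
    (D : Fin n → Prop) (f b : ℕ) (lo hi : ℝ) : Prop :=
  (f = 0 ∧ ∀ y, D y → ¬ IsShellRadius q L S p R y) ∨
  (f = 1 ∧ ∃ y, IsShellRadius q L S p R y ∧ lo = dist (q p) (q y) ∧ hi = lo + L ∧
    b = (shell q S p L lo).card ∧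
    ∀ y', D y' → IsShellRadius q L S p R y' → b ≤ (shell q S p L (dist (q p) (q y'))).card)

theorem ShellInv.mono {S : Finset (Fin n)} {p : Fin n} {R : ℝ} {D D' : Fin n → Prop} {f b : ℕ}
    {lo hi : ℝ} (h : ShellInv q L S p R D f b lo hi)
    (hD : ∀ y, D' y → IsShellRadius q L S p R y → D y) : ShellInv q L S p R D' f b lo hi := by
  rcases h with ⟨h1, h2⟩ | ⟨h1, y, h2, h3, h4, h5, h6⟩
  · exact Or.inl ⟨h1, fun y hy hr => h2 y (hD y hy hr) hr⟩
  · exact Or.inr ⟨h1, y, h2, h3, h4, h5, fun y' hy hr => h6 y' (hD y' hy hr) hr⟩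

theorem ShellInv.update {S : Finset (Fin n)} {p : Fin n} {R : ℝ} {D D' : Fin n → Prop} {f b : ℕ}
    {lo hi : ℝ} {y : Fin n} (h : ShellInv q L S p R D f b lo hi)
    (hD : ∀ y', D' y' → D y' ∨ y' = y) (hy : IsShellRadius q L S p R y)
    (hlt : f = 1 → (shell q S p L (dist (q p) (q y))).card < b) :
    ShellInv q L S p R D' 1 (shell q S p L (dist (q p) (q y))).card (dist (q p) (q y))
      (dist (q p) (q y) + L) := by
  refine Or.inr ⟨rfl, y, hy, rfl, rfl, rfl, fun y' h1 h2 => ?_⟩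
  rcases hD y' h1 with h3 | rfl
  · rcases h with ⟨h4, h5⟩ | ⟨h4, -, -, -, -, -, h5⟩
    · exact absurd h2 (h5 y' h3)
    · exact (hlt h4).le.trans (h5 y' h3 h2)
  · exact le_rfl

theorem ShellInv.skip {S : Finset (Fin n)} {p : Fin n} {R : ℝ} {D D' : Fin n → Prop} {f b : ℕ}
    {lo hi : ℝ} {y : Fin n} (h : ShellInv q L S p R D f b lo hi)
    (hD : ∀ y', D' y' → D y' ∨ y' = y)
    (hlt : f = 1 ∧ b ≤ (shell q S p L (dist (q p) (q y))).card) :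
    ShellInv q L S p R D' f b lo hi := by
  rcases h with ⟨h1, h2⟩ | ⟨h1, y₀, h2, h3, h4, h5, h6⟩
  · omega
  · refine Or.inr ⟨h1, y₀, h2, h3, h4, h5, fun y' hy hr => ?_⟩
    rcases hD y' hy with h7 | rfl
    exacts [h6 y' h7 hr, hlt.2]

/-- Record the size and the radii of the current shell. -/
def recordShell : Program :=
  block [.const 34 1, .add 36 42 2, .radd 33 40 0, .radd 34 41 0]

/-- Examine the shell whose inner radius is determined by the vertex in register `30`. -/
def shellBody : Program := block [
  .add 50 35 2, .add 51 30 2, distProg,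
  .ifRLt 50 31 .skip (block [
    .radd 40 50 0, .radd 41 50 1,
    .ifRLt 32 41 .skip (block [
      .add 40 35 2, shellCount,
      ifEq 34 1 (.ifLt 42 36 recordShell .skip) recordShell])])]

/-- Compute the radii (real registers `33` and `34`) of a sparsest shell of width `rreg 1` around
the cube with the centre `reg 35` and the radius `rreg 31`. -/
def findShell : Program := block [.const 34 0, .radd 32 31 31, forGroup 30 31 shellBody]

/-- A bound for the running time of `findShell`. -/
def shellTime (n d : ℕ) : ℕ := n * (distTime d + countTime n d + 60) + 10

theorem shellBody_spec {p y : Fin n} (hs : Ctx G q s) (hl : HasLabels lab c s) (hL : s.rreg 1 = L)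
    (hp : s.reg 35 = p) (hy : s.reg 30 = y) (hyc : lab y = c)
    (h32 : s.rreg 32 = 2 * s.rreg 31) {D D' : Fin n → Prop}
    (hD : ∀ y', D' y' → D y' ∨ y' = y)
    (hInv : ShellInv q L (univ.filter fun x => lab x = c) p (s.rreg 31) D (s.reg 34) (s.reg 36)
      (s.rreg 33) (s.rreg 34)) :
    Exec shellBody s fun s' t =>
      t ≤ distTime d + countTime n d + 50 ∧ Keeps 34 33 s s' ∧ s'.mem = s.mem ∧
        s'.reg 35 = p ∧
        ShellInv q L (univ.filter fun x => lab x = c) p (s.rreg 31) D' (s'.reg 34) (s'.reg 36)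
          (s'.rreg 33) (s'.rreg 34) := by
  set S := univ.filter fun x => lab x = c with hS
  have hyS : y ∈ S := by simp [hS, hyc]
  unfold shellBody
  simp only [exec_block_cons, exec_add]
  refine (distProg_spec (u := p) (v := y) (hs.keeps (B := 50) (R := 50)
    (s' := (s.setReg 50 (s.reg 35 + s.reg 2)).setReg 51 _) (by simp)
    (fun _ _ => rfl)) ?_ ?_).mono ?_
  · simp [hp, hs.reg2]
  · simp [hy, hs.reg2]
  rintro s₁ t₁ ⟨ht₁, k₁, m₁, d₁⟩
  replace k₁ : Keeps 50 50 s s₁ := Keeps.trans (by simp) k₁ le_rfl le_rfl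
  simp only [mem_setReg] at m₁
  simp only [exec_ifRLt, exec_block_nil, exec_skip, exec_block_cons, exec_radd, d₁,
    k₁.rreg 31 (by norm_num)]
  by_cases h1 : dist (q p) (q y) < s.rreg 31
  · rw [if_pos h1]
    refine ⟨by omega, k₁.of_le (by norm_num) (by norm_num), m₁,
      by rw [k₁.reg 35 (by norm_num), hp], ?_⟩
    rw [k₁.reg 34 (by norm_num), k₁.reg 36 (by norm_num), k₁.rreg 33 (by norm_num),
      k₁.rreg 34 (by norm_num)]
    refine hInv.mono fun y' hD' hr => (hD y' hD').resolve_right ?_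
    rintro rfl
    exact absurd hr.2.1 (not_le.2 h1)
  rw [if_neg h1]
  set s₂ := (s₁.setReal 40 (dist (q p) (q y) + s₁.rreg 0)).setReal 41
    ((s₁.setReal 40 (dist (q p) (q y) + s₁.rreg 0)).rreg 50 +
      (s₁.setReal 40 (dist (q p) (q y) + s₁.rreg 0)).rreg 1) with hs₂
  have k₂ : Keeps 40 40 s s₂ := by simp [hs₂, k₁.of_le]
  have m₂ : s₂.mem = s.mem := m₁
  have r₂ : s₂.rreg 40 = dist (q p) (q y) := by
    simp [hs₂, k₁.rreg 0 (by norm_num), hs.rreg0]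
  have r₂' : s₂.rreg 41 = dist (q p) (q y) + L := by
    simp [hs₂, d₁, k₁.rreg 1 (by norm_num), hL]
  rw [r₂', k₂.rreg 32 (by norm_num), h32]
  by_cases h2 : 2 * s.rreg 31 < dist (q p) (q y) + L
  · rw [if_pos h2]
    refine ⟨by omega, k₂.of_le (by norm_num) (by norm_num), m₂,
      by rw [k₂.reg 35 (by norm_num), hp], ?_⟩
    rw [k₂.reg 34 (by norm_num), k₂.reg 36 (by norm_num), k₂.rreg 33 (by norm_num),
      k₂.rreg 34 (by norm_num)]
    refine hInv.mono fun y' hD' hr => (hD y' hD').resolve_right ?_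
    rintro rfl
    exact absurd hr.2.2 (not_le.2 h2)
  rw [if_neg h2]
  simp only [exec_add, k₂.reg 35 (by norm_num), k₂.reg 2 (by norm_num), hp, hs.reg2, add_zero]
  have hrad : IsShellRadius q L S p (s.rreg 31) y := ⟨hyS, not_lt.1 h1, not_lt.1 h2⟩
  have k₂' : Keeps 40 40 s (s₂.setReg 40 p) := by simp [k₂]
  refine (shellCount_spec (p := p) (L := L) (hs.keeps k₂' fun _ _ => by rw [← m₂]; rfl)
    (hl.keeps k₂' m₂) (by simp) (by simp [r₂, r₂'])).mono ?_
  rintro s₃ t₃ ⟨ht₃, k₃, m₃, c₃⟩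
  have r₃ : s₃.rreg 40 = dist (q p) (q y) := by rw [k₃.rreg 40 (by norm_num)]; simp [r₂]
  have r₃' : s₃.rreg 41 = dist (q p) (q y) + L := by rw [k₃.rreg 41 (by norm_num)]; simp [r₂']
  replace k₃ : Keeps 40 40 s s₃ := k₂'.trans k₃ (by norm_num) (by norm_num)
  replace m₃ : s₃.mem = s.mem := m₃.trans m₂
  rw [rreg_setReg, r₂] at c₃
  have upd : (s.reg 34 = 1 → (shell q S p L (dist (q p) (q y))).card < s.reg 36) → ∀ t,
      t ≤ distTime d + countTime n d + 20 →
      Exec recordShell s₃ fun s' t' => t + t' ≤ distTime d + countTime n d + 30 ∧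
        Keeps 34 33 s s' ∧ s'.mem = s.mem ∧ s'.reg 35 = p ∧
        ShellInv q L S p (s.rreg 31) D' (s'.reg 34) (s'.reg 36) (s'.rreg 33) (s'.rreg 34) := by
    intro hlt t ht
    have e1 := k₃.of_le (B := 34) (R := 33) (by norm_num) (by norm_num)
    have e2 := k₃.reg 2 (by norm_num)
    have e3 := k₃.rreg 0 (by norm_num)
    have e4 := k₃.reg 35 (by norm_num)
    have e5 := hInv.update hD hrad hlt
    simp [recordShell, e1, m₃, e2, e3, e4, hs.reg2, hs.rreg0, hp, c₃, r₃, r₃']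
    exact ⟨by omega, e5⟩
  simp only [exec_ifEq, exec_ifLt, exec_skip, c₃, k₃.reg 34 (by norm_num),
    k₃.reg 1 (by norm_num), k₃.reg 36 (by norm_num), hs.reg1]
  split_ifs with h3 h4
  · refine (upd (fun _ => h4) (t₁ + t₃) (by omega)).mono ?_
    rintro s' t ⟨ht, h⟩
    exact ⟨by omega, h⟩
  · refine ⟨by omega, k₃.of_le (by norm_num) (by norm_num), m₃,
      by rw [k₃.reg 35 (by norm_num), hp], ?_⟩
    rw [k₃.rreg 33 (by norm_num), k₃.rreg 34 (by norm_num)]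
    exact hInv.skip hD ⟨h3, not_lt.1 h4⟩
  · refine (upd (fun h => absurd h h3) (t₁ + t₃) (by omega)).mono ?_
    rintro s' t ⟨ht, h⟩
    exact ⟨by omega, h⟩

theorem findShell_spec {p : Fin n} (hs : Ctx G q s) (hl : HasLabels lab c s) (hL : s.rreg 1 = L)
    (hL0 : 0 ≤ L) (hp : s.reg 35 = p)
    (hcube : IsDenseCube q (univ.filter fun x => lab x = c) p (s.rreg 31))
    (hbig : 2 * L < s.rreg 31) :
    Exec findShell s fun s' t => t ≤ shellTime n d ∧ Keeps 30 32 s s' ∧ s'.mem = s.mem ∧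
      s'.reg 35 = p ∧
      GoodSplit q L (univ.filter fun x => lab x = c) p (s.rreg 31) (s'.rreg 33) (s'.rreg 34)
        True := by
  set S := univ.filter fun x => lab x = c with hS
  unfold findShell
  simp only [exec_block_cons, exec_block_nil, exec_const, exec_radd]
  set s₀ := (s.setReg 34 0).setReal 32 ((s.setReg 34 0).rreg 31 + (s.setReg 34 0).rreg 31)
    with hs₀
  have k0 : Keeps 30 32 s s₀ := by simp [hs₀]
  have e32 : s₀.rreg 32 = 2 * s.rreg 31 := by simp [hs₀]; ring
  refine (exec_forGroup (lab := lab) (c := c) (B := 30) (R := 33)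
    (T := distTime d + countTime n d + 50)
    (hs.keeps k0 fun _ _ => rfl) (hl.keeps k0 rfl) (by norm_num) (by norm_num) (by norm_num)
    (by norm_num)
    (fun k s' => s'.reg 35 = p ∧ ShellInv q L S p (s.rreg 31) (fun y => (y : ℕ) < k) (s'.reg 34)
      (s'.reg 36) (s'.rreg 33) (s'.rreg 34))
    ?_ ?_ ?_ ?_).mono ?_
  · exact ⟨by simp [hs₀, hp], Or.inl ⟨by simp [hs₀], fun y h => absurd h (Nat.not_lt_zero _)⟩⟩
  · rintro k s' i' x (rfl | rfl) h <;> simpa using h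
  · intro k s' hk h
    refine ⟨h.1, h.2.mono fun y hy hr => ?_⟩
    have : y ≠ k := fun h => hk (h ▸ (mem_filter.1 hr.1).2)
    have := Fin.val_ne_of_ne this
    omega
  · intro y s₁ k₁ m₁ hy hyc hInv
    have k₁' := k0.trans k₁ le_rfl (by norm_num)
    have e31 : s₁.rreg 31 = s.rreg 31 := k₁'.rreg 31 (by norm_num)
    refine (shellBody_spec (L := L) (D' := fun y' => (y' : ℕ) < y + 1)
      (hs.keeps k₁' fun _ _ => by rw [m₁]; rfl) (hl.keeps k₁' m₁)
      (by rw [k₁'.rreg 1 (by norm_num), hL]) hInv.1 hy hyc ?_ ?_ (by rw [e31]; exact hInv.2)).mono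
      ?_
    · rw [k₁.rreg 32 (by norm_num), e32, e31]
    · intro y' h'
      rcases Nat.lt_succ_iff_lt_or_eq.1 h' with h' | h'
      exacts [Or.inl h', Or.inr (Fin.ext h')]
    · rintro s₂ t₂ ⟨ht₂, k₂, m₂, hp₂, hInv₂⟩
      rw [e31] at hInv₂
      exact ⟨ht₂, k₁.trans k₂ (by norm_num) le_rfl, m₂.trans m₁,
        by rw [k₂.reg 30 (by norm_num), hy], hp₂, hInv₂⟩
  · rintro s₁ t₁ ⟨ht₁, k₁, m₁, hp₁, hInv⟩
    refine ⟨?_, k0.trans k₁ le_rfl (by norm_num), m₁, hp₁, Or.inr ⟨trivial, hbig, ?_⟩⟩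
    · unfold shellTime
      have : n * (distTime d + countTime n d + 50 + 8) ≤
          n * (distTime d + countTime n d + 60) := Nat.mul_le_mul_left _ (by omega)
      omega
    · rcases hInv with ⟨-, h2⟩ | ⟨-, y, h2, h3, h4, h5, h6⟩
      · obtain ⟨y, hy, hyR⟩ := hcube.radius
        exact absurd ⟨hy, hyR.ge, by rw [hyR]; linarith⟩ (h2 y y.2)
      · refine ⟨h4, y, h2.1, h3, h3 ▸ h2.2.1, h3 ▸ h2.2.2, fun y' hy' h7 h8 => ?_⟩
        rw [← h5]
        exact h6 y' y'.2 ⟨hy', h7, h8⟩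

end Shell

/-! ### Computing the layout -/

section LayoutProg

variable {n d : ℕ} {G : SimpleGraph (Fin n)} {q : Fin n → Fin d → ℝ} {s s' : State}
  {lab : Fin n → ℕ} {c : ℕ} {L : ℝ}

/-- The memory contains the list `l` of vertices from the address `a` on. -/
def HasList (a : ℕ) (l : List (Fin n)) (s : State) : Prop :=
  ∀ i (h : i < l.length), s.mem (a + i) = (l[i] : ℕ)

theorem HasList.append {a : ℕ} {l : List (Fin n)} (h : HasList a l s) {v : Fin n}
    (hmem : ∀ b, a ≤ b → b < a + l.length → s'.mem b = s.mem b)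
    (hv : s'.mem (a + l.length) = v) : HasList a (l ++ [v]) s' := by
  intro i hi
  rw [List.length_append, List.length_singleton] at hi
  rcases Nat.lt_succ_iff_lt_or_eq.1 hi with hi | rfl
  · rw [List.getElem_append_left hi, hmem _ (by omega) (by omega), h i hi]
  · simpa using hv

/-- Append the vertex `reg 30` to the layout and set its label to `0`. -/
def emit : Program :=
  block [.add 32 6 11, .store 32 30, .add 11 11 1, .add 32 5 30, .store 32 2]

/-- Give the vertex `reg 30` the label `reg 38`. -/
def relabel : Program := block [.add 32 5 30, .store 32 38]

/-- Divide the current group: the centre is in register `35`, the radii are in the real registers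
`33` and `34`, and register `37` tells whether there is an inner part. -/
def classify : Program := forTo 30 0 (block [.add 31 5 30, .load 31 31, ifEq 31 10 (block [
  .add 50 35 2, .add 51 30 2, distProg,
  .ifRLt 34 50 .skip (ifEq 30 35 emit (ifEq 37 1 (.ifRLt 33 50 emit relabel) emit))]) .skip])

/-- A bound for the running time of `classify`. -/
def classifyTime (n d : ℕ) : ℕ := n * (distTime d + 50) + 10

/-- The vertices below `k` have been classified: the state `s` differs from the state at the start
of `classify` in the labels and the layout. -/
structure ClassifyInv (lab lab' : Fin n → ℕ) (c : ℕ) (l xs : List (Fin n)) (s₀ : State) (k : ℕ)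
    (s : State) : Prop where
  nodup : xs.Nodup
  mem_iff : ∀ v, v ∈ xs ↔ (v : ℕ) < k ∧ lab v = c ∧ lab' v = 0
  label : ∀ v : Fin n, s.mem (n * n + v) = if (v : ℕ) < k then lab' v else lab v
  list : HasList (n * n + n) (l ++ xs) s
  length : s.reg 11 = (l ++ xs).length
  mem : ∀ a < n * n, s.mem a = s₀.mem a
  keeps : Keeps 11 35 s₀ s
  reg35 : s.reg 35 = s₀.reg 35
  reg37 : s.reg 37 = s₀.reg 37
  reg38 : s.reg 38 = s₀.reg 38
  reg30 : s.reg 30 = k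

theorem ClassifyInv.next_keep {lab' : Fin n → ℕ} {l xs : List (Fin n)} {s₀ : State} {k : Fin n}
    (h : ClassifyInv lab lab' c l xs s₀ k s) (hs' : Keeps 31 35 s s') (hm : s'.mem = s.mem)
    (h35 : s'.reg 35 = s.reg 35) (h37 : s'.reg 37 = s.reg 37) (h38 : s'.reg 38 = s.reg 38)
    (hk : lab' k = lab k) (hk' : lab k = c → lab' k ≠ 0) :
    ClassifyInv lab lab' c l xs s₀ (k + 1) (s'.setReg 30 (k + 1)) where
  nodup := h.nodup
  mem_iff v := by
    rw [h.mem_iff, Nat.lt_succ_iff_lt_or_eq]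
    refine ⟨fun ⟨h1, h2⟩ => ⟨Or.inl h1, h2⟩, fun ⟨h1, h2⟩ => ⟨h1.resolve_right fun h3 => ?_, h2⟩⟩
    obtain rfl := Fin.ext h3
    exact hk' h2.1 h2.2
  label v := by
    rw [mem_setReg, hm, h.label]
    simp only [Nat.lt_succ_iff_lt_or_eq]
    by_cases h1 : (v : ℕ) = k
    · obtain rfl := Fin.ext h1
      simp [hk]
    · simp [h1]
  list i hi := by rw [mem_setReg, hm, h.list i hi]
  length := by simp [hs'.reg 11, h.length]
  mem a ha := by rw [mem_setReg, hm, h.mem a ha]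
  keeps := by simpa using h.keeps.trans hs' (by norm_num) le_rfl
  reg35 := by simp [h35, h.reg35]
  reg37 := by simp [h37, h.reg37]
  reg38 := by simp [h38, h.reg38]
  reg30 := by simp

theorem ClassifyInv.next_label {lab' : Fin n → ℕ} {l xs : List (Fin n)} {s₀ : State} {k : Fin n}
    (h : ClassifyInv lab lab' c l xs s₀ k s) (hs' : Keeps 31 35 s s')
    (hm : ∀ a, s'.mem a = if a = n * n + k then lab' k else s.mem a)
    (h35 : s'.reg 35 = s.reg 35) (h37 : s'.reg 37 = s.reg 37) (h38 : s'.reg 38 = s.reg 38)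
    (hk' : lab' k ≠ 0) :
    ClassifyInv lab lab' c l xs s₀ (k + 1) (s'.setReg 30 (k + 1)) where
  nodup := h.nodup
  mem_iff v := by
    rw [h.mem_iff, Nat.lt_succ_iff_lt_or_eq]
    refine ⟨fun ⟨h1, h2⟩ => ⟨Or.inl h1, h2⟩, fun ⟨h1, h2⟩ => ⟨h1.resolve_right fun h3 => ?_, h2⟩⟩
    obtain rfl := Fin.ext h3
    exact hk' h2.2
  label v := by
    rw [mem_setReg, hm, h.label]
    simp only [Nat.lt_succ_iff_lt_or_eq]
    by_cases h1 : (v : ℕ) = k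
    · obtain rfl := Fin.ext h1
      simp
    · simp [h1]
  list i hi := by rw [mem_setReg, hm, if_neg (by omega), h.list i hi]
  length := by simp [hs'.reg 11, h.length]
  mem a ha := by rw [mem_setReg, hm, if_neg (by omega), h.mem a ha]
  keeps := by simpa using h.keeps.trans hs' (by norm_num) le_rfl
  reg35 := by simp [h35, h.reg35]
  reg37 := by simp [h37, h.reg37]
  reg38 := by simp [h38, h.reg38]
  reg30 := by simp

theorem ClassifyInv.next_emit {lab' : Fin n → ℕ} {l xs : List (Fin n)} {s₀ : State} {k : Fin n}
    (h : ClassifyInv lab lab' c l xs s₀ k s) (hs' : Keeps 11 35 s s')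
    (hm : ∀ a, s'.mem a = if a = n * n + k then 0 else
      if a = n * n + n + (l ++ xs).length then (k : ℕ) else s.mem a)
    (h11 : s'.reg 11 = s.reg 11 + 1)
    (h35 : s'.reg 35 = s.reg 35) (h37 : s'.reg 37 = s.reg 37) (h38 : s'.reg 38 = s.reg 38)
    (hk : lab k = c) (hk' : lab' k = 0) :
    ClassifyInv lab lab' c l (xs ++ [k]) s₀ (k + 1) (s'.setReg 30 (k + 1)) where
  nodup := by
    refine h.nodup.append (by simp) fun v hv hv' => ?_
    rw [List.mem_singleton.1 hv', h.mem_iff] at hv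
    exact absurd hv.1 (lt_irrefl _)
  mem_iff v := by
    rw [List.mem_append, List.mem_singleton, h.mem_iff, Nat.lt_succ_iff_lt_or_eq]
    constructor
    · rintro (⟨h1, h2⟩ | rfl)
      exacts [⟨Or.inl h1, h2⟩, ⟨Or.inr rfl, hk, hk'⟩]
    · rintro ⟨h1 | h1, h2⟩
      exacts [Or.inl ⟨h1, h2⟩, Or.inr (Fin.ext h1)]
  label v := by
    have := v.2
    rw [mem_setReg, hm, h.label]
    simp only [Nat.lt_succ_iff_lt_or_eq]
    by_cases h1 : (v : ℕ) = k
    · obtain rfl := Fin.ext h1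
      simp [hk']
    · rw [if_neg (by omega), if_neg (by omega)]
      simp [h1]
  list := by
    rw [← List.append_assoc]
    refine h.list.append (fun b h1 h2 => ?_) ?_
    · have := k.2
      rw [mem_setReg, hm, if_neg (by omega), if_neg (by omega)]
    · have := k.2
      rw [mem_setReg, hm, if_neg (by omega), if_pos rfl]
  length := by
    simp [h11, h.length]
    omega
  mem a ha := by rw [mem_setReg, hm, if_neg (by omega), if_neg (by omega), h.mem a ha]
  keeps := by simpa using h.keeps.trans hs' le_rfl le_rfl
  reg35 := by simp [h35, h.reg35]
  reg37 := by simp [h37, h.reg37]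
  reg38 := by simp [h38, h.reg38]
  reg30 := by simp

theorem classify_spec {p : Fin n} {l : List (Fin n)} {lo hi : ℝ} {big : Prop} (hs : Ctx G q s)
    (hl : HasLabels lab c s) (hc : 1 ≤ c) (hlist : HasList (n * n + n) l s)
    (h11 : s.reg 11 = l.length) (hp : s.reg 35 = p) (h37 : s.reg 37 = 1 ↔ big)
    (h38 : s.reg 38 = c + 1) (hlo : s.rreg 33 = lo) (hhi : s.rreg 34 = hi) :
    Exec classify s fun s' t => t ≤ classifyTime n d ∧ ∃ xs : List (Fin n),
      ClassifyInv lab (splitLabel q p lo hi big c lab) c l xs s n s' := by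
  set lab' := splitLabel q p lo hi big c lab with hlab'
  refine (exec_forTo (N := n) (T := distTime d + 40)
    (fun k s' => ∃ xs, ClassifyInv lab lab' c l xs s k s') ?_ ?_ ?_).mono ?_
  · refine ⟨[], by simp, by simp, fun v => by simp [hl.label], by
      rw [List.append_nil]; exact hlist, by simp [h11],
      fun _ _ => rfl, by simp, by simp, by simp, by simp, by simp⟩
  · rintro k s' ⟨xs, h⟩
    exact ⟨by rw [h.keeps.reg 0 (by norm_num), hs.reg0], h.reg30⟩
  · rintro k s' hk ⟨xs, h⟩
    obtain ⟨v, rfl⟩ : ∃ v : Fin n, k = v := ⟨⟨k, hk⟩, rfl⟩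
    have hs' : Ctx G q s' := hs.keeps (h.keeps.of_le (R := 1) le_rfl (by norm_num)) h.mem
    have e1 : s'.mem (n * n + v) = lab v := by rw [h.label, if_neg (lt_irrefl _)]
    have e10 : s'.reg 10 = c := by rw [h.keeps.reg 10 (by norm_num), hl.cur]
    simp only [exec_block_cons, exec_block_nil, exec_add, exec_load, exec_ifEq, reg_setReg,
      mem_setReg, if_true, h.reg30, hs'.reg5, e1]
    norm_num only
    simp only [if_false, e10]
    set s₁ := (s'.setReg 31 (n * n + v)).setReg 31 (lab v) with hs₁
    have k₁ : Keeps 31 35 s' s₁ := by simp [hs₁]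
    have m₁ : s₁.mem = s'.mem := rfl
    have q35 : s₁.reg 35 = s'.reg 35 := by simp [hs₁]
    have q37 : s₁.reg 37 = s'.reg 37 := by simp [hs₁]
    have q38 : s₁.reg 38 = s'.reg 38 := by simp [hs₁]
    have f1 : ∀ s'' : State, Keeps 11 35 s' s'' → s''.reg 1 = 1 := fun s'' h' => by
      rw [h'.reg 1 (by norm_num), hs'.reg1]
    by_cases hvc : lab v = c
    swap
    · rw [if_neg hvc]
      simp only [exec_skip]
      refine ⟨by omega, ?_, f1 _ (k₁.of_le (by norm_num) le_rfl), xs,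
        h.next_keep k₁ m₁ q35 q37 q38 ?_ fun h => absurd h hvc⟩
      · rw [k₁.reg 30 (by norm_num), h.reg30]
      · rw [hlab', splitLabel, if_neg hvc]
    rw [if_pos hvc]
    have e35 : s'.reg 35 = p := by rw [h.reg35, hp]
    simp only [e35, hs'.reg2, add_zero]
    refine (distProg_spec (u := p) (v := v) (hs'.keeps (B := 31) (R := 35)
      (s' := (s₁.setReg 50 p).setReg 51 v) (by simpa using k₁) (fun _ _ => rfl))
      (by simp) (by simp)).mono ?_
    rintro s₂ t₂ ⟨ht₂, k₂, m₂, d₂⟩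
    replace k₂ : Keeps 50 35 s₁ s₂ := Keeps.trans (by simp) k₂ le_rfl (by norm_num)
    replace q35 := (k₂.reg 35 (by norm_num)).trans q35
    replace q37 := (k₂.reg 37 (by norm_num)).trans q37
    replace q38 := (k₂.reg 38 (by norm_num)).trans q38
    replace k₂ : Keeps 31 35 s' s₂ := k₁.trans k₂ (by norm_num) (by norm_num)
    replace m₂ : s₂.mem = s'.mem := m₂.trans m₁
    have r34 : s₂.rreg 34 = hi := by
      rw [k₂.rreg 34 (by norm_num), h.keeps.rreg 34 (by norm_num), hhi]
    have r33 : s₂.rreg 33 = lo := by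
      rw [k₂.rreg 33 (by norm_num), h.keeps.rreg 33 (by norm_num), hlo]
    have r30 : s₂.reg 30 = v := by rw [k₂.reg 30 (by norm_num), h.reg30]
    have r35 : s₂.reg 35 = p := by rw [q35, h.reg35, hp]
    have r1 : s₂.reg 1 = 1 := f1 _ (k₂.of_le (by norm_num) le_rfl)
    have r37 : s₂.reg 37 = 1 ↔ big := by rw [q37, h.reg37, h37]
    have hsl : lab' v = if hi < dist (q p) (q v) then c
        else if v = p ∨ (big → lo < dist (q p) (q v)) then 0 else c + 1 := by
      rw [hlab', splitLabel, if_pos hvc]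
    -- The two ways to treat a vertex within the outer radius.
    have hemit : lab' v = 0 → ∀ t, t ≤ distTime d + 15 → Exec emit s₂ fun s'' t' =>
        t + t' ≤ distTime d + 30 ∧ s''.reg 30 = v ∧ s''.reg 1 = 1 ∧
          ∃ xs, ClassifyInv lab lab' c l xs s (v + 1) (s''.setReg 30 (v + 1)) := by
      intro h0 t ht
      have g11 : s₂.reg 11 = (l ++ xs).length := by rw [k₂.reg 11 (by norm_num), h.length]
      have g6 : s₂.reg 6 = n * n + n := by rw [k₂.reg 6 (by norm_num), hs'.reg6]
      have g5 : s₂.reg 5 = n * n := by rw [k₂.reg 5 (by norm_num), hs'.reg5]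
      have g2 : s₂.reg 2 = 0 := by rw [k₂.reg 2 (by norm_num), hs'.reg2]
      simp only [emit, exec_block_cons, exec_block_nil, exec_add, exec_store]
      refine ⟨by omega, by simp [r30], by simp [r1], xs ++ [v],
        h.next_emit ?_ (fun a => ?_) ?_ ?_ ?_ ?_ hvc h0⟩
      · simp [k₂.of_le]
      · simp [mem_setMem, g11, g6, g5, g2, r30, m₂]
      · simp [g11, r1, h.length]
      · simp [q35]
      · simp [q37]
      · simp [q38]
    have hmark : lab' v = c + 1 → ∀ t, t ≤ distTime d + 15 → Exec relabel s₂ fun s'' t' =>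
        t + t' ≤ distTime d + 30 ∧ s''.reg 30 = v ∧ s''.reg 1 = 1 ∧
          ∃ xs, ClassifyInv lab lab' c l xs s (v + 1) (s''.setReg 30 (v + 1)) := by
      intro h0 t ht
      have g5 : s₂.reg 5 = n * n := by rw [k₂.reg 5 (by norm_num), hs'.reg5]
      have g38 : s₂.reg 38 = c + 1 := by rw [q38, h.reg38, h38]
      simp only [relabel, exec_block_cons, exec_block_nil, exec_add, exec_store]
      refine ⟨by omega, by simp [r30], by simp [r1], xs,
        h.next_label ?_ (fun a => ?_) ?_ ?_ ?_ (by omega)⟩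
      · simp [k₂.of_le]
      · simp [mem_setMem, g5, g38, r30, m₂, h0]
      · simp [q35]
      · simp [q37]
      · simp [q38]
    simp only [exec_ifRLt, exec_ifEq, exec_skip, r34, r33, d₂, r30, r35, r1]
    by_cases c1 : hi < dist (q p) (q v)
    · rw [if_pos c1]
      rw [if_pos c1] at hsl
      exact ⟨by omega, trivial, trivial, xs,
        h.next_keep k₂ m₂ q35 q37 q38 (hsl.trans hvc.symm) (by omega)⟩
    rw [if_neg c1]
    rw [if_neg c1] at hsl
    by_cases c2 : v = p
    · rw [if_pos (by rw [c2])]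
      rw [if_pos (Or.inl c2)] at hsl
      refine (hemit hsl (t₂ + 7) (by omega)).mono ?_
      rintro s'' t ⟨ht, h⟩
      exact ⟨by omega, h⟩
    rw [if_neg (fun h => c2 (Fin.ext h))]
    by_cases c3 : big
    · rw [if_pos (r37.2 c3)]
      by_cases c4 : lo < dist (q p) (q v)
      · rw [if_pos c4]
        rw [if_pos (Or.inr fun _ => c4)] at hsl
        refine (hemit hsl (t₂ + 7) (by omega)).mono ?_
        rintro s'' t ⟨ht, h⟩
        exact ⟨by omega, h⟩
      · rw [if_neg c4]
        rw [if_neg (fun h => h.elim c2 fun h => c4 (h c3))] at hsl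
        refine (hmark hsl (t₂ + 7) (by omega)).mono ?_
        rintro s'' t ⟨ht, h⟩
        exact ⟨by omega, h⟩
    · rw [if_neg (fun h => c3 (r37.1 h))]
      rw [if_pos (Or.inr fun h => absurd h c3)] at hsl
      refine (hemit hsl (t₂ + 7) (by omega)).mono ?_
      rintro s'' t ⟨ht, h⟩
      exact ⟨by omega, h⟩
  · rintro s' t ⟨ht, h⟩
    refine ⟨?_, h⟩
    unfold classifyTime
    have : n * (distTime d + 40 + 2) ≤ n * (distTime d + 50) := Nat.mul_le_mul_left _ (by omega)
    omega

end LayoutProg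

section LayoutLoop

variable {n d : ℕ} {G : SimpleGraph (Fin n)} {q : Fin n → Fin d → ℝ} {s s' : State}
  {lab : Fin n → ℕ} {c : ℕ} {L m M : ℝ}

/-- Divide the current group, or pass to the previous one if it is empty. The group is divided by a
shell if the smallest dense cube has a radius greater than `2 * L`, and by the cube otherwise;
register `37` tells which. Register `10` contains the number of the current group and register `11`
the length of the layout. -/
def layoutStep : Program := block [
  groupCount,
  .ifLt 2 42 (block [
    .add 12 42 2, findCube, .radd 30 1 1,
    .ifRLt 30 31 (block [findShell, .const 37 1]) (block [.const 37 0, .radd 34 31 0]),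
    .add 38 10 1, classify, .add 10 10 1]) (.sub 10 10 1)]

/-- Compute the layout. -/
def layoutProg : Program := block [.const 10 1, .const 11 0, .whileLt 2 10 layoutStep]

/-- A bound for the running time of `layoutStep`. -/
def stepTime (n d : ℕ) : ℕ :=
  countTime n d + cubeTime n d + shellTime n d + classifyTime n d + 40

/-- A bound for the running time of `layoutProg`. -/
def layoutTime (n d : ℕ) : ℕ := (2 * n + 1) * (stepTime n d + 1) + 10

/-- The machine state represents the state of the computation of the layout. -/
structure LayoutState (G : SimpleGraph (Fin n)) (q : Fin n → Fin d → ℝ) (L m M : ℝ)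
    (l : List (Fin n)) (lab : Fin n → ℕ) (c : ℕ) (s : State) : Prop where
  ctx : Ctx G q s
  width : s.rreg 1 = L
  labels : HasLabels lab c s
  list : HasList (n * n + n) l s
  length : s.reg 11 = l.length
  inv : LayoutInv G M (cutExpo d (m ^ (1 / (d : ℝ)))) l lab c

theorem splitRadii_spec {p : Fin n} (hs : Ctx G q s) (hl : HasLabels lab c s)
    (hL : s.rreg 1 = L) (hL0 : 0 ≤ L) (hp : s.reg 35 = p)
    (hcube : IsDenseCube q (univ.filter fun x => lab x = c) p (s.rreg 31)) :
    Exec (block [.radd 30 1 1,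
      .ifRLt 30 31 (block [findShell, .const 37 1]) (block [.const 37 0, .radd 34 31 0])]) s
      fun s' t => t ≤ shellTime n d + 10 ∧ Keeps 30 30 s s' ∧ s'.mem = s.mem ∧ s'.reg 35 = p ∧
        GoodSplit q L (univ.filter fun x => lab x = c) p (s.rreg 31) (s'.rreg 33) (s'.rreg 34)
          (s'.reg 37 = 1) := by
  simp only [exec_block_cons, exec_block_nil, exec_radd, exec_ifRLt]
  set s₁ := s.setReal 30 (s.rreg 1 + s.rreg 1) with hs₁
  have k₁ : Keeps 60 30 s s₁ := by simp [hs₁]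
  have e31 : s₁.rreg 31 = s.rreg 31 := by simp [hs₁]
  have e30 : s₁.rreg 30 = 2 * L := by simp [hs₁, hL]; ring
  rw [e30, e31]
  by_cases hbig : 2 * L < s.rreg 31
  · rw [if_pos hbig]
    refine (findShell_spec (L := L) (p := p) (hs.keeps k₁ fun _ _ => rfl) (hl.keeps k₁ rfl)
      (by rw [k₁.rreg 1 (by norm_num), hL]) hL0 (by rw [k₁.reg 35 (by norm_num), hp])
      (by rw [e31]; exact hcube) (by rw [e31]; exact hbig)).mono ?_
    rintro s₂ t₂ ⟨ht₂, k₂, m₂, hp₂, hgood⟩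
    simp only [exec_const]
    refine ⟨by omega, ?_, m₂, by simp [hp₂], ?_⟩
    · exact (k₁.of_le (by norm_num) le_rfl).trans
        (B' := 30) (R' := 30) (by simpa using k₂.of_le (R := 30) le_rfl (by norm_num)) le_rfl le_rfl
    · rw [e31] at hgood
      simpa using hgood
  · rw [if_neg hbig]
    simp only [exec_const]
    have hgood : GoodSplit q L (univ.filter fun x => lab x = c) p (s.rreg 31) (s.rreg 33)
        (s.rreg 31) (0 = 1) := Or.inl ⟨by norm_num, not_lt.1 hbig, rfl⟩
    refine ⟨by omega, by simp [k₁.of_le], rfl, by simp [hs₁, hp], ?_⟩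
    simpa [hs₁, hs.rreg0] using hgood

theorem layoutStep_spec (hd : 2 ≤ d) (hL0 : 0 ≤ L) (hm : 1 ≤ m)
    (hadj : ∀ u v, G.Adj u v → dist (q u) (q v) ≤ L) (hG : LocallyCovered G q L m)
    {l : List (Fin n)} (h : LayoutState G q L m M l lab c s) (hc : 1 ≤ c) :
    Exec layoutStep s fun s' t => t ≤ stepTime n d ∧ ∃ l' lab' c',
      LayoutState G q L m M l' lab' c' s' ∧
        2 * (n - l'.length) + c' < 2 * (n - l.length) + c := by
  unfold layoutStep
  simp only [exec_block_cons, exec_block_nil, exec_ifLt]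
  refine (groupCount_spec h.ctx h.labels).mono ?_
  rintro s₁ t₁ ⟨ht₁, k₁, m₁, c₁⟩
  have h1 : Ctx G q s₁ := h.ctx.keeps k₁ fun _ _ => by rw [m₁]
  have l1 : HasLabels lab c s₁ := h.labels.keeps k₁ m₁
  rw [h1.reg2, c₁]
  by_cases hpos : 0 < (univ.filter fun x => lab x = c).card
  swap
  · rw [if_neg hpos]
    simp only [exec_sub, l1.cur, h1.reg1]
    have hnone : ∀ v, lab v ≠ c := fun v hv => hpos (card_pos.2 ⟨v, by simp [hv]⟩)
    refine ⟨by unfold stepTime; omega, l, lab, c - 1, ⟨?_, ?_, ⟨by simp, ?_⟩, ?_, ?_,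
      h.inv.pop hnone⟩, by omega⟩
    · exact h1.keeps (B := 10) (R := 42) (by simp) (fun _ _ => rfl)
    · simp [k₁.rreg 1, h.width]
    · exact fun v => l1.label v
    · exact fun i hi => by rw [mem_setReg, m₁, h.list i hi]
    · simp [k₁.reg 11, h.length]
  rw [if_pos hpos]
  simp only [exec_add]
  set s₂ := s₁.setReg 12 (s₁.reg 42 + s₁.reg 2) with hs₂
  have k₂ : Keeps 12 42 s s₂ := by simp [hs₂, k₁.of_le]
  have m₂ : s₂.mem = s.mem := m₁
  obtain ⟨v, hv⟩ := card_pos.1 hpos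
  refine (findCube_spec (h.ctx.keeps k₂ fun _ _ => by rw [m₂]) (h.labels.keeps k₂ m₂)
    (by simp [hs₂, c₁, h1.reg2]) ⟨v, (mem_filter.1 hv).2⟩).mono ?_
  rintro s₃ t₃ ⟨ht₃, k₃, m₃, p, hp, hcube⟩
  replace k₃ : Keeps 12 30 s s₃ := (k₂.of_le le_rfl (by norm_num)).trans k₃ (by norm_num) le_rfl
  replace m₃ : s₃.mem = s.mem := m₃.trans m₂
  have h3 : Ctx G q s₃ := h.ctx.keeps k₃ fun _ _ => by rw [m₃]
  have hrad := splitRadii_spec (L := L) h3 (h.labels.keeps k₃ m₃)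
    (by rw [k₃.rreg 1 (by norm_num), h.width]) hL0 hp hcube
  simp only [exec_block_cons, exec_block_nil, exec_radd] at hrad
  rw [exec_radd]
  refine hrad.mono ?_
  rintro s₄ t₄ ⟨ht₄, k₄, m₄, hp₄, hgood⟩
  replace k₄ : Keeps 12 30 s s₄ := k₃.trans k₄ (by norm_num) le_rfl
  replace m₄ : s₄.mem = s.mem := m₄.trans m₃
  set s₅ := s₄.setReg 38 (s₄.reg 10 + s₄.reg 1) with hs₅
  have k₅ : Keeps 12 30 s s₅ := by simp [hs₅, k₄]
  have m₅ : s₅.mem = s.mem := m₄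
  refine (classify_spec (p := p) (l := l) (big := s₄.reg 37 = 1)
    (h.ctx.keeps k₅ fun _ _ => by rw [m₅]) (h.labels.keeps k₅ m₅) hc
    (fun i hi => by rw [m₅, h.list i hi]) (by rw [k₅.reg 11 (by norm_num), h.length])
    (by simp [hs₅, hp₄]) (by simp [hs₅])
    (by simp [hs₅, k₄.reg 10, k₄.reg 1, h.labels.cur, h.ctx.reg1])
    (rfl : _ = s₄.rreg 33) (rfl : _ = s₄.rreg 34)).mono ?_
  rintro s₆ t₆ ⟨ht₆, xs, h6⟩
  have k₆ : Keeps 11 30 s s₆ := (k₅.of_le (by norm_num) le_rfl).trans h6.keeps le_rfl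
    (by norm_num)
  have hctx : Ctx G q s₆ := h.ctx.keeps k₆ fun a ha => by rw [h6.mem a ha, m₅]
  have hmem : ∀ v, v ∈ xs ↔ lab v = c ∧
      splitLabel q p (s₄.rreg 33) (s₄.rreg 34) (s₄.reg 37 = 1) c lab v = 0 := fun v => by
    rw [h6.mem_iff]
    exact and_iff_right v.2
  have hinv := h.inv.geometric_split hd hL0 hm hadj hG hc hcube hgood h6.nodup hmem
  have hpxs : p ∈ xs := by
    have hpc : lab p = c := (mem_filter.1 hcube.center_mem).2
    refine (hmem p).2 ⟨hpc, ?_⟩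
    unfold splitLabel
    rw [if_pos hpc, dist_self, if_neg, if_pos (Or.inl rfl)]
    rw [not_lt]
    have := hcube.radius_nonneg
    rcases hgood with ⟨-, -, h7⟩ | ⟨-, -, h7, y, -, -, h8, -⟩ <;> linarith
  refine ⟨?_, l ++ xs, _, c + 1, ⟨?_, ?_, ⟨?_, ?_⟩, ?_, ?_, hinv⟩, ?_⟩
  · unfold stepTime
    omega
  · exact hctx.keeps (B := 10) (R := 30) (by simp) (fun _ _ => rfl)
  · simp [k₆.rreg 1, h.width]
  · simp [k₆.reg 10, h.labels.cur, hctx.reg1]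
  · intro v
    rw [mem_setReg, h6.label, if_pos v.2]
  · exact fun i hi => by rw [mem_setReg, h6.list i hi]
  · simp [h6.length]
  · have h1 := List.length_pos_of_mem hpxs
    have h2 := hinv.nodup.length_le_card
    rw [Fintype.card_fin, List.length_append] at h2
    rw [List.length_append]
    omega

/-- What the first phase computes: a layout all of whose cuts are small. The labels are `0`
afterwards. -/
structure IsLayout (G : SimpleGraph (Fin n)) (M : ℝ) (l : List (Fin n)) (s : State) : Prop where
  nodup : l.Nodup
  mem : ∀ v, v ∈ l
  cut : ∀ k, HasCut G M (l.take k).toFinset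
  list : HasList (n * n + n) l s
  label : ∀ v : Fin n, s.mem (n * n + v) = 0

theorem layoutProg_spec (hd : 2 ≤ d) (hL0 : 0 ≤ L) (hm : 1 ≤ m)
    (hadj : ∀ u v, G.Adj u v → dist (q u) (q v) ≤ L) (hG : LocallyCovered G q L m)
    (hs : Ctx G q s) (hL : s.rreg 1 = L) (hlab : ∀ v : Fin n, s.mem (n * n + v) = 1) :
    Exec layoutProg s fun s' t => t ≤ layoutTime n d ∧ Ctx G q s' ∧
      ∃ l, IsLayout G (Real.exp (cutExpo d (m ^ (1 / (d : ℝ))) n)) l s' := by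
  unfold layoutProg
  simp only [exec_block_cons, exec_block_nil, exec_const]
  have hm0 : (0 : ℝ) ≤ m ^ (1 / (d : ℝ)) := by positivity
  have hinit := LayoutInv.init (G := G) (cutExpo d (m ^ (1 / (d : ℝ))))
    (cutExpo_nonneg hd hm0)
  rw [Fintype.card_fin] at hinit
  set M := Real.exp (cutExpo d (m ^ (1 / (d : ℝ))) n)
  set s₀ := (s.setReg 10 1).setReg 11 0 with hs₀
  have h0 : LayoutState G q L m M [] (fun _ => 1) 1 s₀ := by
    refine ⟨hs.keeps (B := 10) (R := 10) (by simp [hs₀]) (fun _ _ => rfl), by simp [hs₀, hL],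
      ⟨by simp [hs₀], hlab⟩, fun i hi => absurd hi (Nat.not_lt_zero _), by simp [hs₀], hinit⟩
  -- Dividing a group opens one more group, but moves at least the centre into the layout; hence the
  -- weight `2`.
  refine (exec_while (T := stepTime n d)
    (fun s => ∃ l lab c, LayoutState G q L m M l lab c s)
    (fun s => 2 * (n - s.reg 11) + s.reg 10) ?_ s₀ ⟨_, _, _, h0⟩).mono ?_
  · rintro s' ⟨l, lab, c, h⟩ hlt
    rw [h.ctx.reg2, h.labels.cur] at hlt
    refine (layoutStep_spec hd hL0 hm hadj hG h hlt).mono ?_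
    rintro s'' t ⟨ht, l', lab', c', h', hμ⟩
    refine ⟨ht, ⟨l', lab', c', h'⟩, ?_⟩
    rwa [h'.length, h'.labels.cur, h.length, h.labels.cur]
  · rintro s' t ⟨ht, ⟨l, lab, c, h⟩, hlt⟩
    rw [h.ctx.reg2, h.labels.cur] at hlt
    obtain rfl : c = 0 := by omega
    have hz : ∀ v, lab v = 0 := fun v => Nat.le_zero.1 (h.inv.lab_le v)
    refine ⟨?_, h.ctx, l, h.inv.nodup, fun v => (h.inv.mem_iff v).2 (hz v), h.inv.cut, h.list,
      fun v => by rw [h.labels.label, hz]⟩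
    simp [hs₀] at ht
    unfold layoutTime
    omega

end LayoutLoop

/-! ### Tables in memory -/

section TableMemory

variable {n d : ℕ} {G : SimpleGraph (Fin n)} {q : Fin n → Fin d → ℝ} {s s' : State}
  {P I J : Finset (Fin n)} {l : List (Finset (Fin n))} {a b : ℕ}

theorem mul_add_le_mul {r k : ℕ} (h : r < k) (w : ℕ) : r * w + w ≤ k * w := by
  simpa [add_mul] using Nat.mul_le_mul_right w h

/-- The row of `n + 1` memory cells from the address `a` on represents the subset `I` of `P`. For
vertices in `P` the entries tell whether they belong to `I`, and for the other vertices whether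
they have a neighbour in `I`; the last entry is the size of `I`. -/
structure HasSet (G : SimpleGraph (Fin n)) (P I : Finset (Fin n)) (a : ℕ) (s : State) : Prop where
  entry : ∀ w : Fin n, s.mem (a + w) = if w ∈ I ∪ key G P I then 1 else 0
  size : s.mem (a + n) = I.card

theorem HasSet.congr (h : HasSet G P I a s) (hm : ∀ j < n + 1, s'.mem (b + j) = s.mem (a + j)) :
    HasSet G P I b s' :=
  ⟨fun w => by rw [hm w (by omega), h.entry], by rw [hm n (by omega), h.size]⟩

/-- The rows from the address `a` on represent the members of the list `l`. -/
def HasTable (G : SimpleGraph (Fin n)) (P : Finset (Fin n)) (l : List (Finset (Fin n))) (a : ℕ)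
    (s : State) : Prop :=
  ∀ r (h : r < l.length), HasSet G P l[r] (a + r * (n + 1)) s

theorem HasTable.congr (h : HasTable G P l a s)
    (hm : ∀ b, a ≤ b → b < a + l.length * (n + 1) → s'.mem b = s.mem b) : HasTable G P l a s' := by
  intro r hr
  have := mul_add_le_mul hr (n + 1)
  exact (h r hr).congr fun j hj => hm _ (by omega) (by omega)

theorem HasTable.append (h : HasTable G P l a s) (hI : HasSet G P I (a + l.length * (n + 1)) s) :
    HasTable G P (l ++ [I]) a s := by
  intro r hr
  rw [List.length_append, List.length_singleton] at hr
  rcases Nat.lt_succ_iff_lt_or_eq.1 hr with hr | rfl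
  · rw [List.getElem_append_left hr]
    exact h r hr
  · simpa using hI

theorem HasTable.set (h : HasTable G P l a s) {r : ℕ} (hI : HasSet G P I (a + r * (n + 1)) s')
    (hm : ∀ b, b < a + r * (n + 1) ∨ a + r * (n + 1) + (n + 1) ≤ b →
      b < a + l.length * (n + 1) → s'.mem b = s.mem b) :
    HasTable G P (l.set r I) a s' := by
  intro k hk
  rw [List.length_set] at hk
  by_cases hrk : r = k
  · subst hrk
    simpa using hI
  · rw [List.getElem_set_ne hrk]
    have := mul_add_le_mul hk (n + 1)
    refine (h k hk).congr fun j hj => hm _ ?_ (by omega)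
    rcases Nat.lt_or_gt_of_ne hrk with h' | h'
    · have := mul_add_le_mul h' (n + 1)
      omega
    · have := mul_add_le_mul h' (n + 1)
      omega

/-- The labels mark the vertices of `P`. -/
def HasMarks (P : Finset (Fin n)) (s : State) : Prop :=
  ∀ w : Fin n, s.mem (n * n + w) = if w ∈ P then 1 else 0

/-- Copy the row at the address `reg 28` to the address `reg 29`. -/
def copyRow : Program :=
  forTo 30 8 (block [.add 31 28 30, .load 32 31, .add 31 29 30, .store 31 32])

/-- A bound for the running time of the programs that go through a row once. -/
def rowTime (n : ℕ) : ℕ := n * 20 + 40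

theorem copyRow_spec (hs : Ctx G q s) (ha : s.reg 28 = a) (hb : s.reg 29 = b)
    (hab : a + (n + 1) ≤ b ∨ b + (n + 1) ≤ a) :
    Exec copyRow s fun s' t => t ≤ rowTime n ∧ Keeps 30 60 s s' ∧
      (∀ j < n + 1, s'.mem (b + j) = s.mem (a + j)) ∧
      ∀ c, c < b ∨ b + (n + 1) ≤ c → s'.mem c = s.mem c := by
  unfold copyRow
  refine (exec_forTo (N := n + 1) (T := 8) (fun k s' => Keeps 30 60 s s' ∧ s'.reg 30 = k ∧
    (∀ j < k, s'.mem (b + j) = s.mem (a + j)) ∧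
    ∀ c, c < b ∨ b + k ≤ c → s'.mem c = s.mem c) (by simp) ?_ ?_).mono ?_
  · rintro k s' ⟨h1, h2, -⟩
    exact ⟨by rw [h1.reg 8 (by norm_num), hs.reg8], h2⟩
  · rintro k s' hk ⟨h1, h2, h3, h4⟩
    have e1 := (h1.reg 1 (by norm_num)).trans hs.reg1
    have e2 := (h1.reg 28 (by norm_num)).trans ha
    have e3 := (h1.reg 29 (by norm_num)).trans hb
    have e4 : s'.mem (a + k) = s.mem (a + k) := h4 _ (by omega)
    simp only [exec_block_cons, exec_block_nil, exec_add, exec_load, exec_store]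
    refine ⟨by omega, by simp [h2], by simp [e1], by simp [h1], by simp, fun j hj => ?_,
      fun c hc => ?_⟩
    · simp [mem_setMem, h2, e2, e3, e4]
      split_ifs with hjk
      · rw [hjk]
      · exact h3 j (by omega)
    · simp [mem_setMem, h2, e2, e3, e4]
      rw [if_neg (by omega)]
      exact h4 c (by omega)
  · rintro s' t ⟨ht, h1, -, h3, h4⟩
    exact ⟨by unfold rowTime; omega, h1, h3, h4⟩

/-- Decide whether the rows at the addresses `reg 25` and `reg 15` have the same key. -/
def compareRows : Program := block [.const 27 1, forTo 30 0 (block [.add 31 5 30, .load 31 31,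
  ifEq 31 2 (block [.add 31 25 30, .load 31 31, .add 32 15 30, .load 32 32,
    ifEq 31 32 .skip (.const 27 0)]) .skip])]

theorem compareRows_spec (hs : Ctx G q s) (hP : HasMarks P s) (hIP : I ⊆ P) (hJP : J ⊆ P)
    (hI : HasSet G P I (s.reg 25) s) (hJ : HasSet G P J (s.reg 15) s) :
    Exec compareRows s fun s' t => t ≤ rowTime n ∧ Keeps 27 60 s s' ∧ s'.mem = s.mem ∧
      (s'.reg 27 = 1 ↔ key G P I = key G P J) := by
  obtain ⟨Same, hS0, hS, hSn⟩ : ∃ S : ℕ → Prop, S 0 ∧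
      (∀ v : Fin n, S (v + 1) ↔ S v ∧ (v ∈ key G P I ↔ v ∈ key G P J)) ∧
      (S n → key G P I = key G P J) ∧ (key G P I = key G P J → S n) := by
    refine ⟨fun k => ∀ w : Fin n, (w : ℕ) < k → (w ∈ key G P I ↔ w ∈ key G P J), by simp,
      fun v => ?_, fun h => ?_, fun h w _ => by rw [h]⟩
    · refine ⟨fun h => ⟨fun w hw => h w (by omega), h v (by omega)⟩, fun h w hw => ?_⟩
      rcases Nat.lt_succ_iff_lt_or_eq.1 hw with hw | hw
      exacts [h.1 w hw, Fin.ext hw ▸ h.2]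
    · ext w
      exact h w w.2
  unfold compareRows
  simp only [exec_block_cons, exec_block_nil, exec_const]
  refine (exec_forTo (N := n) (T := 16) (fun k s' => Keeps 27 60 s s' ∧ s'.mem = s.mem ∧
    s'.reg 30 = k ∧ (s'.reg 27 = 1 ↔ Same k)) (by simp [hS0]) ?_ ?_).mono ?_
  · rintro k s' ⟨h1, -, h2, -⟩
    exact ⟨by rw [h1.reg 0 (by norm_num), hs.reg0], h2⟩
  · rintro k s' hk ⟨h1, h2, h3, h4⟩
    obtain ⟨v, rfl⟩ : ∃ v : Fin n, k = v := ⟨⟨k, hk⟩, rfl⟩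
    have e1 := (h1.reg 1 (by norm_num)).trans hs.reg1
    have e2 := (h1.reg 2 (by norm_num)).trans hs.reg2
    have e5 := (h1.reg 5 (by norm_num)).trans hs.reg5
    have e25 := h1.reg 25 (by norm_num)
    have e15 := h1.reg 15 (by norm_num)
    simp only [exec_block_cons, exec_block_nil, exec_add, exec_load, exec_ifEq, reg_setReg,
      mem_setReg, if_true, h2, h3, e5, e2, hP v, exec_skip, hS]
    norm_num only
    simp only [if_false]
    by_cases hv : v ∈ P
    · have hv1 : v ∉ key G P I := fun h => (mem_key.1 h).1 hv
      have hv2 : v ∉ key G P J := fun h => (mem_key.1 h).1 hv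
      simp only [hv, if_true]
      norm_num only
      simp only [if_false]
      simp [h1, h4, e1, hv1, hv2]
    · have hv1 : v ∉ I := fun h => hv (hIP h)
      have hv2 : v ∉ J := fun h => hv (hJP h)
      have f1 := hI.entry v
      have f2 := hJ.entry v
      simp only [mem_union, hv1, hv2, false_or] at f1 f2
      by_cases h5 : v ∈ key G P I <;> by_cases h6 : v ∈ key G P J <;>
        simp [hv, h1, h2, h3, h4, e1, e25, e15, f1, f2, h5, h6]
  · rintro s' t ⟨ht, h1, h2, -, h4⟩
    exact ⟨by unfold rowTime; omega, h1, h2, h4.trans ⟨hSn.1, hSn.2⟩⟩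

/-- Add the row at the address `reg 15`, the end of the table at the address `reg 11`, to this
table. If there already is a row with the same key, then the one with the larger set is kept. -/
def insertRow : Program := block [
  .add 26 15 2, .add 25 11 2,
  .whileLt 25 15 (block [compareRows, ifEq 27 1 (.add 26 25 2) .skip, .add 25 25 8]),
  .ifLt 26 15 (block [.add 31 26 0, .load 31 31, .add 32 15 0, .load 32 32,
    .ifLt 31 32 (block [.add 28 15 2, .add 29 26 2, copyRow]) .skip]) (.add 15 15 8)]

/-- A bound for the running time of `insertRow` for a table with at most `m` rows. -/
def insertTime (n m : ℕ) : ℕ := (m + 1) * ((n + 1) * (rowTime n + 30))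

/-- The change of the state when the set `J` is added to the table `l` at the address `a`. -/
structure AddsSet (G : SimpleGraph (Fin n)) (P : Finset (Fin n)) (l : List (Finset (Fin n)))
    (J : Finset (Fin n)) (a : ℕ) (s s' : State) : Prop where
  keeps : Keeps 15 60 s s'
  reg16 : s'.reg 16 = s.reg 16
  mem : ∀ c < a, s'.mem c = s.mem c
  table : ∃ l', s'.reg 15 = a + l'.length * (n + 1) ∧ HasTable G P l' a s' ∧ IsTable G P l' ∧
    Covers G P l' J ∧ ∀ J', Covers G P l J' → Covers G P l' J'

theorem insertRow_spec {m : ℕ} (hs : Ctx G q s) (hP : HasMarks P s) (h11 : s.reg 11 = a)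
    (h15 : s.reg 15 = a + l.length * (n + 1)) (hl : HasTable G P l a s)
    (hlt' : IsTable G P l) (hlm : l.length ≤ m) (hIP : I ⊆ P) (hI : G.IsIndepSet (I : Set (Fin n)))
    (hIs : HasSet G P I (s.reg 15) s) :
    Exec insertRow s fun s' t => t ≤ insertTime n m ∧ AddsSet G P l I a s s' := by
  unfold insertRow
  simp only [exec_block_cons, exec_block_nil, exec_add]
  -- Before the candidate is stored, register `26` holds the address of a row with the same key, or
  -- the end of the table if there is none among the rows seen so far.
  refine (exec_while (T := rowTime n + 10) (fun s' => Keeps 25 60 s s' ∧ s'.mem = s.mem ∧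
    (∃ k ≤ l.length, s'.reg 25 = a + k * (n + 1) ∧
      (s'.reg 26 = s.reg 15 → ∀ r (hr : r < l.length), r < k → key G P l[r] ≠ key G P I)) ∧
    (s'.reg 26 = s.reg 15 ∨ ∃ r, ∃ hr : r < l.length, s'.reg 26 = a + r * (n + 1) ∧
      key G P l[r] = key G P I))
    (fun s' => a + l.length * (n + 1) - s'.reg 25) ?_ _ ?_).mono ?_
  · rintro s₁ ⟨k₁, m₁, ⟨k, hk, e25, hnot⟩, hfound⟩ hlt
    have e15 := k₁.reg 15 (by norm_num)
    rw [e15, h15, e25] at hlt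
    have hkl : k < l.length := by
      by_contra hcon
      have := Nat.mul_le_mul_right (n + 1) (not_lt.1 hcon)
      omega
    have hnext := mul_add_le_mul hkl (n + 1)
    simp only [exec_block_cons, exec_block_nil]
    refine (compareRows_spec (hs.keeps k₁ fun _ _ => by rw [m₁]) (fun w => by rw [m₁, hP])
      (hlt'.subset _ (List.getElem_mem hkl)) hIP
      ((e25 ▸ hl k hkl).congr fun j _ => by rw [m₁])
      ((e15.symm ▸ hIs).congr fun j _ => by rw [m₁])).mono ?_
    rintro s₂ t₂ ⟨ht₂, k₂, m₂, heq⟩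
    have g1 : s₂.reg 25 = a + k * (n + 1) := by rw [k₂.reg 25 (by norm_num), e25]
    have g2 : s₂.reg 26 = s₁.reg 26 := k₂.reg 26 (by norm_num)
    have g3 : s₂.reg 8 = n + 1 := by rw [k₂.reg 8 (by norm_num), k₁.reg 8 (by norm_num), hs.reg8]
    have g4 : s₂.reg 2 = 0 := by rw [k₂.reg 2 (by norm_num), k₁.reg 2 (by norm_num), hs.reg2]
    have g5 : s₂.reg 1 = 1 := by rw [k₂.reg 1 (by norm_num), k₁.reg 1 (by norm_num), hs.reg1]
    replace k₂ : Keeps 25 60 s s₂ := k₁.trans k₂ (by norm_num) le_rfl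
    replace m₂ := m₂.trans m₁
    have hk1 : (k + 1) * (n + 1) = k * (n + 1) + (n + 1) := by ring
    simp only [exec_ifEq, g5, exec_skip, exec_add]
    by_cases hsame : key G P l[k] = key G P I
    · rw [if_pos (heq.2 hsame)]
      refine ⟨by omega, ⟨by simp [k₂], m₂, ⟨k + 1, hkl, ?_, ?_⟩, Or.inr ⟨k, hkl, ?_, hsame⟩⟩, ?_⟩
      · simp [g1, g3, g4, hk1, add_assoc]
      · simp [g1, g4, h15]
        intro h
        omega
      · simp [g1, g4]
      · simp [g1, g3, g4, e25]
        omega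
    · rw [if_neg fun h => hsame (heq.1 h)]
      refine ⟨by omega, ⟨by simp [k₂], m₂, ⟨k + 1, hkl, ?_, ?_⟩, ?_⟩, ?_⟩
      · simp [g1, g3, hk1, add_assoc]
      · intro h r hr hrk
        rcases Nat.lt_succ_iff_lt_or_eq.1 hrk with hrk | rfl
        · exact hnot (by simpa [g2] using h) r hr hrk
        · exact hsame
      · simpa [g2] using hfound
      · simp [g1, g3, e25]
        omega
  · refine ⟨by simp, rfl, ⟨0, Nat.zero_le _, by simp [h11, hs.reg2], fun _ r _ hr => by omega⟩,
      Or.inl (by simp [hs.reg2])⟩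
  · rintro s₁ t₁ ⟨ht₁, ⟨k₁, m₁, ⟨k, hk, e25, hnot⟩, hfound⟩, hlt⟩
    have e15 := k₁.reg 15 (by norm_num)
    have e16 := k₁.reg 16 (by norm_num)
    have e0 := (k₁.reg 0 (by norm_num)).trans hs.reg0
    have e2 := (k₁.reg 2 (by norm_num)).trans hs.reg2
    have e8 := (k₁.reg 8 (by norm_num)).trans hs.reg8
    have hkl : k = l.length := by
      by_contra hcon
      have := mul_add_le_mul (lt_of_le_of_ne hk hcon) (n + 1)
      rw [e15, h15, e25] at hlt
      omega
    subst hkl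
    have ht : t₁ + rowTime n + 20 ≤ insertTime n m := by
      simp only [reg_setReg, if_true, h11, hs.reg2] at ht₁
      norm_num only at ht₁
      simp only [if_false, add_zero, Nat.add_sub_cancel_left] at ht₁
      have h1 : l.length * (n + 1) * (rowTime n + 10 + 1) ≤ m * (n + 1) * (rowTime n + 30) :=
        Nat.mul_le_mul (Nat.mul_le_mul_right _ hlm) (by omega)
      have h2 : rowTime n + 30 ≤ (n + 1) * (rowTime n + 30) := by
        rw [add_mul]
        omega
      unfold insertTime
      rw [add_mul, ← mul_assoc]
      omega
    simp only [exec_ifLt, exec_block_cons, exec_block_nil, exec_add, exec_load, exec_skip]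
    by_cases hnew : s₁.reg 26 = s.reg 15
    · rw [if_neg (by rw [hnew, e15]; exact lt_irrefl _)]
      refine ⟨by omega, by simp [k₁.of_le], by simp [e16], fun c _ => by rw [mem_setReg, m₁],
        l ++ [I], ?_, ?_, ?_, ⟨I, by simp, rfl, le_rfl⟩, fun J hJ => hJ.append _⟩
      · simp [e15, h15, e8]
        ring
      · refine (hl.append (h15 ▸ hIs)).congr fun b _ _ => by rw [mem_setReg, m₁]
      · exact hlt'.append hIP hI fun J hJ => by
          obtain ⟨r, hr, rfl⟩ := List.getElem_of_mem hJ
          exact hnot hnew r hr hr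
    obtain ⟨r, hr, e26, hrkey⟩ := hfound.resolve_left hnew
    have hrow := mul_add_le_mul hr (n + 1)
    rw [if_pos (by rw [e26, e15, h15]; omega)]
    have f1 : s₁.mem (a + r * (n + 1) + n) = l[r].card := by rw [m₁, (hl r hr).size]
    have f2 : s₁.mem (a + l.length * (n + 1) + n) = I.card := by rw [m₁, ← h15, hIs.size]
    simp only [reg_setReg, mem_setReg, if_true, e26, e0, e15, h15, f1]
    norm_num only
    simp only [if_false, e2, f2]
    by_cases hcard : l[r].card < I.card
    swap
    · rw [if_neg hcard]
      refine ⟨by omega, by simp [k₁.of_le], by simp [e16], fun c _ => by simp [m₁], l,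
        by simp [e15, h15], hl.congr fun b _ _ => by simp [m₁], hlt',
        ⟨l[r], List.getElem_mem hr, hrkey, not_lt.1 hcard⟩, fun J hJ => hJ⟩
    rw [if_pos hcard]
    set s₂ := (((s₁.setReg 31 (a + r * (n + 1) + n)).setReg 31 l[r].card).setReg 32
      (a + l.length * (n + 1) + n)).setReg 32 I.card with hs₂
    set s₃ := (s₂.setReg 28 (a + l.length * (n + 1) + 0)).setReg 29 (a + r * (n + 1) + 0) with hs₃
    have k₃ : Keeps 25 60 s s₃ := by simp [hs₃, hs₂, k₁]
    have m₃ : s₃.mem = s.mem := m₁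
    refine (copyRow_spec (a := a + l.length * (n + 1)) (b := a + r * (n + 1))
      (hs.keeps k₃ fun _ _ => by rw [m₃]) (by simp [hs₃]) (by simp [hs₃])
      (Or.inr (by omega))).mono ?_
    rintro s₄ t₄ ⟨ht₄, k₄, hcopy, hrest⟩
    refine ⟨by omega, (k₃.trans k₄ (by norm_num) le_rfl).of_le (by norm_num) le_rfl, ?_,
      fun c hc => ?_, l.set r I, ?_, ?_, hlt'.set hIP hI hr hrkey, ?_,
      fun J hJ => hJ.set hr hrkey hcard.le⟩
    · rw [k₄.reg 16 (by norm_num), k₃.reg 16 (by norm_num)]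
    · rw [hrest c (by omega), m₃]
    · rw [k₄.reg 15 (by norm_num), k₃.reg 15 (by norm_num), h15, List.length_set]
    · exact hl.set (hIs.congr fun j hj => by rw [hcopy j hj, m₃, h15])
        fun b hb _ => by rw [hrest b hb, m₃]
    · exact ⟨I, List.mem_set hr I, rfl, le_rfl⟩

end TableMemory

/-! ### The dynamic program -/

section Generation

variable {n d m : ℕ} {G : SimpleGraph (Fin n)} {q : Fin n → Fin d → ℝ} {s s' s₁ : State}
  {P I J : Finset (Fin n)} {l l' : List (Finset (Fin n))} {a b : ℕ} {v : Fin n}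

/-- The table under construction, from the address `reg 11` up to the address `reg 15`. -/
structure OpenTable (G : SimpleGraph (Fin n)) (P : Finset (Fin n)) (l : List (Finset (Fin n)))
    (a : ℕ) (s : State) : Prop where
  start : s.reg 11 = a
  fin : s.reg 15 = a + l.length * (n + 1)
  rows : HasTable G P l a s
  isTable : IsTable G P l

theorem AddsSet.openTable (h : AddsSet G P l J a s s') (ht : OpenTable G P l a s) :
    ∃ l', OpenTable G P l' a s' ∧ Covers G P l' J ∧ ∀ J', Covers G P l J' → Covers G P l' J' := by
  obtain ⟨l', h1, h2, h3, h4⟩ := h.table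
  exact ⟨l', ⟨by rw [h.keeps.reg 11 (by norm_num), ht.start], h1, h2, h3⟩, h4⟩

/-- Adding a set whose row has been written to the end of the table. -/
theorem insertRow_spec_of_keeps (hs : Ctx G q s) (hP : HasMarks P s) (ha : n * n + 2 * n ≤ a)
    (ht : OpenTable G P l a s) (hlm : l.length ≤ m) (hJP : J ⊆ P)
    (hJ : G.IsIndepSet (J : Set (Fin n))) (hk : Keeps 28 60 s s₁)
    (hmem : ∀ c < s.reg 15, s₁.mem c = s.mem c) (hrow : HasSet G P J (s.reg 15) s₁) :
    Exec insertRow s₁ fun s' t => t ≤ insertTime n m ∧ AddsSet G P l J a s s' := by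
  have h15 := ht.fin
  refine (insertRow_spec (a := a) (hs.keeps hk fun c hc => hmem c (by omega))
    (fun w => by rw [hmem _ (by omega), hP]) (by rw [hk.reg 11 (by norm_num), ht.start])
    (by rw [hk.reg 15 (by norm_num), h15]) (ht.rows.congr fun c _ hc => hmem c (by omega))
    ht.isTable hlm hJP hJ (by rw [hk.reg 15 (by norm_num)]; exact hrow)).mono ?_
  rintro s' t ⟨h1, h2⟩
  exact ⟨h1, (hk.of_le (by norm_num) le_rfl).trans h2.keeps le_rfl le_rfl,
    by rw [h2.reg16, hk.reg 16 (by norm_num)], fun c hc => by rw [h2.mem c hc, hmem c (by omega)],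
    h2.table⟩

theorem key_insert : key G (insert v P) I = (key G P I).erase v := by
  ext w
  simp only [mem_key, mem_insert, not_or, mem_erase, and_assoc]

theorem mem_row_insert (hI : I ⊆ P) (hv : v ∉ P) (w : Fin n) :
    w ∈ I ∪ key G (insert v P) I ↔ w ≠ v ∧ w ∈ I ∪ key G P I := by
  have : w ∈ I → w ≠ v := fun h h' => hv (h' ▸ hI h)
  rw [key_insert, mem_union, mem_union, mem_erase]
  tauto

theorem mem_row_insert_insert (hI : I ⊆ P) (w : Fin n) :
    w ∈ insert v I ∪ key G (insert v P) (insert v I) ↔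
      w = v ∨ (w ∉ insert v P ∧ G.Adj v w) ∨ w ∈ I ∪ key G P I := by
  have : w ∈ I → w ∈ P := fun h => hI h
  simp only [mem_union, mem_insert, mem_key, not_or, exists_eq_or_imp]
  tauto

/-- Add the set of the row at the address `reg 16` to the new table. -/
def skipRow : Program := block [.add 28 16 2, .add 29 15 2, copyRow, .add 31 15 13, .store 31 2,
  insertRow]

/-- Add the set of the row at the address `reg 16`, together with the vertex `reg 13`, to the new
table. -/
def takeRow : Program := block [.add 28 16 2, .add 29 15 2, copyRow,
  forTo 30 0 (block [.add 31 14 30, .load 31 31, .add 32 5 30, .load 32 32,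
    .ifLt 32 31 (block [.add 31 15 30, .store 31 1]) .skip]),
  .add 31 15 13, .store 31 1, .add 31 15 0, .load 32 31, .add 32 32 1, .store 31 32, insertRow]

theorem skipRow_spec (hs : Ctx G q s) (hP : HasMarks (insert v P) s) (ha : n * n + 2 * n ≤ a)
    (ht : OpenTable G (insert v P) l a s) (hlm : l.length ≤ m) (hv : v ∉ P) (hIP : I ⊆ P)
    (hI : G.IsIndepSet (I : Set (Fin n))) (h13 : s.reg 13 = v)
    (h16 : s.reg 16 + (n + 1) ≤ a) (hrow : HasSet G P I (s.reg 16) s) :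
    Exec skipRow s fun s' t => t ≤ insertTime n m + rowTime n + 10 ∧
      AddsSet G (insert v P) l I a s s' := by
  have h15 := ht.fin
  unfold skipRow
  simp only [exec_block_cons, exec_block_nil, exec_add, exec_store]
  set s₁ := (s.setReg 28 (s.reg 16 + s.reg 2)).setReg 29
    ((s.setReg 28 (s.reg 16 + s.reg 2)).reg 15 + (s.setReg 28 (s.reg 16 + s.reg 2)).reg 2) with hs₁
  have k₁ : Keeps 28 60 s s₁ := by simp [hs₁]
  refine (copyRow_spec (a := s.reg 16) (b := s.reg 15) (hs.keeps k₁ fun _ _ => rfl)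
    (by simp [hs₁, hs.reg2]) (by simp [hs₁, hs.reg2]) (Or.inl (by omega))).mono ?_
  rintro s₂ t₂ ⟨ht₂, k₂, hcopy, hrest⟩
  have m₁ : s₁.mem = s.mem := rfl
  replace k₂ : Keeps 28 60 s s₂ := k₁.trans k₂ (by norm_num) le_rfl
  have e15 := k₂.reg 15 (by norm_num)
  have e13 := (k₂.reg 13 (by norm_num)).trans h13
  have e2 := (k₂.reg 2 (by norm_num)).trans hs.reg2
  have hm : ∀ c, ((s₂.setReg 31 (s₂.reg 15 + s₂.reg 13)).setMem
      ((s₂.setReg 31 (s₂.reg 15 + s₂.reg 13)).reg 31)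
      ((s₂.setReg 31 (s₂.reg 15 + s₂.reg 13)).reg 2)).mem c =
      if c = s.reg 15 + v then 0 else s₂.mem c := fun c => by
    simp [mem_setMem, e15, e13, e2]
  refine (insertRow_spec_of_keeps hs hP ha ht hlm (hIP.trans (subset_insert _ _)) hI
    (by simp [k₂]) (fun c hc => ?_) ⟨fun w => ?_, ?_⟩).mono ?_
  · rw [hm, if_neg (by omega), hrest c (Or.inl hc), m₁]
  · rw [hm, hcopy w (by omega), m₁, hrow.entry]
    simp only [mem_row_insert hIP hv]
    by_cases hw : w = v
    · simp [hw]
    · simp [hw, Fin.ext_iff.not.1 hw]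
  · rw [hm, if_neg (by omega), hcopy n (by omega), m₁, hrow.size]
  · rintro s₃ t₃ ⟨ht₃, h3⟩
    exact ⟨by omega, h3⟩

theorem takeRow_spec (hs : Ctx G q s) (hP : HasMarks (insert v P) s) (ha : n * n + 2 * n ≤ a)
    (ht : OpenTable G (insert v P) l a s) (hlm : l.length ≤ m) (hv : v ∉ P) (hIP : I ⊆ P)
    (hI : G.IsIndepSet (I : Set (Fin n))) (hvI : v ∉ key G P I) (h13 : s.reg 13 = v)
    (h14 : s.reg 14 = v * n) (h16 : s.reg 16 + (n + 1) ≤ a) (hrow : HasSet G P I (s.reg 16) s) :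
    Exec takeRow s fun s' t => t ≤ insertTime n m + 2 * rowTime n + 20 ∧
      AddsSet G (insert v P) l (insert v I) a s s' := by
  have h15 := ht.fin
  unfold takeRow
  simp only [exec_block_cons, exec_block_nil, exec_add]
  set s₁ := (s.setReg 28 (s.reg 16 + s.reg 2)).setReg 29
    ((s.setReg 28 (s.reg 16 + s.reg 2)).reg 15 + (s.setReg 28 (s.reg 16 + s.reg 2)).reg 2) with hs₁
  have k₁ : Keeps 28 60 s s₁ := by simp [hs₁]
  refine (copyRow_spec (a := s.reg 16) (b := s.reg 15) (hs.keeps k₁ fun _ _ => rfl)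
    (by simp [hs₁, hs.reg2]) (by simp [hs₁, hs.reg2]) (Or.inl (by omega))).mono ?_
  rintro s₂ t₂ ⟨ht₂, k₂, hcopy, hrest⟩
  have m₁ : s₁.mem = s.mem := rfl
  rw [m₁] at hcopy hrest
  replace k₂ : Keeps 28 60 s s₂ := k₁.trans k₂ (by norm_num) le_rfl
  refine (exec_forTo (N := n) (T := 10) (fun k s' => Keeps 28 60 s s' ∧ s'.reg 30 = k ∧
    (∀ c, c < s.reg 15 → s'.mem c = s.mem c) ∧ s'.mem (s.reg 15 + n) = I.card ∧
    ∀ w : Fin n, s'.mem (s.reg 15 + w) =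
      if ((w : ℕ) < k ∧ w ∉ insert v P ∧ G.Adj v w) ∨ w ∈ I ∪ key G P I then 1 else 0)
    ?_ ?_ ?_).mono ?_
  · refine ⟨by simp [k₂], by simp, fun c hc => hrest c (Or.inl hc), ?_, fun w => ?_⟩
    · rw [mem_setReg, hcopy n (by omega), hrow.size]
    · simp [hcopy w (by omega), hrow.entry]
  · rintro k s' ⟨h1, h2, -⟩
    exact ⟨by rw [h1.reg 0 (by norm_num), hs.reg0], h2⟩
  · rintro k s' hk ⟨h1, h2, h3, h4, h5⟩
    obtain ⟨u, rfl⟩ : ∃ u : Fin n, k = u := ⟨⟨k, hk⟩, rfl⟩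
    have e1 := (h1.reg 1 (by norm_num)).trans hs.reg1
    have e5 := (h1.reg 5 (by norm_num)).trans hs.reg5
    have e14 := (h1.reg 14 (by norm_num)).trans h14
    have e15 := h1.reg 15 (by norm_num)
    have hlt := addr_lt v u
    have f1 : s'.mem (v * n + u) = if G.Adj v u then 1 else 0 := by
      rw [h3 _ (by omega), hs.adj]
    have f2 : s'.mem (n * n + u) = if u ∈ insert v P then 1 else 0 := by
      rw [h3 _ (by omega), hP]
    simp only [exec_block_cons, exec_block_nil, exec_add, exec_load, exec_ifLt, reg_setReg,
      mem_setReg, if_true, h2, e14, e5, f1, exec_skip, exec_store]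
    norm_num only
    have hcond : ((if u ∈ insert v P then 1 else 0) < (if G.Adj v u then 1 else 0)) ↔
        u ∉ insert v P ∧ G.Adj v u := by
      by_cases h6 : u ∈ insert v P <;> by_cases h7 : G.Adj v u <;> simp [h6, h7]
    simp only [if_false, f2, hcond]
    have hstep : ∀ (w : Fin n), ¬ (w = u ∧ (w ∉ insert v P ∧ G.Adj v w)) →
        (((w : ℕ) < u + 1 ∧ w ∉ insert v P ∧ G.Adj v w) ∨ w ∈ I ∪ key G P I ↔
        ((w : ℕ) < u ∧ w ∉ insert v P ∧ G.Adj v w) ∨ w ∈ I ∪ key G P I) := by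
      intro w hw
      rw [Nat.lt_succ_iff_lt_or_eq, ← Fin.ext_iff]
      tauto
    by_cases hu : u ∉ insert v P ∧ G.Adj v u
    · rw [if_pos hu]
      refine ⟨by simp, by simp [h2], by simp [e1], by simp [h1], by simp, fun c hc => ?_, ?_,
        fun w => ?_⟩
      · simp [mem_setMem, e15]
        rw [if_neg (by omega), h3 c hc]
      · simp [mem_setMem, e15]
        rw [if_neg (by omega), h4]
      · simp [mem_setMem, e15, e1]
        by_cases hw : w = u
        · subst hw
          simp [hu.2, not_or.1 (mem_insert.not.1 hu.1)]
        · rw [if_neg (Fin.ext_iff.not.1 hw), h5, if_congr (hstep w fun h => hw h.1).symm rfl rfl]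
          simp
    · rw [if_neg hu]
      refine ⟨by simp, by simp, by simp [e1], by simp [h1], by simp, h3, h4, fun w => ?_⟩
      rw [h5, if_congr (hstep w fun h => hu (h.1 ▸ h.2)).symm rfl rfl]
  rintro s₃ t₃ ⟨ht₃, k₃, -, m₃, hsize, hentry⟩
  have e15 := k₃.reg 15 (by norm_num)
  have e13 := (k₃.reg 13 (by norm_num)).trans h13
  have e1 := (k₃.reg 1 (by norm_num)).trans hs.reg1
  have e0 := (k₃.reg 0 (by norm_num)).trans hs.reg0
  simp only [exec_store, exec_load]
  set s₄ := s₃.setReg 31 (s₃.reg 15 + s₃.reg 13) with hs₄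
  set s₅ := (s₄.setMem (s₄.reg 31) (s₄.reg 1)).setReg 31
    ((s₄.setMem (s₄.reg 31) (s₄.reg 1)).reg 15 + (s₄.setMem (s₄.reg 31) (s₄.reg 1)).reg 0) with hs₅
  have m₅ : ∀ c, s₅.mem c = if c = s.reg 15 + v then 1 else s₃.mem c := fun c => by
    simp [hs₅, hs₄, mem_setMem, e15, e13, e1]
  have r₅ : s₅.reg 31 = s.reg 15 + n := by simp [hs₅, hs₄, e15, e0]
  have k₅ : Keeps 28 60 s s₅ := by simp [hs₅, hs₄, k₃]
  set s₆ := s₅.setReg 32 (s₅.mem (s₅.reg 31)) with hs₆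
  set s₇ := s₆.setReg 32 (s₆.reg 32 + s₆.reg 1) with hs₇
  have m₇ : ∀ c, (s₇.setMem (s₇.reg 31) (s₇.reg 32)).mem c =
      if c = s.reg 15 + n then I.card + 1 else if c = s.reg 15 + v then 1 else s₃.mem c :=
    fun c => by
      have f1 := (k₅.reg 1 (by norm_num)).trans hs.reg1
      have f2 : s₅.mem (s.reg 15 + n) = I.card := by rw [m₅, if_neg (by omega), hsize]
      rw [mem_setMem, ← m₅ c]
      simp [hs₇, hs₆, r₅, f1, f2]
  refine (insertRow_spec_of_keeps hs hP ha ht hlm (insert_subset_insert _ hIP)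
    (isIndepSet_insert hI hv hvI) (by simp [hs₇, hs₆, k₅]) (fun c hc => ?_)
    ⟨fun w => ?_, ?_⟩).mono ?_
  · rw [m₇, if_neg (by omega), if_neg (by omega), m₃ c hc]
  · rw [m₇, if_neg (by omega), hentry]
    simp only [mem_row_insert_insert hIP]
    by_cases hw : w = v
    · simp [hw]
    · rw [if_neg fun h => hw (Fin.ext (by omega))]
      simp [hw]
  · rw [m₇, if_pos rfl, card_insert_of_notMem fun h => hv (hIP h)]
  · rintro s₈ t₈ ⟨ht₈, h8⟩
    unfold rowTime at *
    exact ⟨by omega, h8⟩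

end Generation

section DynamicProgram

variable {n d m : ℕ} {G : SimpleGraph (Fin n)} {q : Fin n → Fin d → ℝ} {s s' s₁ : State}
  {P I J : Finset (Fin n)} {l l' : List (Finset (Fin n))} {a b : ℕ} {v : Fin n} {M : ℝ}

/-- Add the extensions of the set of the row at the address `reg 16` to the new table, and go to
the next row. -/
def extendRow : Program := block [skipRow, .add 31 16 13, .load 31 31, ifEq 31 2 takeRow .skip,
  .add 16 16 8]

/-- A bound for the running time of `extendRow`. -/
def extendTime (n m : ℕ) : ℕ := 2 * insertTime n m + 3 * rowTime n + 50

/-- The sets that the extensions of `I` by `v` require in the table `l`. -/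
def CoversExtensions (G : SimpleGraph (Fin n)) (P : Finset (Fin n)) (v : Fin n)
    (l : List (Finset (Fin n))) (I : Finset (Fin n)) : Prop :=
  Covers G (insert v P) l I ∧ (v ∉ key G P I → Covers G (insert v P) l (insert v I))

theorem extendRow_spec (hs : Ctx G q s) (hP : HasMarks (insert v P) s) (ha : n * n + 2 * n ≤ a)
    (ht : OpenTable G (insert v P) l a s)
    (hm : ∀ l, IsTable G (insert v P) l → l.length ≤ m) (hv : v ∉ P) (hIP : I ⊆ P)
    (hI : G.IsIndepSet (I : Set (Fin n))) (h13 : s.reg 13 = v) (h14 : s.reg 14 = v * n)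
    (h16 : s.reg 16 + (n + 1) ≤ a) (hrow : HasSet G P I (s.reg 16) s) :
    Exec extendRow s fun s' t => t ≤ extendTime n m ∧ Keeps 15 60 s s' ∧
      s'.reg 16 = s.reg 16 + (n + 1) ∧ (∀ c < a, s'.mem c = s.mem c) ∧
      ∃ l', OpenTable G (insert v P) l' a s' ∧ CoversExtensions G P v l' I ∧
        ∀ J, Covers G (insert v P) l J → Covers G (insert v P) l' J := by
  unfold extendRow
  simp only [exec_block_cons, exec_block_nil, exec_add, exec_load]
  refine (skipRow_spec hs hP ha ht (hm l ht.isTable) hv hIP hI h13 h16 hrow).mono ?_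
  rintro s₁ t₁ ⟨ht₁, h₁⟩
  obtain ⟨l₁, hl₁, hI₁, hc₁⟩ := h₁.openTable ht
  set s₂ := (s₁.setReg 31 (s₁.reg 16 + s₁.reg 13)).setReg 31
    ((s₁.setReg 31 (s₁.reg 16 + s₁.reg 13)).mem ((s₁.setReg 31 (s₁.reg 16 + s₁.reg 13)).reg 31))
    with hs₂
  have hvrow : s.mem (s.reg 16 + v) = if v ∈ key G P I then 1 else 0 := by
    rw [hrow.entry]
    simp only [mem_union, show v ∉ I from fun h => hv (hIP h), false_or]
  have e31 : s₂.reg 31 = if v ∈ key G P I then 1 else 0 := by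
    simp [hs₂, h₁.reg16, h₁.keeps.reg 13 (by norm_num), h13]
    rw [h₁.mem _ (by omega), hvrow]
  have k₂ : Keeps 15 60 s s₂ := by simp [hs₂, h₁.keeps]
  have e16 : s₂.reg 16 = s.reg 16 := by simp [hs₂, h₁.reg16]
  have e8 := (k₂.reg 8 (by norm_num)).trans hs.reg8
  have e2 := (k₂.reg 2 (by norm_num)).trans hs.reg2
  have m₂ : ∀ c < a, s₂.mem c = s.mem c := h₁.mem
  have o₂ : OpenTable G (insert v P) l₁ a s₂ :=
    ⟨by simp [hs₂, hl₁.start], by simp [hs₂, hl₁.fin], hl₁.rows.congr fun _ _ _ => rfl,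
      hl₁.isTable⟩
  simp only [exec_ifEq, e31, e2, exec_skip]
  by_cases hvk : v ∈ key G P I
  · rw [if_neg (by simp [hvk])]
    refine ⟨by unfold extendTime; omega, by simp [k₂], by simp [e16, e8], fun c hc => m₂ c hc, l₁,
      ⟨?_, ?_, o₂.rows.congr fun _ _ _ => rfl, o₂.isTable⟩, ⟨hI₁, fun h => absurd hvk h⟩, hc₁⟩
    · simp [o₂.start]
    · simp [o₂.fin]
  · rw [if_pos (by simp [hvk])]
    refine (takeRow_spec (hs.keeps k₂ fun c hc => m₂ c (by omega))
      (fun w => by rw [m₂ _ (by omega), hP]) ha o₂ (hm l₁ o₂.isTable) hv hIP hI hvk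
      (by rw [k₂.reg 13 (by norm_num), h13]) (by rw [k₂.reg 14 (by norm_num), h14])
      (by rw [e16]; exact h16) (hrow.congr fun j hj => by rw [e16, m₂ _ (by omega)])).mono ?_
    rintro s₃ t₃ ⟨ht₃, h₃⟩
    obtain ⟨l₃, hl₃, hI₃, hc₃⟩ := h₃.openTable o₂
    refine ⟨by unfold extendTime; omega, ?_, ?_, fun c hc => ?_, l₃,
      ⟨?_, ?_, hl₃.rows.congr fun _ _ _ => rfl, hl₃.isTable⟩, ⟨hc₃ _ hI₁, fun _ => hI₃⟩,
      fun J hJ => hc₃ J (hc₁ J hJ)⟩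
    · simpa using k₂.trans h₃.keeps le_rfl le_rfl
    · simp [h₃.reg16, e16, h₃.keeps.reg 8, e8]
    · rw [mem_setReg, h₃.mem c hc, m₂ c hc]
    · simp [hl₃.start]
    · simp [hl₃.fin]

/-- The machine state between two steps of the dynamic program: the registers `10` and `11` delimit
a full table for the marked vertices. -/
structure TableState (G : SimpleGraph (Fin n)) (q : Fin n → Fin d → ℝ) (P : Finset (Fin n))
    (l : List (Finset (Fin n))) (s : State) : Prop where
  ctx : Ctx G q s
  marks : HasMarks P s
  start : n * n + 2 * n ≤ s.reg 10
  fin : s.reg 11 = s.reg 10 + l.length * (n + 1)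
  rows : HasTable G P l (s.reg 10) s
  full : IsFullTable G P l

/-- Compute a full table for the marked vertices and the vertex `reg 13` from a full table for the
marked vertices. -/
def extendTable : Program := block [.add 31 5 13, .store 31 1, .add 15 11 2, .add 16 10 2,
  .whileLt 16 11 extendRow, .add 10 11 2, .add 11 15 2]

/-- A bound for the running time of `extendTable`. -/
def extendTableTime (n m : ℕ) : ℕ := m * (n + 1) * (extendTime n m + 1) + 20

theorem extendTable_spec (h : TableState G q P l s) (hv : v ∉ P) (hlm : l.length ≤ m)
    (hm : ∀ l, IsTable G (insert v P) l → l.length ≤ m) (h13 : s.reg 13 = v)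
    (h14 : s.reg 14 = v * n) :
    Exec extendTable s fun s' t => t ≤ extendTableTime n m ∧ Keeps 10 60 s s' ∧
      s'.reg 12 = s.reg 12 ∧ (∀ c, n * n + n ≤ c → c < n * n + 2 * n → s'.mem c = s.mem c) ∧
      ∃ l', TableState G q (insert v P) l' s' := by
  have hs := h.ctx
  have h10 := h.start
  have h11 := h.fin
  unfold extendTable
  simp only [exec_block_cons, exec_block_nil, exec_add, exec_store]
  set s₁ := (s.setReg 31 (s.reg 5 + s.reg 13)).setMem ((s.setReg 31 (s.reg 5 + s.reg 13)).reg 31)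
    ((s.setReg 31 (s.reg 5 + s.reg 13)).reg 1) with hs₁
  set s₂ := (s₁.setReg 15 (s₁.reg 11 + s₁.reg 2)).setReg 16
    ((s₁.setReg 15 (s₁.reg 11 + s₁.reg 2)).reg 10 + (s₁.setReg 15 (s₁.reg 11 + s₁.reg 2)).reg 2)
    with hs₂
  have k₂ : Keeps 15 60 s s₂ := by simp [hs₂, hs₁]
  have m₂ : ∀ c, s₂.mem c = if c = n * n + v then 1 else s.mem c := fun c => by
    simp [hs₂, hs₁, mem_setMem, hs.reg5, hs.reg1, h13]
  have e15 : s₂.reg 15 = s.reg 11 := by simp [hs₂, hs₁, hs.reg2]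
  have e16 : s₂.reg 16 = s.reg 10 := by simp [hs₂, hs₁, hs.reg2]
  have e11 := k₂.reg 11 (by norm_num)
  have hs2 : Ctx G q s₂ := hs.keeps k₂ fun c hc => by rw [m₂, if_neg (by omega)]
  have hP2 : HasMarks (insert v P) s₂ := fun w => by
    rw [m₂, h.marks]
    by_cases hw : w = v
    · simp [hw]
    · rw [if_neg fun h => hw (Fin.ext (by omega))]
      simp [hw]
  have hrows : HasTable G P l (s.reg 10) s₂ := h.rows.congr fun c hc _ => by
    rw [m₂, if_neg (by omega)]
  refine (exec_while (T := extendTime n m) (fun s' => Keeps 15 60 s₂ s' ∧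
    (∀ c < s.reg 11, s'.mem c = s₂.mem c) ∧ ∃ r ≤ l.length, s'.reg 16 = s.reg 10 + r * (n + 1) ∧
    ∃ l', OpenTable G (insert v P) l' (s.reg 11) s' ∧
      ∀ i (hi : i < l.length), i < r → CoversExtensions G P v l' l[i])
    (fun s' => s.reg 11 - s'.reg 16) ?_ _ ?_).mono ?_
  · rintro s₃ ⟨k₃, m₃, r, hr, e16', l', hl', hcov⟩ hlt
    rw [k₃.reg 11 (by norm_num), e11, e16', h11] at hlt
    have hrl : r < l.length := by
      by_contra hcon
      have := Nat.mul_le_mul_right (n + 1) (not_lt.1 hcon)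
      omega
    have hnext := mul_add_le_mul hrl (n + 1)
    refine (extendRow_spec (hs2.keeps k₃ fun c hc => m₃ c (by omega))
      (fun w => by rw [m₃ _ (by omega), hP2]) (by omega) hl' hm hv
      (h.full.1.subset _ (List.getElem_mem hrl)) (h.full.1.indep _ (List.getElem_mem hrl))
      (by rw [k₃.reg 13 (by norm_num), k₂.reg 13 (by norm_num), h13])
      (by rw [k₃.reg 14 (by norm_num), k₂.reg 14 (by norm_num), h14]) (by omega)
      ((hrows r hrl).congr fun j hj => by rw [e16', m₃ _ (by omega)])).mono ?_
    rintro s₄ t₄ ⟨ht₄, k₄, e16₄, m₄, l₄, hl₄, hcov₄, hmono⟩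
    refine ⟨ht₄, ⟨k₃.trans k₄ le_rfl le_rfl, fun c hc => by rw [m₄ c hc, m₃ c hc], r + 1, hrl,
      by rw [e16₄, e16']; ring, l₄, hl₄, fun i hi hir => ?_⟩, by omega⟩
    rcases Nat.lt_succ_iff_lt_or_eq.1 hir with hir | rfl
    · exact ⟨hmono _ (hcov i hi hir).1, fun h => hmono _ ((hcov i hi hir).2 h)⟩
    · exact hcov₄
  · refine ⟨by simp, fun _ _ => rfl, 0, Nat.zero_le _, by simp [e16], [], ⟨e11, by simp [e15],
      fun r hr => absurd hr (Nat.not_lt_zero _), IsTable.nil _⟩, fun i _ hi =>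
      absurd hi (Nat.not_lt_zero _)⟩
  · rintro s₃ t₃ ⟨ht₃, ⟨k₃, m₃, r, hr, e16', l', hl', hcov⟩, hlt⟩
    have hrl : r = l.length := by
      by_contra hcon
      have := mul_add_le_mul (lt_of_le_of_ne hr hcon) (n + 1)
      rw [k₃.reg 11 (by norm_num), e11, e16'] at hlt
      omega
    subst hrl
    have k₄ := k₂.trans k₃ le_rfl le_rfl
    have e2 := (k₄.reg 2 (by norm_num)).trans hs.reg2
    have e11' := k₄.reg 11 (by norm_num)
    have m₄ : ∀ c < s.reg 11, s₃.mem c = if c = n * n + v then 1 else s.mem c := fun c hc => by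
      rw [m₃ c hc, m₂]
    refine ⟨?_, by simp [k₄.of_le], by simp [k₄.reg 12], fun c h1 h2 => ?_, l', ⟨?_, ?_, ?_, ?_, ?_,
      h.full.step hv hl'.isTable (fun I hI => ?_) fun I hI => ?_⟩⟩
    · rw [e16, h11, Nat.add_sub_cancel_left] at ht₃
      have := Nat.mul_le_mul_right (extendTime n m + 1) (Nat.mul_le_mul_right (n + 1) hlm)
      unfold extendTableTime
      omega
    · simp only [mem_setReg]
      rw [m₄ c (by omega), if_neg (by omega)]
    · exact hs2.keeps (B := 10) (R := 60) (by simp [k₃.of_le]) fun c hc => m₃ c (by omega)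
    · exact fun w => by rw [mem_setReg, mem_setReg, m₃ _ (by omega), hP2]
    · simp [e11', e2]
      omega
    · simp [e11', e2, hl'.fin]
    · simp only [reg_setReg, e11', e2]
      exact hl'.rows.congr fun _ _ _ => rfl
    · obtain ⟨i, hi, rfl⟩ := List.getElem_of_mem hI
      exact (hcov i hi hi).1
    · obtain ⟨i, hi, rfl⟩ := List.getElem_of_mem hI
      exact (hcov i hi hi).2

/-- Compute full tables for the initial segments of the layout, starting with the single row of
zeros for the empty segment. The loop that adds up register `14` computes the address of the row of
the adjacency matrix. -/
def tableProg : Program := block [.add 10 7 2,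
  forTo 30 8 (block [.add 31 10 30, .store 31 2]), .add 11 10 8,
  forTo 12 0 (block [.add 31 6 12, .load 13 31, .const 14 0, forTo 30 0 (.add 14 14 13),
    extendTable])]

/-- A bound for the running time of `tableProg`. -/
def tableTime (n m : ℕ) : ℕ := n * (extendTableTime n m + 2 * rowTime n) + 2 * rowTime n

theorem tableProg_spec {o : List (Fin n)} (hs : Ctx G q s) (ho : IsLayout G M o s)
    (hM : ∀ x : ℕ, x ≤ M → x ≤ m) :
    Exec tableProg s fun s' t => t ≤ tableTime n m ∧ ∃ I, G.IsMaximumIndepSet I ∧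
      TableState G q univ [I] s' := by
  have hlen : o.length = n := by
    rw [← List.toFinset_card_of_nodup ho.nodup,
      eq_univ_of_forall fun v => List.mem_toFinset.2 (ho.mem v), card_univ, Fintype.card_fin]
  have hm : ∀ k l, IsTable G (o.take k).toFinset l → l.length ≤ m := fun k l hl =>
    hM _ (hl.length_le (ho.cut k))
  unfold tableProg
  simp only [exec_block_cons, exec_block_nil, exec_add]
  set s₁ := s.setReg 10 (s.reg 7 + s.reg 2) with hs₁
  refine (exec_forTo (N := n + 1) (T := 4) (fun k s' => Keeps 30 60 s₁ s' ∧ s'.reg 30 = k ∧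
    (∀ c < n * n + 2 * n, s'.mem c = s.mem c) ∧ ∀ j < k, s'.mem (n * n + 2 * n + j) = 0)
    (by simp [hs₁]) ?_ ?_).mono ?_
  · rintro k s' ⟨h1, h2, -⟩
    exact ⟨by rw [h1.reg 8 (by norm_num)]; simp [hs₁, hs.reg8], h2⟩
  · rintro k s' hk ⟨h1, h2, h3, h4⟩
    have e10 : s'.reg 10 = n * n + 2 * n := by
      rw [h1.reg 10 (by norm_num)]
      simp [hs₁, hs.reg7, hs.reg2]
    have e1 : s'.reg 1 = 1 := by
      rw [h1.reg 1 (by norm_num)]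
      simp [hs₁, hs.reg1]
    have e2 : s'.reg 2 = 0 := by
      rw [h1.reg 2 (by norm_num)]
      simp [hs₁, hs.reg2]
    simp only [exec_block_cons, exec_block_nil, exec_add, exec_store]
    refine ⟨by omega, by simp [h2], by simp [e1], by simp [h1], by simp, fun c hc => ?_,
      fun j hj => ?_⟩
    · simp [mem_setMem, e10, h2, e2]
      rw [h3 c hc, if_neg (by omega)]
    · simp [mem_setMem, e10, h2, e2]
      exact fun hjk => h4 j (by omega)
  rintro s₂ t₂ ⟨ht₂, k₂, -, m₂, hzero⟩
  set s₃ := s₂.setReg 11 (s₂.reg 10 + s₂.reg 8) with hs₃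
  have k₁₀ : Keeps 10 60 s s₂ := Keeps.trans (by simp [hs₁]) k₂ (by norm_num) le_rfl
  have k₃ : Keeps 10 60 s s₃ := by simp [hs₃, k₁₀]
  have e10 : s₃.reg 10 = n * n + 2 * n := by
    rw [hs₃, reg_setReg, if_neg (by norm_num), k₂.reg 10 (by norm_num), hs₁, reg_setReg, if_pos rfl,
      hs.reg7, hs.reg2, add_zero]
  have h0 : TableState G q (o.take 0).toFinset [∅] s₃ := by
    refine ⟨hs.keeps k₃ fun c hc => m₂ c (by omega), fun w => ?_, e10.ge, ?_, ?_, ?_⟩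
    · rw [hs₃, mem_setReg, m₂ _ (by omega), ho.label]
      simp
    · have e8 := (k₁₀.reg 8 (by norm_num)).trans hs.reg8
      have : s₃.reg 11 = s₂.reg 10 + s₂.reg 8 := by simp [hs₃]
      rw [this, e8, List.length_singleton, one_mul, e10, ← e10]
      simp [hs₃]
    · intro r hr
      obtain rfl : r = 0 := by simpa using hr
      rw [zero_mul, add_zero, e10]
      exact ⟨fun w => by simp [hs₃, hzero w (by omega), mem_key], by simp [hs₃, hzero n]⟩
    · simpa using isFullTable_singleton_empty
  refine (exec_forTo (N := n) (T := extendTableTime n m + rowTime n)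
    (fun k s' => Keeps 10 60 s s' ∧ s'.reg 12 = k ∧
      (∀ c, n * n + n ≤ c → c < n * n + 2 * n → s'.mem c = s.mem c) ∧
      ∃ l, TableState G q (o.take k).toFinset l s') ?_ ?_ ?_).mono ?_
  · refine ⟨by simp [k₃], by simp, fun c _ hc => m₂ c hc, [∅], ?_⟩
    obtain ⟨h1, h2, h3, h4, h5, h6⟩ := h0
    exact ⟨h1.keeps (B := 10) (R := 60) (by simp) fun _ _ => rfl, h2, h3, h4,
      h5.congr fun _ _ _ => rfl, h6⟩
  · rintro k s' ⟨h1, h2, -⟩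
    exact ⟨by rw [h1.reg 0 (by norm_num), hs.reg0], h2⟩
  · rintro k s' hk ⟨h1, h2, h3, l, h⟩
    have hko : k < o.length := by omega
    have htake : (o.take (k + 1)).toFinset = insert o[k] (o.take k).toFinset := by
      rw [List.take_succ_eq_append_getElem hko, List.toFinset_append]
      ext w
      simp [or_comm]
    have hnew : o[k] ∉ (o.take k).toFinset := by
      intro hmem
      obtain ⟨i, hi, hik⟩ := List.getElem_of_mem (List.mem_toFinset.1 hmem)
      rw [List.length_take] at hi
      rw [List.getElem_take] at hik
      have := (ho.nodup.getElem_inj_iff).1 hik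
      omega
    have f6 := h.ctx.reg6
    have f13 : s'.mem (n * n + n + k) = (o[k] : ℕ) := by
      rw [h3 _ (by omega) (by omega), ho.list k hko]
    simp only [exec_block_cons, exec_block_nil, exec_add, exec_load, exec_const]
    set s₄ := ((s'.setReg 31 (s'.reg 6 + s'.reg 12)).setReg 13 ((s'.setReg 31
      (s'.reg 6 + s'.reg 12)).mem ((s'.setReg 31 (s'.reg 6 + s'.reg 12)).reg 31))).setReg 14 0
      with hs₄
    have k₄ : Keeps 13 60 s' s₄ := by simp [hs₄]
    have e13 : s₄.reg 13 = o[k] := by simp [hs₄, f6, h2, f13]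
    refine (exec_forTo (N := n) (T := 1) (fun j s'' => Keeps 14 60 s₄ s'' ∧ s''.mem = s₄.mem ∧
      s''.reg 30 = j ∧ s''.reg 14 = o[k] * j) (by simp [hs₄]) ?_ ?_).mono ?_
    · rintro j s'' ⟨g1, -, g2, -⟩
      exact ⟨by rw [g1.reg 0 (by norm_num), k₄.reg 0 (by norm_num), h.ctx.reg0], g2⟩
    · rintro j s'' hj ⟨g1, g2, g3, g4⟩
      have g5 := (g1.reg 13 (by norm_num)).trans e13
      have g6 := (g1.reg 1 (by norm_num)).trans ((k₄.reg 1 (by norm_num)).trans h.ctx.reg1)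
      rw [exec_add]
      refine ⟨le_rfl, by simp [g3], by simp [g6], by simp [g1], by simp [g2], by simp, ?_⟩
      simp [g4, g5]
      ring
    rintro s₅ t₅ ⟨ht₅, k₅, m₅, -, e14⟩
    have k₆ : Keeps 13 60 s' s₅ := k₄.trans k₅ (by norm_num) le_rfl
    have m₆ : s₅.mem = s'.mem := m₅
    have h5 : TableState G q (o.take k).toFinset l s₅ := by
      refine ⟨h.ctx.keeps k₆ fun _ _ => by rw [m₆], fun w => by rw [m₆, h.marks],
        by rw [k₆.reg 10 (by norm_num)]; exact h.start, ?_, ?_, h.full⟩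
      · rw [k₆.reg 10 (by norm_num), k₆.reg 11 (by norm_num), h.fin]
      · rw [k₆.reg 10 (by norm_num)]
        exact h.rows.congr fun _ _ _ => by rw [m₆]
    refine (extendTable_spec h5 hnew (hm k l h.full.1) (fun l hl => hm (k + 1) l (htake ▸ hl))
      ((k₅.reg 13 (by norm_num)).trans e13) e14).mono ?_
    rintro s₆ t₆ ⟨ht₆, k₇, e12, m₇, l', h'⟩
    have k₈ : Keeps 10 60 s' s₆ := (k₆.of_le (by norm_num) le_rfl).trans k₇ le_rfl le_rfl
    have e12' : s₆.reg 12 = k := by rw [e12, k₆.reg 12 (by norm_num), h2]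
    refine ⟨by unfold rowTime; omega, e12', h'.ctx.reg1,
      by simpa using h1.trans k₈ le_rfl le_rfl, by simp,
      fun c h1 h2 => by rw [mem_setReg, m₇ c h1 h2, m₆, h3 c h1 h2], l', ?_⟩
    rw [htake]
    obtain ⟨h1, h2, h3, h4, h5, h6⟩ := h'
    exact ⟨h1.keeps (B := 10) (R := 60) (by simp) fun _ _ => rfl, h2, h3, h4,
      h5.congr fun _ _ _ => rfl, h6⟩
  · rintro s' t ⟨ht, h1, -, -, l, h⟩
    rw [List.take_of_length_le hlen.le,
      eq_univ_of_forall fun v => List.mem_toFinset.2 (ho.mem v)] at h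
    obtain ⟨I, rfl, hI⟩ := h.full.eq_singleton
    refine ⟨?_, I, hI, h⟩
    have : n * (extendTableTime n m + rowTime n + 2) ≤ n * (extendTableTime n m + 2 * rowTime n) :=
      Nat.mul_le_mul_left _ (by unfold rowTime; omega)
    unfold tableTime
    have : (n + 1) * (4 + 2) + 10 ≤ 2 * rowTime n := by unfold rowTime; omega
    omega

/-- Write the only set in the table to the beginning of the memory. -/
def outputProg : Program := forTo 30 0 (block [.add 31 10 30, .load 31 31, .store 30 31])

theorem outputProg_spec (h : TableState G q univ [I] s) :
    Exec outputProg s fun s' t => t ≤ rowTime n ∧ output n s' = I := by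
  have hs := h.ctx
  have h10 := h.start
  have hrow := h.rows 0 (by simp)
  refine (exec_forTo (N := n) (T := 5) (fun k s' => Keeps 30 60 s s' ∧ s'.reg 30 = k ∧
    (∀ c, k ≤ c → s'.mem c = s.mem c) ∧ ∀ j < k, s'.mem j = s.mem (s.reg 10 + j))
    (by simp) ?_ ?_).mono ?_
  · rintro k s' ⟨h1, h2, -⟩
    exact ⟨by rw [h1.reg 0 (by norm_num), hs.reg0], h2⟩
  · rintro k s' hk ⟨h1, h2, h3, h4⟩
    have e10 := h1.reg 10 (by norm_num)
    have e1 := (h1.reg 1 (by norm_num)).trans hs.reg1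
    simp only [exec_block_cons, exec_block_nil, exec_add, exec_load, exec_store]
    refine ⟨by omega, by simp [h2], by simp [e1], by simp [h1], by simp, fun c hc => ?_,
      fun j hj => ?_⟩
    · simp [mem_setMem, h2]
      rw [if_neg (by omega), h3 c (by omega)]
    · simp [mem_setMem, h2, e10]
      split_ifs with hjk
      · rw [h3 _ (by omega), hjk]
      · exact h4 j (by omega)
  · rintro s' t ⟨ht, -, -, -, h4⟩
    refine ⟨by unfold rowTime; omega, ?_⟩
    ext v
    have := hrow.entry v
    simp only [zero_mul, add_zero, List.getElem_cons_zero, mem_union, mem_key] at this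
    simp [output, h4 v v.2, this]

end DynamicProgram

/-! ### The whole algorithm -/

section Algorithm

variable {n d : ℕ} {G : SimpleGraph (Fin n)} {q : Fin n → Fin d → ℝ} {s s' : State} {L m : ℝ}

/-- Compute the largest distance of the points of adjacent vertices in the real register `1`. -/
def widthProg : Program := block [.const 21 0, forTo 22 0 (forTo 23 0 (block [.load 24 21,
  .ifLt 2 24 (block [.add 50 22 2, .add 51 23 2, distProg, .ifRLt 1 50 (.radd 1 50 0) .skip]) .skip,
  .add 21 21 1]))]

/-- A bound for the running time of `widthProg`. -/
def widthTime (n d : ℕ) : ℕ := n * (n * (distTime d + 20) + 10) + 10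

theorem widthProg_spec (hs : Ctx G q s) (hr : s.rreg 1 = 0) :
    Exec widthProg s fun s' t => t ≤ widthTime n d ∧ Keeps 21 1 s s' ∧ s'.mem = s.mem ∧
      0 ≤ s'.rreg 1 ∧ (∀ u v, G.Adj u v → dist (q u) (q v) ≤ s'.rreg 1) ∧
      ∀ L, 0 ≤ L → (∀ u v, G.Adj u v → dist (q u) (q v) ≤ L) → s'.rreg 1 ≤ L := by
  unfold widthProg
  simp only [exec_block_cons, exec_block_nil, exec_const]
  refine (exec_forTo (N := n) (T := n * (distTime d + 18) + 2) (fun k s' => Keeps 21 1 s s' ∧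
    s'.mem = s.mem ∧ s'.reg 22 = k ∧ s'.reg 21 = k * n ∧ 0 ≤ s'.rreg 1 ∧
    (∀ u v : Fin n, (u : ℕ) < k → G.Adj u v → dist (q u) (q v) ≤ s'.rreg 1) ∧
    ∀ L, 0 ≤ L → (∀ u v, G.Adj u v → dist (q u) (q v) ≤ L) → s'.rreg 1 ≤ L) ?_ ?_ ?_).mono ?_
  · simp +contextual [hr]
  · rintro k s' ⟨h1, -, h2, -⟩
    exact ⟨by rw [h1.reg 0 (by norm_num), hs.reg0], h2⟩
  · rintro k s' hk ⟨h1, h2, h3, h4, h5, h6, h7⟩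
    obtain ⟨a, rfl⟩ : ∃ a : Fin n, k = a := ⟨⟨k, hk⟩, rfl⟩
    refine (exec_forTo (N := n) (T := distTime d + 16) (fun j s'' => Keeps 21 1 s s'' ∧
      s''.mem = s.mem ∧ s''.reg 22 = a ∧ s''.reg 23 = j ∧ s''.reg 21 = a * n + j ∧ 0 ≤ s''.rreg 1 ∧
      (∀ u v : Fin n, (u : ℕ) < a ∨ u = a ∧ (v : ℕ) < j → G.Adj u v →
        dist (q u) (q v) ≤ s''.rreg 1) ∧
      ∀ L, 0 ≤ L → (∀ u v, G.Adj u v → dist (q u) (q v) ≤ L) → s''.rreg 1 ≤ L) ?_ ?_ ?_).mono ?_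
    · refine ⟨by simp [h1], h2, by simp [h3], by simp, by simp [h4], by simpa using h5,
        fun u v huv h => ?_, h7⟩
      exact h6 u v (huv.resolve_right fun h => Nat.not_lt_zero _ h.2) h
    · rintro j s'' ⟨g1, -, -, g2, -⟩
      exact ⟨by rw [g1.reg 0 (by norm_num), hs.reg0], g2⟩
    · rintro j s₁ hj ⟨g1, g2, g3, g4, g5, g6, g7, g8⟩
      obtain ⟨b, rfl⟩ : ∃ b : Fin n, j = b := ⟨⟨j, hj⟩, rfl⟩
      have f0 := (g1.rreg 0 (by norm_num)).trans hs.rreg0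
      have f1 := (g1.reg 1 (by norm_num)).trans hs.reg1
      have f2 := (g1.reg 2 (by norm_num)).trans hs.reg2
      have f3 : s₁.mem (a * n + b) = if G.Adj a b then 1 else 0 := by rw [g2, hs.adj]
      have hsplit : ∀ u v : Fin n, (u : ℕ) < a ∨ u = a ∧ (v : ℕ) < b + 1 →
          ((u : ℕ) < a ∨ u = a ∧ (v : ℕ) < b) ∨ u = a ∧ v = b := by
        intro u v h
        rw [Nat.lt_succ_iff_lt_or_eq, ← Fin.ext_iff] at h
        tauto
      simp only [exec_block_cons, exec_block_nil, exec_load, exec_ifLt, exec_skip, exec_add,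
        reg_setReg, if_true, g5, f3, f2]
      norm_num only
      simp only [if_false, g3, g4]
      set s₂ := s₁.setReg 24 (if G.Adj a b then 1 else 0) with hs₂
      by_cases hab : G.Adj a b
      · rw [if_pos (by simp [hab])]
        set s₃ := (s₂.setReg 50 (a + 0)).setReg 51 (b + 0) with hs₃
        have k₃ : Keeps 24 50 s₁ s₃ := by simp [hs₃, hs₂]
        have hs3 : Ctx G q s₃ := hs.keeps (B := 21) (R := 1) (s' := s₃)
          (g1.trans k₃ (by norm_num) (by norm_num)) fun _ _ => by
            have : s₃.mem = s₁.mem := rfl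
            rw [this, g2]
        refine (distProg_spec (u := a) (v := b) hs3 (by simp [hs₃]) (by simp [hs₃])).mono ?_
        rintro s₄ t₄ ⟨ht₄, k₄, m₄, d₄⟩
        replace k₄ : Keeps 24 50 s₁ s₄ := k₃.trans k₄ (by norm_num) le_rfl
        replace m₄ : s₄.mem = s.mem := m₄.trans g2
        have e1 := (k₄.reg 1 (by norm_num)).trans f1
        have e21 := (k₄.reg 21 (by norm_num)).trans g5
        have e22 := (k₄.reg 22 (by norm_num)).trans g3
        have e23 := (k₄.reg 23 (by norm_num)).trans g4
        have r0 := (k₄.rreg 0 (by norm_num)).trans f0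
        have r1 := k₄.rreg 1 (by norm_num)
        have k₅ : Keeps 21 1 s s₄ := g1.trans k₄ (by norm_num) (by norm_num)
        simp only [exec_ifRLt, exec_radd, exec_skip, r1, d₄]
        split_ifs with hlt
        · refine ⟨by omega, by simp [e23], by simp [e1], by simp [k₅], m₄, by simp [e22], by simp,
            by simp [e21, e1, add_assoc], ?_, fun u v huv h => ?_, fun L hL h => ?_⟩
          · simp [r0]
          · simp [r0]
            rcases hsplit u v huv with huv | ⟨rfl, rfl⟩
            exacts [(g7 u v huv h).trans hlt.le, le_rfl]
          · simpa [d₄, r0] using h a b hab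
        · refine ⟨by omega, by simp [e23], by simp [e1], by simp [k₅], m₄, by simp [e22], by simp,
            by simp [e21, e1, add_assoc], ?_, fun u v huv h => ?_, fun L hL h => ?_⟩
          · simp [r1, g6]
          · simp [r1]
            rcases hsplit u v huv with huv | ⟨rfl, rfl⟩
            exacts [g7 u v huv h, not_lt.1 hlt]
          · simpa [r1] using g8 L hL h
      · rw [if_neg (by simp [hab])]
        refine ⟨by omega, by simp [hs₂, g4], by simp [hs₂, f1], by simp [hs₂, g1], g2,
          by simp [hs₂, g3], by simp, by simp [hs₂, g5, f1, add_assoc], g6,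
          fun u v huv h => ?_, g8⟩
        rcases hsplit u v huv with huv | ⟨rfl, rfl⟩
        exacts [g7 u v huv h, absurd h hab]
    · rintro s₁ t₁ ⟨ht₁, g1, g2, g3, -, g5, g6, g7, g8⟩
      have f1 := (g1.reg 1 (by norm_num)).trans hs.reg1
      refine ⟨ht₁, g3, f1, by simp [g1], g2, by simp, ?_, g6, fun u v hu h => ?_, g8⟩
      · simp [g5]
        ring
      · rcases Nat.lt_succ_iff_lt_or_eq.1 hu with hu | hu
        exacts [g7 u v (Or.inl hu) h, g7 u v (Or.inr ⟨Fin.ext hu, v.2⟩) h]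
  · rintro s₁ t₁ ⟨ht₁, g1, g2, -, -, g6, g7, g8⟩
    refine ⟨?_, g1, g2, g6, fun u v => g7 u v u.2, g8⟩
    have : n * (n * (distTime d + 18) + 2 + 2) ≤ n * (n * (distTime d + 20) + 10) :=
      Nat.mul_le_mul_left _ (by
        have := Nat.mul_le_mul_left n (show distTime d + 18 ≤ distTime d + 20 by omega)
        omega)
    unfold widthTime
    omega

theorem mul_add_inj {a b x y w : ℕ} (hx : x < w) (hy : y < w) (h : a * w + x = b * w + y) :
    a = b ∧ x = y := by
  have h1 : (a * w + x) % w = x := by rw [Nat.mul_add_mod_self_right, Nat.mod_eq_of_lt hx]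
  have h2 : (b * w + y) % w = y := by rw [Nat.mul_add_mod_self_right, Nat.mod_eq_of_lt hy]
  have h3 : x = y := by rw [← h1, h, h2]
  subst h3
  exact ⟨Nat.eq_of_mul_eq_mul_right (by omega) (Nat.add_right_cancel h), rfl⟩

theorem input_mem (p : Fin n → EuclideanSpace ℝ (Fin d)) (i j : Fin n) :
    (input G p).mem (i * n + j) = if G.Adj i j then 1 else 0 := by
  unfold input
  refine if_congr ⟨?_, fun h => ⟨i, j, rfl, h⟩⟩ rfl rfl
  rintro ⟨i', j', h, hadj⟩
  obtain ⟨h1, h2⟩ := mul_add_inj j.2 j'.2 h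
  rwa [Fin.ext h1, Fin.ext h2]

theorem input_rmem (p : Fin n → EuclideanSpace ℝ (Fin d)) (i : Fin n) (k : Fin d) :
    (input G p).rmem (i * d + k) = p i k := by
  have h : ∃ ij : Fin n × Fin d, (i : ℕ) * d + k = ij.1 * d + ij.2 := ⟨(i, k), rfl⟩
  have h' : h.choose = (i, k) := by
    obtain ⟨h1, h2⟩ := mul_add_inj k.2 h.choose.2.2 h.choose_spec
    exact Prod.ext (Fin.ext h1).symm (Fin.ext h2).symm
  change (if h : _ then _ else _) = _
  rw [dif_pos h, h']

/-- Set up the global data and compute the largest distance of the points of adjacent vertices. -/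
def initProg (d : ℕ) : Program := block [.const 1 1, .const 3 d,
  .const 4 (ballRatio d), forTo 10 0 (.add 5 5 0), .add 6 5 0, .add 7 6 0, .add 8 0 1,
  forTo 10 0 (block [.add 11 5 10, .store 11 1]), widthProg]

/-- A bound for the running time of `initProg`. -/
def initTime (n d : ℕ) : ℕ := widthTime n d + rowTime n

theorem initProg_spec (p : Fin n → EuclideanSpace ℝ (Fin d)) :
    Exec (initProg d) (input G p) fun s' t => t ≤ initTime n d ∧ Ctx G (fun i => (p i).ofLp) s' ∧
      (∀ v : Fin n, s'.mem (n * n + v) = 1) ∧ 0 ≤ s'.rreg 1 ∧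
      (∀ u v, G.Adj u v → dist (p u).ofLp (p v).ofLp ≤ s'.rreg 1) ∧
      ∀ L, 0 ≤ L → (∀ u v, G.Adj u v → dist (p u).ofLp (p v).ofLp ≤ L) → s'.rreg 1 ≤ L := by
  have i0 : (input G p).reg 0 = n := rfl
  have i1 : ∀ a, (input G p).reg (a + 1) = 0 := fun a => rfl
  have ir : ∀ a, (input G p).rreg a = 0 := fun a => rfl
  unfold initProg
  simp only [exec_block_cons, exec_block_nil, exec_const, exec_add]
  set s₁ := (((input G p).setReg 1 1).setReg 3 d).setReg 4 (ballRatio d) with hs₁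
  refine (exec_forTo (N := n) (T := 1) (fun k s' => Keeps 5 60 s₁ s' ∧ s'.mem = s₁.mem ∧
    s'.reg 10 = k ∧ s'.reg 5 = n * k) (by simp [hs₁, i1]) ?_ ?_).mono ?_
  · rintro k s' ⟨h1, -, h2, -⟩
    exact ⟨by rw [h1.reg 0 (by norm_num)]; simp [hs₁, i0], h2⟩
  · rintro k s' hk ⟨h1, h2, h3, h4⟩
    have e0 : s'.reg 0 = n := by rw [h1.reg 0 (by norm_num)]; simp [hs₁, i0]
    have e1 : s'.reg 1 = 1 := by rw [h1.reg 1 (by norm_num)]; simp [hs₁]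
    rw [exec_add]
    exact ⟨le_rfl, by simp [h3], by simp [e1], by simp [h1], by simp [h2], by simp,
      by simp [h4, e0]; ring⟩
  rintro s₂ t₂ ⟨ht₂, k₂, m₂, -, e5⟩
  set s₃ := s₂.setReg 6 (s₂.reg 5 + s₂.reg 0) with hs₃
  set s₄ := s₃.setReg 7 (s₃.reg 6 + s₃.reg 0) with hs₄
  set s₅ := s₄.setReg 8 (s₄.reg 0 + s₄.reg 1) with hs₅
  have e0 : s₂.reg 0 = n := by rw [k₂.reg 0 (by norm_num)]; simp [hs₁, i0]
  have e1 : s₂.reg 1 = 1 := by rw [k₂.reg 1 (by norm_num)]; simp [hs₁]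
  have h5 : Ctx G (fun i => (p i).ofLp) s₅ := by
    refine ⟨by simp [hs₅, hs₄, hs₃, e0], by simp [hs₅, hs₄, hs₃, e1], ?_, ?_, ?_,
      by simp [hs₅, hs₄, hs₃, e5], by simp [hs₅, hs₄, hs₃, e5, e0], ?_,
      by simp [hs₅, hs₄, hs₃, e0, e1], ?_, fun i j => ?_, fun i k => ?_⟩
    · simp [hs₅, hs₄, hs₃, k₂.reg 2]
      simp [hs₁, i1]
    · simp [hs₅, hs₄, hs₃, k₂.reg 3]
      simp [hs₁]
    · simp [hs₅, hs₄, hs₃, k₂.reg 4]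
      simp [hs₁]
    · simp [hs₅, hs₄, hs₃, e5, e0]
      ring
    · simp [hs₅, hs₄, hs₃, k₂.rreg 0]
      simp [hs₁, ir]
    · rw [← input_mem p]
      exact congrFun m₂ _
    · rw [← input_rmem (G := G) p]
      exact congrFun k₂.rmem _
  have r5 : s₅.rreg 1 = 0 := by
    simp [hs₅, hs₄, hs₃, k₂.rreg 1]
    simp [hs₁, ir]
  refine (exec_forTo (N := n) (T := 3) (fun k s' => Keeps 10 60 s₅ s' ∧ s'.reg 10 = k ∧
    (∀ c < n * n, s'.mem c = s₅.mem c) ∧ ∀ j < k, s'.mem (n * n + j) = 1) (by simp) ?_ ?_).mono ?_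
  · rintro k s' ⟨h1, h2, -⟩
    exact ⟨by rw [h1.reg 0 (by norm_num), h5.reg0], h2⟩
  · rintro k s' hk ⟨h1, h2, h3, h4⟩
    have f1 := (h1.reg 1 (by norm_num)).trans h5.reg1
    have f5 := (h1.reg 5 (by norm_num)).trans h5.reg5
    simp only [exec_block_cons, exec_block_nil, exec_add, exec_store]
    refine ⟨by omega, by simp [h2], by simp [f1], by simp [h1], by simp, fun c hc => ?_,
      fun j hj => ?_⟩
    · simp [mem_setMem, f5, h2]
      rw [if_neg (by omega), h3 c hc]
    · simp [mem_setMem, f5, h2, f1]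
      exact fun hjk => h4 j (by omega)
  rintro s₆ t₆ ⟨ht₆, k₆, -, m₆, hlab⟩
  refine (widthProg_spec (h5.keeps k₆ m₆) (by rw [k₆.rreg 1 (by norm_num), r5])).mono ?_
  rintro s₇ t₇ ⟨ht₇, k₇, m₇, hL⟩
  exact ⟨by unfold initTime rowTime; omega,
    (h5.keeps k₆ m₆).keeps k₇ fun _ _ => by rw [m₇], fun v => by rw [m₇, hlab v v.2], hL⟩

/-- The algorithm: compute a layout of the graph by recursively splitting the point set with
separators made of few cliques, and solve the problem by dynamic programming along the layout. -/
def misProg (d : ℕ) : Program := block [initProg d, layoutProg, tableProg, outputProg]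

/-- A bound for the running time of `misProg` if the tables have at most `m` rows. -/
def misTime (n d m : ℕ) : ℕ :=
  initTime n d + layoutTime n d + tableTime n m + rowTime n + 1

theorem misProg_spec (hd : 2 ≤ d) (p : Fin n → EuclideanSpace ℝ (Fin d)) (hL0 : 0 ≤ L) (hm : 1 ≤ m)
    (hadj : ∀ u v, G.Adj u v → dist (p u).ofLp (p v).ofLp ≤ L)
    (hG : LocallyCovered G (fun i => (p i).ofLp) L m) :
    Exec (misProg d) (input G p) fun s' t =>
      t ≤ misTime n d ⌊Real.exp (cutExpo d (m ^ (1 / (d : ℝ))) n)⌋₊ ∧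
      G.IsMaximumIndepSet (output n s') := by
  unfold misProg
  simp only [exec_block_cons, exec_block_nil]
  refine (initProg_spec p).mono ?_
  rintro s₁ t₁ ⟨ht₁, h1, hlab, hL1, hadj1, hLmin⟩
  -- The computed width is at most `L`, and local coverage for `L` implies that for smaller widths.
  have hG1 : LocallyCovered G (fun i => (p i).ofLp) (s₁.rreg 1) m := fun T hT =>
    hG T fun u hu v hv => (hT u hu v hv).trans (hLmin L hL0 hadj)
  refine (layoutProg_spec hd hL1 hm hadj1 hG1 h1 rfl hlab).mono ?_
  rintro s₂ t₂ ⟨ht₂, h2, o, ho⟩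
  refine (tableProg_spec h2 ho fun x hx => Nat.le_floor hx).mono ?_
  rintro s₃ t₃ ⟨ht₃, I, hI, h3⟩
  refine (outputProg_spec h3).mono ?_
  rintro s₄ t₄ ⟨ht₄, h4⟩
  exact ⟨by unfold misTime; omega, h4 ▸ hI⟩

end Algorithm

/-! ### The running time -/

section Time

variable {n d m : ℕ}

theorem insertTime_le (hn : 1 ≤ n) (hm : 1 ≤ m) : insertTime n m ≤ 360 * (m * n ^ 2) :=
  calc insertTime n m ≤ (m + m) * ((n + n) * (90 * n)) := by
        unfold insertTime rowTime
        gcongr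
        omega
    _ = 360 * (m * n ^ 2) := by ring

theorem tableTime_le (hn : 1 ≤ n) (hm : 1 ≤ m) : tableTime n m ≤ 2300 * (n ^ 4 * m ^ 2) := by
  have h1 : rowTime n ≤ 60 * n := by
    unfold rowTime
    omega
  have h2 : extendTime n m ≤ 950 * (m * n ^ 2) := by
    have e1 := insertTime_le hn hm
    have e2 : n ≤ m * n ^ 2 := by nlinarith [Nat.mul_le_mul hm (Nat.mul_le_mul hn hn)]
    unfold extendTime
    omega
  have h3 : extendTableTime n m ≤ 1922 * (n ^ 3 * m ^ 2) := by
    have e1 : 1 ≤ m * n ^ 2 := Nat.mul_pos hm (pow_pos hn 2)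
    have e2 : 1 ≤ n ^ 3 * m ^ 2 := Nat.mul_pos (pow_pos hn 3) (pow_pos hm 2)
    calc extendTableTime n m ≤ m * (n + n) * (950 * (m * n ^ 2) + m * n ^ 2) +
          20 * (n ^ 3 * m ^ 2) := by
          unfold extendTableTime
          gcongr
          omega
      _ = 1922 * (n ^ 3 * m ^ 2) := by ring
  have e1 : n ≤ n ^ 3 * m ^ 2 := by
    calc n = n ^ 1 * 1 := by ring
      _ ≤ n ^ 3 * m ^ 2 := Nat.mul_le_mul (Nat.pow_le_pow_right hn (by norm_num))
          (Nat.one_le_pow _ _ hm)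
  have e2 : n ^ 3 * m ^ 2 ≤ n ^ 4 * m ^ 2 :=
    Nat.mul_le_mul_right _ (Nat.pow_le_pow_right hn (by norm_num))
  calc tableTime n m ≤ n * (1922 * (n ^ 3 * m ^ 2) + 2 * (60 * (n ^ 3 * m ^ 2))) +
        2 * (60 * (n ^ 4 * m ^ 2)) := by
        unfold tableTime
        gcongr <;> omega
    _ = 2162 * (n ^ 4 * m ^ 2) := by ring
    _ ≤ 2300 * (n ^ 4 * m ^ 2) := by gcongr; norm_num

theorem layoutTime_le (hn : 1 ≤ n) : initTime n d + layoutTime n d + rowTime n + 1 ≤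
    3000 * (distTime d * n ^ 4) := by
  have hD : 1 ≤ distTime d := by
    unfold distTime
    omega
  unfold initTime layoutTime stepTime classifyTime shellTime cubeTime countTime widthTime rowTime
  generalize distTime d = D at *
  have h1 : ∀ k ≤ 4, D * n ^ k ≤ D * n ^ 4 := fun k hk =>
    Nat.mul_le_mul_left _ (Nat.pow_le_pow_right hn hk)
  have h2 : ∀ k ≤ 4, n ^ k ≤ D * n ^ 4 := fun k hk =>
    (Nat.le_mul_of_pos_left _ hD).trans (h1 k hk)
  linarith [h1 0 (by norm_num), h1 1 (by norm_num), h1 2 (by norm_num), h1 3 (by norm_num),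
    h2 0 (by norm_num), h2 1 (by norm_num), h2 2 (by norm_num), h2 3 (by norm_num),
    h2 4 (by norm_num)]

/-- The running time is polynomial in the number of vertices and the size of the tables. -/
theorem misTime_le (d : ℕ) : ∃ A : ℕ, ∀ n m : ℕ, 1 ≤ n → 1 ≤ m →
    misTime n d m ≤ A * (n ^ 4 * m ^ 2) := by
  refine ⟨3000 * distTime d + 2300, fun n m hn hm => ?_⟩
  have h1 := layoutTime_le (d := d) hn
  have h2 := tableTime_le hn hm
  have h3 : distTime d * n ^ 4 ≤ distTime d * (n ^ 4 * m ^ 2) :=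
    Nat.mul_le_mul_left _ (Nat.le_mul_of_pos_right _ (pow_pos hm 2))
  unfold misTime
  rw [add_mul, mul_assoc]
  omega

theorem cutExpo_le (hd : 2 ≤ d) {K α : ℝ} (hK : 1 ≤ K) (hα : 1 ≤ α) :
    cutExpo d ((K * α ^ d) ^ (1 / (d : ℝ))) n ≤ expoConst d * K * ((n : ℝ) ^ expo d * α) := by
  have hd0 : (d : ℝ) ≠ 0 := by positivity
  have h1 : (K * α ^ d) ^ (1 / (d : ℝ)) ≤ K * α := by
    rw [Real.mul_rpow (by linarith) (by positivity), one_div,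
      Real.pow_rpow_inv_natCast (by linarith) (by omega)]
    gcongr
    refine Real.rpow_le_self_of_one_le hK ?_
    exact inv_le_one_of_one_le₀ (by exact_mod_cast (by omega : 1 ≤ d))
  have h2 := expoConst_pos hd
  unfold cutExpo
  calc expoConst d * ((K * α ^ d) ^ (1 / (d : ℝ)) * (n : ℝ) ^ expo d)
      ≤ expoConst d * (K * α * (n : ℝ) ^ expo d) := by gcongr
    _ = _ := by ring

theorem misTime_floor_le (hd : 2 ≤ d) {A : ℕ}
    (hA : ∀ n m : ℕ, 1 ≤ n → 1 ≤ m → misTime n d m ≤ A * (n ^ 4 * m ^ 2)) (hn : 1 ≤ n)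
    {E B α : ℝ} (hE0 : 0 ≤ E) (hα : 1 ≤ α) (hE : E ≤ B * ((n : ℝ) ^ expo d * α)) :
    (misTime n d ⌊Real.exp E⌋₊ : ℝ) ≤
      (2 : ℝ) ^ ((A + 8 + 2 * B) / Real.log 2 * ((n : ℝ) ^ expo d * α)) := by
  have hn' : (1 : ℝ) ≤ n := by exact_mod_cast hn
  set x := (n : ℝ) ^ expo d * α with hx
  have hsqrt : √(n : ℝ) ≤ x := by
    rw [Real.sqrt_eq_rpow]
    calc (n : ℝ) ^ (1 / 2 : ℝ) ≤ (n : ℝ) ^ expo d :=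
          Real.rpow_le_rpow_of_exponent_le hn' (half_le_expo hd)
      _ ≤ x := le_mul_of_one_le_right (by positivity) hα
  have hx1 : 1 ≤ x := (Real.one_le_sqrt.2 hn').trans hsqrt
  have hn4 : (n : ℝ) ^ 4 ≤ Real.exp (8 * x) := by
    have h1 : √(n : ℝ) ≤ Real.exp x := by linarith [Real.add_one_le_exp x]
    calc (n : ℝ) ^ 4 = √(n : ℝ) ^ 8 := by
          rw [show 8 = 2 * 4 by norm_num, pow_mul, Real.sq_sqrt (by linarith)]
      _ ≤ Real.exp x ^ 8 := by gcongr
      _ = Real.exp (8 * x) := by rw [← Real.exp_nat_mul]; norm_num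
  have hA' : (A : ℝ) ≤ Real.exp (A * x) := by
    have h1 := Real.add_one_le_exp (A * x)
    nlinarith [Nat.cast_nonneg (α := ℝ) A]
  have hm : (⌊Real.exp E⌋₊ : ℝ) ^ 2 ≤ Real.exp (2 * B * x) := by
    calc (⌊Real.exp E⌋₊ : ℝ) ^ 2 ≤ Real.exp E ^ 2 := by
          gcongr
          exact Nat.floor_le (Real.exp_nonneg _)
      _ = Real.exp (2 * E) := by rw [← Real.exp_nat_mul]; norm_num
      _ ≤ Real.exp (2 * B * x) := Real.exp_le_exp.2 (by linarith)
  have h1 : 1 ≤ ⌊Real.exp E⌋₊ := Nat.le_floor (by simpa using hE0)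
  calc (misTime n d ⌊Real.exp E⌋₊ : ℝ) ≤ A * ((n : ℝ) ^ 4 * (⌊Real.exp E⌋₊ : ℝ) ^ 2) := by
        exact_mod_cast hA n _ hn h1
    _ ≤ Real.exp (A * x) * (Real.exp (8 * x) * Real.exp (2 * B * x)) := by gcongr
    _ = Real.exp (Real.log 2 * ((A + 8 + 2 * B) / Real.log 2 * x)) := by
        rw [← Real.exp_add, ← Real.exp_add]
        congr 1
        field_simp
        ring
    _ = _ := (Real.rpow_def_of_pos (by norm_num) _).symm

end Time

end StabbedMIS

/-- For every dimension `d ≥ 2` there is an algorithm for maximum independent set on intersection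
graphs of similarly sized `α`-stabbed objects in `ℝ^d` that runs in time `2 ^ O(n ^ (1 - 1/d) α)`;
the constant in the exponent does not depend on `α`. -/
theorem theorem1 (d : ℕ) (hd : 2 ≤ d) (σ κ : ℝ) (hσ : 1 ≤ σ) (hκ : 0 ≤ κ) :
    ∃ (P : RealRAM.Program) (C : ℝ), 0 < C ∧
      ∀ (α : ℝ), 1 ≤ α →
      ∀ (n : ℕ), 1 ≤ n →
      ∀ (o : Fin n → Set (EuclideanSpace ℝ (Fin d))) (p : Fin n → EuclideanSpace ℝ (Fin d)),
        (∀ i, Bornology.IsBounded (o i)) → SimilarlySized σ o → IsStabbed α o → Locates κ p o →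
        ∃ (s : RealRAM.State) (t : ℕ),
          RealRAM.Runs P (RealRAM.input (intersectionGraph o) p) s t ∧
          (t : ℝ) ≤ (2 : ℝ) ^ (C * ((n : ℝ) ^ (1 - 1 / (d : ℝ)) * α)) ∧
          (intersectionGraph o).IsMaximumIndepSet (RealRAM.output n s) := by
  obtain ⟨K, hK, hcov⟩ := StabbedMIS.exists_locallyCovered (d := d) σ κ hσ hκ
  obtain ⟨A, hA⟩ := StabbedMIS.misTime_le d
  have hB : 0 < StabbedMIS.expoConst d * K := mul_pos (StabbedMIS.expoConst_pos hd) (by linarith)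
  refine ⟨StabbedMIS.misProg d, (A + 8 + 2 * (StabbedMIS.expoConst d * K)) / Real.log 2,
    div_pos (by positivity) (Real.log_pos (by norm_num)), fun α hα n hn o p h1 h2 h3 h4 => ?_⟩
  obtain ⟨L, hL, hadj, hG⟩ := hcov α hα n hn o p h1 h2 h3 h4
  have hm : 1 ≤ K * α ^ d := one_le_mul_of_one_le_of_one_le hK (one_le_pow₀ hα)
  obtain ⟨s, t, hrun, ht, hs⟩ := StabbedMIS.misProg_spec hd p hL hm hadj hG
  refine ⟨s, t, hrun, (Nat.cast_le.2 ht).trans ?_, hs⟩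
  exact StabbedMIS.misTime_floor_le hd hA hn
    (mul_nonneg (StabbedMIS.expoConst_pos hd).le (by positivity)) hα (StabbedMIS.cutExpo_le hd hK hα)
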